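/- Setting. Let $n,m\ge 1$ and $p_1,\dots,p_n\ge1$ be integers. For each learner $i\in[n]=\{1,\dots,n\}$ let $\mathbb X_i\subseteq\mathbb R^{p_i}$ be closed and convex with $r_i\mathbb B^{p_i}\subseteq\mathbb X_i\subseteq R_i\mathbb B^{p_i}$, $r_i,R_i>0$ ($\mathbb B^{p}$ is the closed unit ball and $\mathbb S^{p}$ the unit sphere of $\mathbb R^{p}$), and put $\mathbb X=\mathbb X_1\times\dots\times\mathbb X_n$. Let $u_{i,t}$ ($i\in[n]$, $t\ge1$) be independent random vectors, $u_{i,t}$ uniform on $\mathbb S^{p_i}$. At each round $t\ge 1$ an adaptive adversary chooses $f_{i,t}:\mathbb X_i\to\mathbb R$ and $g_{i,t}:\mathbb X_i\to\mathbb R^m$, which may depend on $(u_{j,s})_{j\in[n],s<t}$. The functions $f_{i,t}$ and $[g_{i,t}]_j$, $j\in[m]$, are convex and differentiable on $\mathbb X_i$, with $|f_{i,t}|\le F_{f_i}$, $|[g_{i,t}]_j|\le F_{g_i}$, $\|\nabla f_{i,t}\|\le G_{f_i}$, $\|\nabla[g_{i,t}]_j\|\le G_{g_i}$ on $\mathbb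 X_i$, where $F_{f_i},F_{g_i},G_{f_i},G_{g_i}>0$ do not depend on $t$. Write $f_t(x)=\sum_i f_{i,t}(x_i)$ and $g_t(x)=\sum_i g_{i,t}(x_i)$, and assume that for every $T\ge1$ there is an $x\in\mathbb X$ with $g_t(x)\le 0$ componentwise for all $t\in[T]$. The learners communicate over directed graphs $([n],\mathcal E_t)$ with mixing matrices $W_t$: $[W_t]_{ij}>0$ if $(j,i)\in\mathcal E_t$ or $i=j$, and $[W_t]_{ij}=0$ otherwise. There are $w\in(0,1)$ and an integer $\iota>0$ such that for all $t\ge1$: every positive entry of $W_t$ is at least $w$, $W_t$ is doubly stochastic, and $([n],\mathcal E_t\cup\dots\cup\mathcal E_{t+\iota-1})$ is strongly connected. Algorithm. Let $\theta_1\in(3/4,5/6]$, $\theta_2=2\theta_1-3/2$, $\theta_3=\theta_1-1/2$ and $$\alpha_{i,t}=\frac{r_i^2}{4mp_i^2F_{g_i}^2t^{\theta_1}},\quad \beta_{t}=\frac2{t^{\theta_2}},\quad \gamma_{t}=\frac1{t^{1-\theta_2}},\quad \xi_{t}=\frac1{(t+1)^{\theta_3}},\quad \delta_{i,t}=\frac{r_i}{(t+1)^{\theta_3}}.$$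 Start from any fixed $z_{i,1}\in(1-\xi_1)\mathbb X_i$, from $x_{i,1}=z_{i,1}+\delta_{i,1}u_{i,1}$ and $q_{i,1}=0$, and for $t\ge2$ let $$\tilde q_{i,t}=\sum_j[W_{t-1}]_{ij}q_{j,t-1},\qquad a_{i,t}=\frac{p_i}{\delta_{i,t-1}}\Big(f_{i,t-1}(x_{i,t-1})+\tilde q_{i,t}^\top g_{i,t-1}(x_{i,t-1})\Big)u_{i,t-1},$$ $$z_{i,t}=\mathcal P_{(1-\xi_t)\mathbb X_i}(z_{i,t-1}-\alpha_{i,t}a_{i,t}),\quad x_{i,t}=z_{i,t}+\delta_{i,t}u_{i,t},\quad q_{i,t}=[(1-\beta_t\gamma_t)\tilde q_{i,t}+\gamma_t g_{i,t-1}(x_{i,t-1})]_+,$$ where $\mathcal P_K$ is the Euclidean projection onto $K$ and $[\cdot]_+$ the componentwise positive part. Put $x_t=(x_{1,t},\dots,x_{n,t})$. Claim. For every $T\ge1$, if $\check x^*_T$ minimizes $\sum_{t=1}^Tf_t(x)$ over all $x\in\mathbb X$ with $g_t(x)\le0$ for $t\in[T]$ (the optimal static decision in hindsight), then $$\mathbf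 E\Big[\sum_{t=1}^Tf_t(x_t)-\sum_{t=1}^Tf_t(\check x^*_T)\Big]\le C_1T^{\theta_1},\qquad \mathbf E\Big[\Big\|\Big[\sum_{t=1}^Tg_t(x_t)\Big]_+\Big\|\Big]\le\sqrt{C_2}\,T^{7/4-\theta_1}$$ (both random variables being integrable), where, with $F_g=\max_iF_{g_i}$, $\tau=(1-\frac w{2n^2})^{-2}$, $\lambda=(1-\frac w{2n^2})^{1/\iota}$ and $C_0=\frac{6mn^2F_g^2\tau}{1-\lambda}+2mnF_g^2$, $$C_1=\sum_{i=1}^n\Big(\frac{mF_gG_{g_i}(2r_i+R_i)}{1-\theta_3+\theta_2}+\frac{G_{f_i}(2r_i+R_i)}{1-\theta_3}+\frac{8mp_i^2F_{g_i}^2R_i^2}{r_i^2}+\frac{F_{f_i}^2}{4mF_{g_i}^2(1-\theta_1+2\theta_3)}+\frac{16mp_i^2F_{g_i}^2R_i^2}{r_i^2}\Big)+\frac{C_0}{\theta_2},$$ $$C_2=2n\Big(1+\max_{i}\frac{F_{f_i}^2}{F_{g_i}^2(1-\theta_1+2\theta_3)}+\frac1{1-\theta_2}\Big)\Big(2\sum_{i=1}^nF_{f_i}+C_1\Big).$$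 In particular the expected static regret is $O(T^{\theta_1})$ and the expected constraint violation is $O(T^{7/4-\theta_1})$. -/

import Mathlib

open MeasureTheory ProbabilityTheory
open scoped Pointwise

noncomputable section

namespace DBCO

/-- `ℝᵏ` with the Euclidean norm. -/
abbrev Vec (k : ℕ) : Type := EuclideanSpace ℝ (Fin k)

/-- `[v]₊`, the projection onto the nonnegative orthant: the componentwise positive part. -/
def orthantProj {m : ℕ} (v : Vec m) : Vec m := WithLp.toLp 2 fun j => max (v j) 0

/-- `y` is the Euclidean projection of `x` onto `K`, i.e. `y = argmin_{y ∈ K} ‖x - y‖²`. -/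
def IsProjection {k : ℕ} (K : Set (Vec k)) (x y : Vec k) : Prop :=
  y ∈ K ∧ ∀ y' ∈ K, ‖x - y‖ ^ 2 ≤ ‖x - y'‖ ^ 2

/-- The one-point sampling gradient estimator `(k / δ) φ(z + δ v) v` of `φ` at `z`. -/
def onePointGrad {k : ℕ} (δ : ℝ) (φ : Vec k → ℝ) (z v : Vec k) : Vec k :=
  ((k : ℝ) / δ * φ (z + δ • v)) • v

/-- The uniform probability distribution on the unit sphere of `ℝᵏ` (normalized surface
measure). -/
def uniformSphere (k : ℕ) : Measure (Metric.sphere (0 : Vec k) 1) :=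
  ((volume : Measure (Vec k)).toSphere Set.univ)⁻¹ • (volume : Measure (Vec k)).toSphere

/-! ### The communication graphs -/

/-- `W` is a mixing matrix of the directed graph `G`: `W i j > 0` if `(j, i)` is an edge or
`i = j`, and `W i j = 0` otherwise. -/
def IsMixingMatrix {n : ℕ} (G : Digraph (Fin n)) (W : Matrix (Fin n) (Fin n) ℝ) : Prop :=
  ∀ i j, ((G.Adj j i ∨ i = j) → 0 < W i j) ∧ (¬ (G.Adj j i ∨ i = j) → W i j = 0)

/-- The assumption on the time-varying graphs `G t` and their mixing matrices `W t`, `t ≥ 1`. -/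
structure GraphAssumption {n : ℕ} (G : ℕ → Digraph (Fin n))
    (W : ℕ → Matrix (Fin n) (Fin n) ℝ) (w : ℝ) (ι : ℕ) : Prop where
  w_pos : 0 < w
  w_lt_one : w < 1
  ι_pos : 0 < ι
  mixing : ∀ t, 1 ≤ t → IsMixingMatrix (G t) (W t)
  lower : ∀ t, 1 ≤ t → ∀ i j, 0 < W t i j → w ≤ W t i j
  doubly : ∀ t, 1 ≤ t → W t ∈ doublyStochastic ℝ (Fin n)
  /-- the union of the edge sets at the times `t, …, t + ι - 1` is strongly connected -/
  connected : ∀ t, 1 ≤ t → ∀ i j,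
    Relation.ReflTransGen (fun a b => ∃ l < ι, (G (t + l)).Adj a b) i j

/-! ### Decision sets, losses and constraints -/

/-- Each decision set is closed, convex and lies between two balls around the origin. -/
structure SetAssumption {n : ℕ} {p : Fin n → ℕ} (X : (i : Fin n) → Set (Vec (p i)))
    (r R : Fin n → ℝ) : Prop where
  r_pos : ∀ i, 0 < r i
  R_pos : ∀ i, 0 < R i
  convex : ∀ i, Convex ℝ (X i)
  closed : ∀ i, IsClosed (X i)
  inner_ball : ∀ i, Metric.closedBall 0 (r i) ⊆ X i
  outer_ball : ∀ i, X i ⊆ Metric.closedBall 0 (R i)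

/-- The assumption on one scalar function on a decision set `K`: convex, bounded by `F`,
differentiable, with gradient bounded by `G`. Only the values on `K` matter. -/
structure FunAssumption {k : ℕ} (K : Set (Vec k)) (φ : Vec k → ℝ) (F G : ℝ) : Prop where
  convex : ConvexOn ℝ K φ
  bounded : ∀ x ∈ K, |φ x| ≤ F
  differentiable : DifferentiableOn ℝ φ K
  grad_bounded : ∀ x ∈ K, ‖gradientWithin φ K x‖ ≤ G

/-- The σ-algebra generated by all the directions `u j s` with `1 ≤ s < t`, `j ∈ [n]`. -/
abbrev past {n : ℕ} {p : Fin n → ℕ} {Ω : Type*}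
    (u : (i : Fin n) → ℕ → Ω → Metric.sphere (0 : Vec (p i)) 1) (t : ℕ) : MeasurableSpace Ω :=
  ⨆ (j : Fin n) (s : ℕ) (_ : 1 ≤ s ∧ s < t), MeasurableSpace.comap (u j s) inferInstance

/-- The loss and constraint functions `f i t ω`, `g i t ω`, `t ≥ 1`, chosen by an adaptive
adversary: at round `t` they may depend on the learners' randomness of the rounds before `t`.
They satisfy the regularity assumption with uniform constants. -/
structure AdversaryAssumption {n m : ℕ} {p : Fin n → ℕ} {Ω : Type*}
    (X : (i : Fin n) → Set (Vec (p i)))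
    (u : (i : Fin n) → ℕ → Ω → Metric.sphere (0 : Vec (p i)) 1)
    (f : (i : Fin n) → ℕ → Ω → Vec (p i) → ℝ) (g : (i : Fin n) → ℕ → Ω → Vec (p i) → Vec m)
    (Ff Fg Gf Gg : Fin n → ℝ) : Prop where
  Ff_pos : ∀ i, 0 < Ff i
  Fg_pos : ∀ i, 0 < Fg i
  Gf_pos : ∀ i, 0 < Gf i
  Gg_pos : ∀ i, 0 < Gg i
  adapted_f : ∀ i t, 1 ≤ t → ∀ x ∈ X i, Measurable[past u t] fun ω => f i t ω x
  adapted_g : ∀ i t, 1 ≤ t → ∀ x ∈ X i, ∀ j, Measurable[past u t] fun ω => g i t ω x j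
  loss : ∀ i t ω, 1 ≤ t → FunAssumption (X i) (f i t ω) (Ff i) (Gf i)
  constraint : ∀ i t ω, 1 ≤ t → ∀ j,
    FunAssumption (X i) (fun x => g i t ω x j) (Fg i) (Gg i)

/-- The directions `u i t`, `i ∈ [n]`, `t ≥ 1`, are independent, and each is uniformly
distributed on the unit sphere of `ℝ^{p i}`. -/
structure IsUniformSampling {n : ℕ} {p : Fin n → ℕ} {Ω : Type*} [MeasurableSpace Ω]
    (μ : Measure Ω) (u : (i : Fin n) → ℕ → Ω → Metric.sphere (0 : Vec (p i)) 1) : Prop where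
  measurable : ∀ i t, 1 ≤ t → Measurable (u i t)
  uniform : ∀ i t, 1 ≤ t → μ.map (u i t) = uniformSphere (p i)
  indep : iIndepFun (fun k : Fin n × ℕ => u k.1 (k.2 + 1)) μ

/-! ### The algorithm -/

/-- The update direction of learner `i` computed from the samples of one round:
`∇̂₁f(z) + (∇̂₁g(z))ᵀ q̃`, the rows of `∇̂₁g(z)` being the estimators of the components of `g`. -/
def direction {k m : ℕ} (δ : ℝ) (φ : Vec k → ℝ) (ψ : Vec k → Vec m) (z v : Vec k)
    (qt : Vec m) : Vec k :=
  onePointGrad δ φ z v + ∑ j, qt j • onePointGrad δ (fun y => ψ y j) z v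

/-- `z, x, q, qt` are the sequences generated by distributed bandit online descent with the
one-point sampling gradient estimator (rounds are numbered from `1`; `qt` is `q̃`), with stepsizes
`α, β, γ`, shrinkage coefficients `ξ` and exploration parameters `δ`. -/
structure IsOnePointRun {n m : ℕ} {p : Fin n → ℕ} {Ω : Type*}
    (W : ℕ → Matrix (Fin n) (Fin n) ℝ) (X : (i : Fin n) → Set (Vec (p i)))
    (u : (i : Fin n) → ℕ → Ω → Metric.sphere (0 : Vec (p i)) 1)
    (f : (i : Fin n) → ℕ → Ω → Vec (p i) → ℝ) (g : (i : Fin n) → ℕ → Ω → Vec (p i) → Vec m)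
    (α β γ ξ δ : Fin n → ℕ → ℝ)
    (z x : (i : Fin n) → ℕ → Ω → Vec (p i)) (q qt : Fin n → ℕ → Ω → Vec m) : Prop where
  /-- the starting points are arbitrary fixed points of the shrunken decision sets -/
  z_init : ∀ i, ∃ c ∈ (1 - ξ i 1) • X i, ∀ ω, z i 1 ω = c
  q_init : ∀ i ω, q i 1 ω = 0
  x_eq : ∀ i t ω, 1 ≤ t → x i t ω = z i t ω + δ i t • (u i t ω : Vec (p i))
  qt_step : ∀ i t ω, 1 ≤ t → qt i (t + 1) ω = ∑ j, W t i j • q j t ω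
  z_step : ∀ i t ω, 1 ≤ t →
    IsProjection ((1 - ξ i (t + 1)) • X i)
      (z i t ω - α i (t + 1) •
        direction (δ i t) (f i t ω) (g i t ω) (z i t ω) (u i t ω : Vec (p i)) (qt i (t + 1) ω))
      (z i (t + 1) ω)
  q_step : ∀ i t ω, 1 ≤ t →
    q i (t + 1) ω = orthantProj ((1 - β i (t + 1) * γ i (t + 1)) • qt i (t + 1) ω
      + γ i (t + 1) • g i t ω (x i t ω))

/-! The choice of the stepsizes, shrinkage coefficients and exploration parameters. -/

def alpha {n : ℕ} (m : ℕ) (p : Fin n → ℕ) (r Fg : Fin n → ℝ) (θ₁ : ℝ) (i : Fin n) (t : ℕ) : ℝ :=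
  r i ^ 2 / (4 * m * (p i : ℝ) ^ 2 * Fg i ^ 2 * (t : ℝ) ^ θ₁)

def beta {n : ℕ} (θ₂ : ℝ) (_ : Fin n) (t : ℕ) : ℝ := 2 / (t : ℝ) ^ θ₂

def gamma {n : ℕ} (θ₂ : ℝ) (_ : Fin n) (t : ℕ) : ℝ := 1 / (t : ℝ) ^ (1 - θ₂)

def xi {n : ℕ} (θ₃ : ℝ) (_ : Fin n) (t : ℕ) : ℝ := 1 / ((t : ℝ) + 1) ^ θ₃

def delta {n : ℕ} (r : Fin n → ℝ) (θ₃ : ℝ) (i : Fin n) (t : ℕ) : ℝ := r i / ((t : ℝ) + 1) ^ θ₃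

/-! ### Regret, static optimum, constraint violation -/

section performance

variable {n m : ℕ} {p : Fin n → ℕ}

/-- `Reg(x_T, y_T) = ∑ₜ fₜ(xₜ) - ∑ₜ fₜ(yₜ)` with the global losses `fₜ(x) = ∑ᵢ f_{i,t}(xᵢ)`. -/
def regret (f : (i : Fin n) → ℕ → Vec (p i) → ℝ) (T : ℕ) (x y : (i : Fin n) → ℕ → Vec (p i)) : ℝ :=
  ∑ t ∈ Finset.Icc 1 T, ∑ i, f i t (x i t) - ∑ t ∈ Finset.Icc 1 T, ∑ i, f i t (y i t)

/-- The feasible static decisions up to round `T`: `y ∈ X₁ × ⋯ × Xₙ` with `gₜ(y) ≤ 0` for all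
`t ∈ [T]`, where `gₜ(y) = ∑ᵢ g_{i,t}(yᵢ)`. -/
def staticFeasible (X : (i : Fin n) → Set (Vec (p i))) (g : (i : Fin n) → ℕ → Vec (p i) → Vec m)
    (T : ℕ) : Set ((i : Fin n) → Vec (p i)) :=
  {y | (∀ i, y i ∈ X i) ∧ ∀ t ∈ Finset.Icc 1 T, ∀ j, (∑ i, g i t (y i)) j ≤ 0}

/-- `y` is an optimal static decision in hindsight. -/
def IsStaticOptimum (X : (i : Fin n) → Set (Vec (p i))) (f : (i : Fin n) → ℕ → Vec (p i) → ℝ)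
    (g : (i : Fin n) → ℕ → Vec (p i) → Vec m) (T : ℕ) (y : (i : Fin n) → Vec (p i)) : Prop :=
  y ∈ staticFeasible X g T ∧ ∀ y' ∈ staticFeasible X g T,
    ∑ t ∈ Finset.Icc 1 T, ∑ i, f i t (y i) ≤ ∑ t ∈ Finset.Icc 1 T, ∑ i, f i t (y' i)

/-- The constraint violation `‖[∑ₜ gₜ(xₜ)]₊‖`. -/
def violation (g : (i : Fin n) → ℕ → Vec (p i) → Vec m) (T : ℕ)
    (x : (i : Fin n) → ℕ → Vec (p i)) : ℝ :=
  ‖orthantProj (∑ t ∈ Finset.Icc 1 T, ∑ i, g i t (x i t))‖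

end performance

/-! ### The constants -/

def tauConst (n : ℕ) (w : ℝ) : ℝ := ((1 - w / (2 * (n : ℝ) ^ 2)) ^ 2)⁻¹

def lambdaConst (n : ℕ) (w : ℝ) (ι : ℕ) : ℝ := (1 - w / (2 * (n : ℝ) ^ 2)) ^ (1 / (ι : ℝ))

/-- `F_g = maxᵢ F_{g_i}`. -/
def FgMax {n : ℕ} (Fg : Fin n → ℝ) : ℝ := ⨆ i, Fg i

def C0 {n : ℕ} (m : ℕ) (Fg : Fin n → ℝ) (w : ℝ) (ι : ℕ) : ℝ :=
  6 * m * (n : ℝ) ^ 2 * FgMax Fg ^ 2 * tauConst n w / (1 - lambdaConst n w ι)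
    + 2 * m * n * FgMax Fg ^ 2

def C1 {n : ℕ} (m : ℕ) (p : Fin n → ℕ) (r R Ff Fg Gf Gg : Fin n → ℝ) (w : ℝ) (ι : ℕ)
    (θ₁ θ₂ θ₃ : ℝ) : ℝ :=
  ∑ i, (m * FgMax Fg * Gg i * (2 * r i + R i) / (1 - θ₃ + θ₂)
      + Gf i * (2 * r i + R i) / (1 - θ₃)
      + 8 * m * (p i : ℝ) ^ 2 * Fg i ^ 2 * R i ^ 2 / r i ^ 2
      + Ff i ^ 2 / (4 * m * Fg i ^ 2 * (1 - θ₁ + 2 * θ₃))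
      + 16 * m * (p i : ℝ) ^ 2 * Fg i ^ 2 * R i ^ 2 / r i ^ 2)
    + C0 m Fg w ι / θ₂

def C21 {n : ℕ} (Ff Fg : Fin n → ℝ) (θ₁ θ₂ θ₃ : ℝ) : ℝ :=
  2 * n * (1 + (⨆ i, Ff i ^ 2 / (Fg i ^ 2 * (1 - θ₁ + 2 * θ₃))) + 1 / (1 - θ₂))

def C2 {n : ℕ} (m : ℕ) (p : Fin n → ℕ) (r R Ff Fg Gf Gg : Fin n → ℝ) (w : ℝ) (ι : ℕ)
    (θ₁ θ₂ θ₃ : ℝ) : ℝ :=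
  C21 Ff Fg θ₁ θ₂ θ₃ * (2 * ∑ i, Ff i + C1 m p r R Ff Fg Gf Gg w ι θ₁ θ₂ θ₃)

end DBCO

end

/-!
The proof is a primal-dual argument along each trajectory, followed by taking expectations.

*Primal part.* By the divergence theorem on the ball, the mean over the sphere of the one-point
estimator `(k / δ) φ(z + δ v) v` is the gradient at `z` of the average of `φ` over the ball of
radius `δ`; for convex Lipschitz `φ` it is therefore a subgradient at `z` up to an error of order
`δ` (`FunAssumption.sub_le_inner_integral`). Projected descent then bounds the regret of a learner
in terms of the sampled directions `a t` and the noise `e t`, the difference between `a t` and its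
conditional mean. The optimal decision in hindsight depends on all the randomness, so the noise
cannot be averaged out against it directly. It enters only through `⟨∑ (1 - ξ) e, y⟩`, which
Young's inequality bounds by `R² / α + (α / 4) ‖∑ (1 - ξ) e‖²` uniformly in `y`. The noise is a
martingale difference sequence, hence the expectation of `‖∑ (1 - ξ) e‖²` is at most that of
`∑ ‖a t‖²`, which the descent controls (`IsPrimalRun.sum_le`, `integral_noiseTerm_nonpos`). Since
the multiplier grows with `t`, so does `‖a t‖`; the corresponding part of its square is left to the
dual part.

*Dual part.* The regularized dual ascent compares the multipliers with an arbitrary `ν ≥ 0`. The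
regularization keeps them of size `t^θ₂` and leaves a negative multiple of their squared norm,
which absorbs the second-order term of the primal part (`IsDualRun.sum_inner_sub_le`). A feasible
comparator makes the constraint term nonpositive for a multiplier common to all learners; the
disagreement of their multipliers costs the constant `C₀`. It contracts over each window of `ι`
rounds: cutting the learners at the largest gap between their values, strong connectivity forces
some learner to average across the cut (`GraphAssumption.sqDev_window_le`), and summation of the
resulting geometric decay bounds the accumulated disagreement (`IsDualRun.sum_norm_sub_mean_le`).

*Conclusion.* Together these give, for every feasible `y` and every `ν ≥ 0` on each trajectory,
`regret y + ⟨ν, ∑ g⟩ ≤ C₁ T^θ₁ + N + n A ‖ν‖²`, where `N` depends on neither `y` nor `ν` and has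
nonpositive mean (`pathwise_le`, `StandingAssumption.exists_noise`). The multiplier `ν = 0` gives
the bound on the regret. The maximum over `ν`, at a multiple of the positive part of `∑ g`, gives
the second moment of the violation, and so its mean. Integrability of the regret rests on
measurability of the optimal value, which comes from compactness of the decision sets
(`measurableSet_exists_forall_le`) and requires no measurable choice of minimizers.
-/

namespace DBCO

/-! ### The divergence theorem on the unit ball for Lipschitz functions -/

/-- The radial cutoff: `1` on the ball of radius `1 - ε`, `0` outside the unit ball, and affine
in the radius in between. -/
noncomputable def cutoff {E : Type*} [NormedAddCommGroup E] (ε : ℝ) (x : E) : ℝ :=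
  max 0 (min 1 (ε⁻¹ * (1 - ‖x‖)))

section Cutoff

open Filter Topology Metric Set

variable {E : Type*} [NormedAddCommGroup E]

lemma cutoff_nonneg (ε : ℝ) (x : E) : 0 ≤ cutoff ε x := le_max_left _ _

lemma cutoff_le_one (ε : ℝ) (x : E) : cutoff ε x ≤ 1 :=
  max_le zero_le_one (min_le_left _ _)

lemma cutoff_of_one_le {ε : ℝ} (hε : 0 < ε) {x : E} (hx : 1 ≤ ‖x‖) : cutoff ε x = 0 := by
  have : ε⁻¹ * (1 - ‖x‖) ≤ 0 := mul_nonpos_of_nonneg_of_nonpos (by positivity) (by linarith)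
  exact max_eq_left ((min_le_right _ _).trans this)

lemma cutoff_of_le {ε : ℝ} (hε : 0 < ε) {x : E} (hx : ‖x‖ ≤ 1 - ε) : cutoff ε x = 1 := by
  have : 1 ≤ ε⁻¹ * (1 - ‖x‖) := by
    rw [inv_mul_eq_div, le_div_iff₀ hε]; linarith
  rw [cutoff, min_eq_left this]; simp

lemma cutoff_of_mem {ε : ℝ} (hε : 0 < ε) {x : E} (h1 : 1 - ε ≤ ‖x‖) (h2 : ‖x‖ ≤ 1) :
    cutoff ε x = ε⁻¹ * (1 - ‖x‖) := by
  have h3 : ε⁻¹ * (1 - ‖x‖) ≤ 1 := by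
    rw [inv_mul_eq_div, div_le_one hε]; linarith
  have h4 : 0 ≤ ε⁻¹ * (1 - ‖x‖) := mul_nonneg (by positivity) (by linarith)
  rw [cutoff, min_eq_right h3, max_eq_right h4]

lemma lipschitzWith_cutoff {ε : ℝ} (hε : 0 < ε) :
    LipschitzWith (Real.toNNReal ε⁻¹) (cutoff ε : E → ℝ) := by
  refine LipschitzWith.of_dist_le_mul fun x y => ?_
  rw [Real.coe_toNNReal _ (by positivity), Real.dist_eq, dist_eq_norm]
  have h1 : |cutoff ε x - cutoff ε y| ≤ |ε⁻¹ * (1 - ‖x‖) - ε⁻¹ * (1 - ‖y‖)| := by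
    refine (abs_max_sub_max_le_max _ _ _ _).trans ?_
    rw [sub_self, abs_zero, max_eq_right (abs_nonneg _)]
    refine (abs_min_sub_min_le_max _ _ _ _).trans ?_
    rw [sub_self, abs_zero, max_eq_right (abs_nonneg _)]
  refine h1.trans ?_
  rw [← mul_sub, abs_mul, abs_of_pos (inv_pos.2 hε)]
  gcongr
  rw [sub_sub_sub_cancel_left, abs_sub_comm]
  exact abs_norm_sub_norm_le x y

lemma hasCompactSupport_cutoff [ProperSpace E] {ε : ℝ} (hε : 0 < ε) :
    HasCompactSupport (cutoff ε : E → ℝ) := by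
  refine HasCompactSupport.intro (isCompact_closedBall (0 : E) 1) fun x hx => ?_
  refine cutoff_of_one_le hε ?_
  rw [mem_closedBall_zero_iff, not_le] at hx
  exact hx.le

end Cutoff

section CutoffDeriv

open Filter Topology Metric Set

variable {E : Type*} [NormedAddCommGroup E] [InnerProductSpace ℝ E]

lemma tendsto_norm_line (x w : E) : Tendsto (fun t : ℝ => ‖x + t • w‖) (𝓝 0) (𝓝 ‖x‖) := by
  have : Continuous fun t : ℝ => ‖x + t • w‖ := by fun_prop
  simpa using this.tendsto 0

lemma lineDeriv_cutoff_of_lt {ε : ℝ} (hε : 0 < ε) {x : E} (hx : ‖x‖ < 1 - ε) (w : E) :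
    lineDeriv ℝ (cutoff ε) x w = 0 := by
  have : (fun t : ℝ => cutoff ε (x + t • w)) =ᶠ[𝓝 0] fun _ => (1 : ℝ) := by
    filter_upwards [(tendsto_norm_line x w).eventually_lt_const hx] with t ht
    exact cutoff_of_le hε ht.le
  rw [lineDeriv, this.deriv_eq]; simp

lemma lineDeriv_cutoff_of_gt {ε : ℝ} (hε : 0 < ε) {x : E} (hx : 1 < ‖x‖) (w : E) :
    lineDeriv ℝ (cutoff ε) x w = 0 := by
  have : (fun t : ℝ => cutoff ε (x + t • w)) =ᶠ[𝓝 0] fun _ => (0 : ℝ) := by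
    filter_upwards [(tendsto_norm_line x w).eventually_const_lt hx] with t ht
    exact cutoff_of_one_le hε ht.le
  rw [lineDeriv, this.deriv_eq]; simp

lemma lineDeriv_cutoff_of_mem {ε : ℝ} (hε : 0 < ε) {x : E} (h0 : x ≠ 0) (h1 : 1 - ε < ‖x‖)
    (h2 : ‖x‖ < 1) (w : E) :
    lineDeriv ℝ (cutoff ε) x w = -(ε⁻¹ * (‖x‖⁻¹ * inner ℝ x w)) := by
  have : (fun t : ℝ => cutoff ε (x + t • w)) =ᶠ[𝓝 0]
      fun t => ε⁻¹ * (1 - √(‖x + t • w‖ ^ 2)) := by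
    filter_upwards [(tendsto_norm_line x w).eventually_const_lt h1,
      (tendsto_norm_line x w).eventually_lt_const h2] with t ht1 ht2
    rw [cutoff_of_mem hε ht1.le ht2.le, Real.sqrt_sq (norm_nonneg _)]
  rw [lineDeriv, this.deriv_eq]
  have hd : HasDerivAt (fun t : ℝ => x + t • w) w 0 := by
    simpa using ((hasDerivAt_id (0 : ℝ)).smul_const w).const_add x
  have hn : ‖x‖ ≠ 0 := norm_ne_zero_iff.2 h0
  have h3 := ((hd.norm_sq.sqrt (by simpa using h0)).const_sub 1).const_mul ε⁻¹
  rw [h3.deriv]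
  simp only [zero_smul, add_zero, Real.sqrt_sq (norm_nonneg x)]
  field_simp

end CutoffDeriv

section Divergence

open Filter Topology Metric Set

variable {E : Type*} [NormedAddCommGroup E] [InnerProductSpace ℝ E] [FiniteDimensional ℝ E]
  [MeasurableSpace E] [BorelSpace E] [Nontrivial E]

/-- Integration in polar coordinates. -/
lemma integral_polar {F : E → ℝ} (hF : Integrable F) :
    ∫ x, F x = ∫ r in Ioi (0 : ℝ), r ^ (Module.finrank ℝ E - 1) *
      ∫ v : sphere (0 : E) 1, F (r • (v : E)) ∂(volume : Measure E).toSphere := by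
  have hmp := (volume : Measure E).measurePreserving_homeomorphUnitSphereProd
  have hemb := (homeomorphUnitSphereProd E).measurableEmbedding
  set H : sphere (0 : E) 1 × Ioi (0 : ℝ) → ℝ := fun y => F ((y.2 : ℝ) • (y.1 : E)) with hH
  have hcomp : ∀ x : ({0}ᶜ : Set E), H (homeomorphUnitSphereProd E x) = F x := by
    intro x
    have : (x : E) = ((homeomorphUnitSphereProd E).symm (homeomorphUnitSphereProd E x) : E) := by
      simp
    conv_rhs => rw [this]
    have hx : ‖(x : E)‖ ≠ 0 := norm_ne_zero_iff.2 x.2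
    simp [hH, smul_smul, mul_inv_cancel₀ hx]
  have h1 : ∫ x, F x = ∫ y, H y ∂((volume : Measure E).toSphere.prod
      (.volumeIoiPow (Module.finrank ℝ E - 1))) := by
    rw [← hmp.integral_comp hemb H, integral_congr_ae (ae_of_all _ hcomp),
      integral_subtype_comap (measurableSet_singleton _).compl fun x ↦ F x,
      restrict_compl_singleton]
  have hint : Integrable H ((volume : Measure E).toSphere.prod
      (.volumeIoiPow (Module.finrank ℝ E - 1))) := by
    rw [← hmp.integrable_comp_emb hemb]
    have : H ∘ homeomorphUnitSphereProd E = fun x : ({0}ᶜ : Set E) => F x := funext hcomp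
    rw [this]
    have h2 := (integrableOn_iff_comap_subtypeVal (μ := (volume : Measure E)) (f := F)
      (measurableSet_singleton (0 : E)).compl).1 hF.integrableOn
    exact h2
  rw [h1, integral_prod_symm _ hint]
  simp only [Measure.volumeIoiPow, ENNReal.ofReal]
  rw [integral_withDensity_eq_integral_smul]
  · rw [integral_subtype_comap measurableSet_Ioi fun a ↦
      Real.toNNReal (a ^ (Module.finrank ℝ E - 1)) •
        ∫ v : sphere (0 : E) 1, F (a • (v : E)) ∂(volume : Measure E).toSphere]
    refine setIntegral_congr_fun measurableSet_Ioi fun x hx ↦ ?_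
    rw [NNReal.smul_def, Real.coe_toNNReal _ (pow_nonneg (le_of_lt hx) _), smul_eq_mul]
  · exact (measurable_subtype_coe.pow_const _).real_toNNReal

/-- The divergence theorem on the unit ball for a Lipschitz function: the flux of `ψ h` through
the unit sphere is the integral of the derivative of `ψ` along `h` over the ball. -/
lemma integral_sphere_mul_inner {ψ : E → ℝ} {C : NNReal} (hψ : LipschitzWith C ψ) (h : E) :
    ∫ v : sphere (0 : E) 1, ψ v * inner ℝ (v : E) h ∂(volume : Measure E).toSphere =
      ∫ x in ball (0 : E) 1, lineDeriv ℝ ψ x h := by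
  set N := Module.finrank ℝ E - 1
  set σ := (volume : Measure E).toSphere
  set A : ℝ → ℝ := fun r => ∫ v : sphere (0 : E) 1, ψ (r • (v : E)) * inner ℝ (v : E) h ∂σ with hA
  have hAc : Continuous A := by
    have : Continuous (Function.uncurry fun (r : ℝ) (v : sphere (0 : E) 1) =>
        ψ (r • (v : E)) * inner ℝ (v : E) h) := by
      have := hψ.continuous
      simp only [Function.uncurry_def]
      fun_prop
    simpa using continuous_parametric_integral_of_continuous this (s := univ) isCompact_univ
      (μ := σ)
  -- integration by parts against the cutoff, in polar coordinates
  have key : ∀ ε : ℝ, 0 < ε → ε < 1 → ∫ x, lineDeriv ℝ ψ x h * cutoff ε x =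
      ε⁻¹ * ∫ r in (1 - ε)..1, r ^ N * A r := by
    intro ε hε hε1
    have hg := lipschitzWith_cutoff (E := E) hε
    have hgc := hasCompactSupport_cutoff (E := E) hε
    rw [hψ.integral_lineDeriv_mul_eq hg hgc h]
    have hzero : ∀ x ∉ closedBall (0 : E) 1, lineDeriv ℝ (cutoff ε) x (-h) * ψ x = 0 := by
      intro x hx
      rw [mem_closedBall_zero_iff, not_le] at hx
      rw [lineDeriv_cutoff_of_gt hε hx, zero_mul]
    have hint : Integrable fun x : E => lineDeriv ℝ (cutoff ε) x (-h) * ψ x := by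
      rw [← integrableOn_iff_integrable_of_support_subset (s := closedBall (0 : E) 1)
        (fun x hx => by by_contra h'; exact hx (hzero x h'))]
      refine IntegrableOn.mul_continuousOn ?_ hψ.continuous.continuousOn (isCompact_closedBall 0 1)
      exact (hg.locallyIntegrable_lineDeriv (-h)).integrableOn_isCompact (isCompact_closedBall 0 1)
    rw [integral_polar hint, intervalIntegral.integral_of_le (by linarith),
      ← integral_const_mul, ← integral_indicator measurableSet_Ioi,
      ← integral_indicator measurableSet_Ioc]
    refine integral_congr_ae ?_
    have hne : ∀ᵐ r : ℝ, r ≠ 1 - ε := by simp [ae_iff, measure_singleton]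
    have hne' : ∀ᵐ r : ℝ, r ≠ 1 := by simp [ae_iff, measure_singleton]
    filter_upwards [hne, hne'] with r hr1 hr2
    have hnorm : ∀ v : sphere (0 : E) 1, 0 < r → ‖r • (v : E)‖ = r := by
      intro v hr
      rw [norm_smul, norm_eq_of_mem_sphere, mul_one, Real.norm_of_nonneg hr.le]
    by_cases hr0 : 0 < r
    · rw [indicator_of_mem (mem_Ioi.2 hr0)]
      by_cases hr3 : r ∈ Ioc (1 - ε) 1
      · rw [indicator_of_mem hr3, hA]
        have : ∀ v : sphere (0 : E) 1, lineDeriv ℝ (cutoff ε) (r • (v : E)) (-h) * ψ (r • (v : E))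
            = ε⁻¹ * (ψ (r • (v : E)) * inner ℝ (v : E) h) := by
          intro v
          have hn := hnorm v hr0
          rw [lineDeriv_cutoff_of_mem hε, hn]
          · rw [inner_neg_right, real_inner_smul_left]; field_simp
          · rw [← norm_pos_iff, hn]; exact hr0
          · rw [hn]; exact hr3.1
          · rw [hn]; exact lt_of_le_of_ne hr3.2 hr2
        simp_rw [this, integral_const_mul]
        ring
      · rw [indicator_of_notMem hr3]
        have : ∀ v : sphere (0 : E) 1,
            lineDeriv ℝ (cutoff ε) (r • (v : E)) (-h) * ψ (r • (v : E)) = 0 := by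
          intro v
          have hn := hnorm v hr0
          rcases lt_or_gt_of_ne hr1 with h' | h'
          · rw [lineDeriv_cutoff_of_lt hε (by rw [hn]; exact h'), zero_mul]
          · have : 1 < r := by
              by_contra h''
              exact hr3 ⟨h', not_lt.1 h''⟩
            rw [lineDeriv_cutoff_of_gt hε (by rw [hn]; exact this), zero_mul]
        simp [this]
    · rw [indicator_of_notMem (by simpa using hr0), indicator_of_notMem]
      intro h'
      exact hr0 (by linarith [h'.1])
  -- let the width of the cutoff tend to zero
  set e : ℕ → ℝ := fun k => 1 / ((k : ℝ) + 2) with he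
  have he0 : ∀ k, 0 < e k := fun k => by positivity
  have he1 : ∀ k, e k < 1 := fun k => by
    rw [he]; simp only; rw [div_lt_one (by positivity)]
    have : (0 : ℝ) ≤ k := k.cast_nonneg
    linarith
  have het : Tendsto e atTop (𝓝 0) := by
    have := tendsto_one_div_add_atTop_nhds_zero_nat (𝕜 := ℝ)
    have h2 := (tendsto_add_atTop_iff_nat 1).2 this
    refine h2.congr fun k => ?_
    simp only [he]; push_cast; ring_nf
  have lim1 : Tendsto (fun k => ∫ x, lineDeriv ℝ ψ x h * cutoff (e k) x) atTop
      (𝓝 (∫ x, (ball (0 : E) 1).indicator (fun x => lineDeriv ℝ ψ x h) x)) := by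
    refine tendsto_integral_of_dominated_convergence
      ((closedBall (0 : E) 1).indicator fun x => |lineDeriv ℝ ψ x h|) ?_ ?_ ?_ ?_
    · intro k
      exact (hψ.locallyIntegrable_lineDeriv h).aestronglyMeasurable.mul
        (lipschitzWith_cutoff (he0 k)).continuous.aestronglyMeasurable
    · rw [integrable_indicator_iff measurableSet_closedBall]
      exact ((hψ.locallyIntegrable_lineDeriv h).integrableOn_isCompact
        (isCompact_closedBall 0 1)).abs
    · intro k
      refine ae_of_all _ fun x => ?_
      by_cases hx : x ∈ closedBall (0 : E) 1
      · rw [indicator_of_mem hx, norm_mul, Real.norm_eq_abs,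
          Real.norm_of_nonneg (cutoff_nonneg _ _)]
        exact mul_le_of_le_one_right (abs_nonneg _) (cutoff_le_one _ _)
      · rw [indicator_of_notMem hx]
        rw [mem_closedBall_zero_iff, not_le] at hx
        rw [cutoff_of_one_le (he0 k) hx.le]; simp
    · refine ae_of_all _ fun x => ?_
      by_cases hx : x ∈ ball (0 : E) 1
      · rw [indicator_of_mem hx]
        rw [mem_ball_zero_iff] at hx
        refine tendsto_const_nhds.congr' ?_
        filter_upwards [het.eventually_lt_const (sub_pos.2 hx)] with k hk
        rw [cutoff_of_le (he0 k) (by linarith), mul_one]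
      · rw [indicator_of_notMem hx]
        rw [mem_ball_zero_iff, not_lt] at hx
        refine tendsto_const_nhds.congr fun k => ?_
        rw [cutoff_of_one_le (he0 k) hx, mul_zero]
  have lim2 : Tendsto (fun k => (e k)⁻¹ * ∫ r in (1 - e k)..1, r ^ N * A r) atTop (𝓝 (A 1)) := by
    have hF : Continuous fun r : ℝ => r ^ N * A r := by fun_prop
    have hd : HasDerivAt (fun x => ∫ r in (0 : ℝ)..x, r ^ N * A r) (1 ^ N * A 1) 1 :=
      intervalIntegral.integral_hasDerivAt_right (hF.intervalIntegrable _ _)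
        (hF.stronglyMeasurableAtFilter _ _) hF.continuousAt
    rw [one_pow, one_mul] at hd
    have hs := hasDerivAt_iff_tendsto_slope.1 hd
    have ht : Tendsto (fun k => 1 - e k) atTop (𝓝[≠] 1) := by
      refine tendsto_nhdsWithin_iff.2 ⟨?_, Eventually.of_forall fun k => ?_⟩
      · simpa using het.const_sub 1
      · have := he0 k
        simp only [mem_compl_iff, mem_singleton_iff]
        linarith
    refine (hs.comp ht).congr fun k => ?_
    have := he0 k
    simp only [Function.comp, slope_def_field]
    have hsub := intervalIntegral.integral_interval_sub_left (μ := volume)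
      (hF.intervalIntegrable 0 1)
      (hF.intervalIntegrable 0 (1 - e k))
    have h3 : 1 - e k - 1 = -(e k) := by ring
    rw [h3, ← hsub]
    field_simp
    ring
  have huniq := tendsto_nhds_unique (lim1.congr fun k => key _ (he0 k) (he1 k)) lim2
  rw [integral_indicator measurableSet_ball] at huniq
  rw [huniq, hA]
  simp

end Divergence

/-! ### The one-point gradient estimator -/

section Estimator

open Filter Topology Metric Set

variable {k : ℕ} {K : Set (Vec k)} {φ : Vec k → ℝ} {F G : ℝ}

lemma FunAssumption.fderivWithin_le (h : FunAssumption K φ F G) {x : Vec k} (hx : x ∈ K) :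
    ‖fderivWithin ℝ φ K x‖ ≤ G := by
  rw [← toDual_gradientWithin, LinearIsometryEquiv.norm_map]
  exact h.grad_bounded x hx

lemma FunAssumption.abs_sub_le (h : FunAssumption K φ F G) {x y : Vec k} (hx : x ∈ K)
    (hy : y ∈ K) : |φ x - φ y| ≤ G * ‖x - y‖ := by
  have := h.convex.1.norm_image_sub_le_of_norm_fderivWithin_le h.differentiable
    (fun x hx => h.fderivWithin_le hx) hy hx
  simpa [Real.norm_eq_abs] using this

lemma FunAssumption.continuousOn (h : FunAssumption K φ F G) : ContinuousOn φ K :=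
  h.differentiable.continuousOn

/-- The first-order characterization of convexity. -/
lemma fderiv_le_sub_of_convexOn (hc : ConvexOn ℝ K φ) {x y : Vec k} (hx : x ∈ K) (hy : y ∈ K)
    (hd : DifferentiableAt ℝ φ x) : fderiv ℝ φ x (y - x) ≤ φ y - φ x := by
  have hl : HasDerivAt (fun t : ℝ => φ (x + t • (y - x))) (fderiv ℝ φ x (y - x)) 0 :=
    hd.hasFDerivAt.hasLineDerivAt (y - x)
  have hs := (hasDerivAt_iff_tendsto_slope.1 hl).mono_left
    (nhdsWithin_mono 0 (fun t (ht : 0 < t) => ne_of_gt ht) : 𝓝[>] (0 : ℝ) ≤ 𝓝[≠] 0)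
  refine le_of_tendsto hs ?_
  filter_upwards [Ioo_mem_nhdsGT (zero_lt_one' ℝ)] with t ht
  have hcv := hc.2 hx hy (sub_nonneg.2 ht.2.le) ht.1.le (by ring)
  have he : (1 - t) • x + t • y = x + t • (y - x) := by module
  rw [he, smul_eq_mul, smul_eq_mul] at hcv
  rw [slope_def_field, div_le_iff₀ (by linarith [ht.1])]
  simp only [zero_smul, add_zero, sub_zero]
  linarith

lemma add_smul_mem_interior {z : Vec k} {δ : ℝ} (hδ : 0 < δ)
    (hz : ∀ v ∈ closedBall (0 : Vec k) 1, z + δ • v ∈ K) {x : Vec k} (hx : x ∈ ball (0 : Vec k) 1) :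
    z + δ • x ∈ interior K := by
  rw [mem_interior_iff_mem_nhds]
  have hc : Continuous fun w : Vec k => δ⁻¹ • (w - z) := by fun_prop
  have hx' : δ⁻¹ • (z + δ • x - z) ∈ ball (0 : Vec k) 1 := by
    rwa [add_sub_cancel_left, inv_smul_smul₀ hδ.ne']
  filter_upwards [hc.continuousAt.preimage_mem_nhds (isOpen_ball.mem_nhds hx')] with w hw
  have := hz _ (ball_subset_closedBall hw)
  rwa [smul_inv_smul₀ hδ.ne', add_sub_cancel] at this

lemma isProbabilityMeasure_uniformSphere (hk : 0 < k) : IsProbabilityMeasure (uniformSphere k) := by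
  have : Nonempty (Fin k) := ⟨⟨0, hk⟩⟩
  have : Nontrivial (Vec k) := inferInstance
  have h0 : (volume : Measure (Vec k)).toSphere Set.univ ≠ 0 := by
    simpa [hk.ne'] using (measure_ball_pos (volume : Measure (Vec k)) 0 one_pos).ne'
  exact ⟨by
    rw [uniformSphere, Measure.smul_apply, smul_eq_mul]
    exact ENNReal.inv_mul_cancel h0 (measure_ne_top _ _)⟩

lemma FunAssumption.continuous_comp_sphere (h : FunAssumption K φ F G) {z : Vec k} {δ : ℝ}
    (hz : ∀ v ∈ closedBall (0 : Vec k) 1, z + δ • v ∈ K) :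
    Continuous fun v : sphere (0 : Vec k) 1 => φ (z + δ • (v : Vec k)) :=
  h.continuousOn.comp_continuous (by fun_prop) fun v => hz v (sphere_subset_closedBall v.2)

/-- The mean of the one-point estimator is the gradient of a smoothed version of `φ`; by convexity
it is an approximate subgradient of `φ`. -/
lemma FunAssumption.sub_le_inner_integral (hk : 0 < k) (h : FunAssumption K φ F G)
    {z y : Vec k} {δ : ℝ} (hδ : 0 < δ)
    (hz : ∀ v ∈ closedBall (0 : Vec k) 1, z + δ • v ∈ K) (hy : y ∈ K) :
    φ z - φ y - G * δ ≤
      inner ℝ (∫ v : sphere (0 : Vec k) 1, onePointGrad δ φ z v ∂uniformSphere k) (z - y) := by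
  have : Nonempty (Fin k) := ⟨⟨0, hk⟩⟩
  have : Nontrivial (Vec k) := inferInstance
  have := isProbabilityMeasure_uniformSphere hk
  have hzK : z ∈ K := by simpa using hz 0 (by simp)
  have hG : 0 ≤ G := (norm_nonneg _).trans (h.grad_bounded z hzK)
  obtain ⟨φ', hφ', hEq⟩ : ∃ g : Vec k → ℝ, LipschitzWith (Real.toNNReal G) g ∧ EqOn φ g K := by
    refine LipschitzOnWith.extend_real (LipschitzOnWith.of_dist_le_mul fun x hx y hy => ?_)
    rw [Real.coe_toNNReal _ hG, Real.dist_eq, dist_eq_norm]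
    exact h.abs_sub_le hx hy
  set ψ : Vec k → ℝ := fun v => φ' (z + δ • v) with hψ
  have hψL : LipschitzWith (Real.toNNReal G * Real.toNNReal δ) ψ := by
    refine hφ'.comp (LipschitzWith.of_dist_le_mul fun v w => ?_)
    rw [Real.coe_toNNReal _ hδ.le, dist_add_left, dist_smul₀, Real.norm_of_nonneg hδ.le]
  have hψeq : ∀ v ∈ closedBall (0 : Vec k) 1, ψ v = φ (z + δ • v) := fun v hv =>
    (hEq (hz v hv)).symm
  set B : ℝ := (volume : Measure (Vec k)).real (ball 0 1) with hB
  have hBpos : 0 < B := ENNReal.toReal_pos (measure_ball_pos _ _ one_pos).ne' measure_ball_lt_top.ne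
  -- the mean as an integral over the ball
  have hmean : inner ℝ (∫ v : sphere (0 : Vec k) 1, onePointGrad δ φ z v ∂uniformSphere k) (z - y)
      = (δ * B)⁻¹ * ∫ x in ball (0 : Vec k) 1, lineDeriv ℝ ψ x (z - y) := by
    rw [← integral_sphere_mul_inner hψL, real_inner_comm, ← integral_inner]
    · have hpt : ∀ v : sphere (0 : Vec k) 1, inner ℝ (z - y) (onePointGrad δ φ z v) =
          (k : ℝ) / δ * (ψ v * inner ℝ (v : Vec k) (z - y)) := by
        intro v
        rw [onePointGrad, real_inner_smul_right, hψeq v (sphere_subset_closedBall v.2),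
          real_inner_comm]
        ring
      simp_rw [hpt, integral_const_mul]
      rw [uniformSphere, integral_smul_measure, ENNReal.toReal_inv, ← Measure.real,
        Measure.toSphere_real_apply_univ, finrank_euclideanSpace_fin, smul_eq_mul, ← hB]
      have : (k : ℝ) ≠ 0 := by positivity
      field_simp
    · have hc : Continuous fun v : sphere (0 : Vec k) 1 => onePointGrad δ φ z v := by
        exact (continuous_const.mul (h.continuous_comp_sphere hz)).smul continuous_subtype_val
      exact hc.integrable_of_hasCompactSupport (HasCompactSupport.of_compactSpace _)
  -- the first-order lower bound inside the ball
  have hpt : ∀ x ∈ ball (0 : Vec k) 1, δ * (ψ x - φ y - G * δ) ≤ lineDeriv ℝ ψ x (z - y) := by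
    intro x hx
    have hint := add_smul_mem_interior hδ hz hx
    have hnhds : K ∈ 𝓝 (z + δ • x) := mem_interior_iff_mem_nhds.1 hint
    have hmem : z + δ • x ∈ K := interior_subset hint
    have hd : DifferentiableAt ℝ φ (z + δ • x) :=
      (h.differentiable _ hmem).differentiableAt hnhds
    have heq : φ =ᶠ[𝓝 (z + δ • x)] φ' := by
      filter_upwards [hnhds] with w hw using hEq hw
    have hd' : HasFDerivAt φ' (fderiv ℝ φ (z + δ • x)) (z + δ • x) :=
      hd.hasFDerivAt.congr_of_eventuallyEq heq.symm
    have hin : HasFDerivAt (fun v : Vec k => z + δ • v) (δ • ContinuousLinearMap.id ℝ (Vec k)) x :=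
      ((hasFDerivAt_id x).const_smul δ).const_add z
    have hψd : HasFDerivAt ψ
        ((fderiv ℝ φ (z + δ • x)).comp (δ • ContinuousLinearMap.id ℝ (Vec k))) x :=
      HasFDerivAt.comp x hd' hin
    rw [(hψd.hasLineDerivAt (z - y)).lineDeriv]
    simp only [ContinuousLinearMap.comp_apply, _root_.smul_apply,
      ContinuousLinearMap.id_apply, map_smul, smul_eq_mul]
    refine mul_le_mul_of_nonneg_left ?_ hδ.le
    have h1 := fderiv_le_sub_of_convexOn h.convex hmem hy hd
    have h2 : fderiv ℝ φ (z + δ • x) (δ • x) ≤ G * δ := by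
      refine (le_abs_self _).trans ?_
      rw [← Real.norm_eq_abs]
      refine (ContinuousLinearMap.le_opNorm _ _).trans ?_
      have hn : ‖fderiv ℝ φ (z + δ • x)‖ ≤ G := by
        rw [← fderivWithin_of_mem_nhds hnhds]; exact h.fderivWithin_le hmem
      have hn2 : ‖δ • x‖ ≤ δ := by
        rw [norm_smul, Real.norm_of_nonneg hδ.le]
        exact mul_le_of_le_one_right hδ.le (mem_ball_zero_iff.1 hx).le
      exact mul_le_mul hn hn2 (norm_nonneg _) hG
    have h3 : z - y = -(y - (z + δ • x)) - δ • x := by module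
    rw [h3, map_sub, map_neg, hψeq x (ball_subset_closedBall hx)]
    linarith
  have hiψ : IntegrableOn ψ (ball (0 : Vec k) 1) :=
    (hψL.continuous.continuousOn.integrableOn_compact (isCompact_closedBall 0 1)).mono_set
      ball_subset_closedBall
  have hneg : ∫ x in ball (0 : Vec k) 1, ψ (-x) = ∫ x in ball (0 : Vec k) 1, ψ x := by
    have hmp := (Measure.measurePreserving_neg (volume : Measure (Vec k))).setIntegral_preimage_emb
      (Homeomorph.neg (Vec k)).measurableEmbedding ψ (ball (0 : Vec k) 1)
    simpa using hmp
  have hiψ' : IntegrableOn (fun x => ψ (-x)) (ball (0 : Vec k) 1) := by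
    have hc : Continuous fun x => ψ (-x) := hψL.continuous.comp continuous_neg
    exact (hc.continuousOn.integrableOn_compact (isCompact_closedBall 0 1)).mono_set
      ball_subset_closedBall
  have hconst : ∀ c : ℝ, ∫ _x in ball (0 : Vec k) 1, c = B * c := fun c => by
    rw [setIntegral_const, smul_eq_mul]
  have hic : ∀ c : ℝ, IntegrableOn (fun _ => c) (ball (0 : Vec k) 1) := fun c =>
    integrableOn_const measure_ball_lt_top.ne
  -- by symmetry the mean of `φ` over the ball is at least its value at the centre
  have hsym : B * φ z ≤ ∫ x in ball (0 : Vec k) 1, ψ x := by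
    have h2 : ∫ _x in ball (0 : Vec k) 1, 2 * φ z ≤ ∫ x in ball (0 : Vec k) 1, (ψ x + ψ (-x)) := by
      refine setIntegral_mono_on (hic _) (hiψ.add hiψ') measurableSet_ball fun x hx => ?_
      have hx1 := ball_subset_closedBall hx
      have hx2 : -x ∈ closedBall (0 : Vec k) 1 := by simpa using hx1
      rw [hψeq x hx1, hψeq _ hx2]
      have := h.convex.2 (hz x hx1) (hz _ hx2) (by norm_num : (0 : ℝ) ≤ 1 / 2)
        (by norm_num : (0 : ℝ) ≤ 1 / 2) (by norm_num)
      have he : (1 / 2 : ℝ) • (z + δ • x) + (1 / 2 : ℝ) • (z + δ • -x) = z := by module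
      rw [he, smul_eq_mul, smul_eq_mul] at this
      linarith
    rw [integral_add hiψ hiψ', hneg, hconst] at h2
    linarith
  have hlow : ∫ x in ball (0 : Vec k) 1, δ * (ψ x - (φ y + G * δ)) ≤
      ∫ x in ball (0 : Vec k) 1, lineDeriv ℝ ψ x (z - y) := by
    refine setIntegral_mono_on ?_ ?_ measurableSet_ball fun x hx => ?_
    · exact (hiψ.sub (hic _)).const_mul δ
    · exact ((hψL.locallyIntegrable_lineDeriv _).integrableOn_isCompact
        (isCompact_closedBall 0 1)).mono_set ball_subset_closedBall
    · rw [← sub_sub]; exact hpt x hx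
  rw [integral_const_mul, integral_sub hiψ (hic _), hconst] at hlow
  rw [hmean, inv_mul_eq_div, le_div_iff₀ (by positivity)]
  nlinarith [mul_le_mul_of_nonneg_left hsym hδ.le]

end Estimator

/-! ### Contraction of disagreement over time-varying graphs -/

section Consensus

open Finset Matrix

variable {n m : ℕ}

/-- The sum of the squared deviations of `x` from its mean. -/
noncomputable def sqDev (x : Fin n → ℝ) : ℝ := ∑ i, (x i - (∑ k, x k) / n) ^ 2

/-- `x` is at least `a` on `S` and at most `b` off `S`. -/
def Separated (S : Finset (Fin n)) (a b : ℝ) (x : Fin n → ℝ) : Prop :=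
  (∀ i ∈ S, a ≤ x i) ∧ ∀ i ∉ S, x i ≤ b

lemma sqDev_eq (hn : 0 < n) (x : Fin n → ℝ) : sqDev x = ∑ i, x i ^ 2 - (∑ k, x k) ^ 2 / n := by
  have hn' : (n : ℝ) ≠ 0 := by positivity
  set s := ∑ k, x k with hs
  have h1 : ∀ i, (x i - s / n) ^ 2 = x i ^ 2 - 2 * (s / n) * x i + (s / n) ^ 2 := fun i => by ring
  unfold sqDev
  rw [← hs]
  simp_rw [h1, sum_add_distrib, sum_sub_distrib, ← mul_sum, ← hs]
  simp only [sum_const, card_univ, Fintype.card_fin, nsmul_eq_mul]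
  field_simp
  ring

lemma sqDev_le_sum_sq (hn : 0 < n) (x : Fin n → ℝ) : sqDev x ≤ ∑ i, x i ^ 2 := by
  rw [sqDev_eq hn]
  have : 0 ≤ (∑ k, x k) ^ 2 / (n : ℝ) := by positivity
  linarith

lemma sqDev_le_of_bounds (hn : 0 < n) {x : Fin n → ℝ} {a b : ℝ} (ha : ∀ i, a ≤ x i)
    (hb : ∀ i, x i ≤ b) : sqDev x ≤ n * (b - a) ^ 2 := by
  have hn' : (0 : ℝ) < n := by positivity
  have h1 : a ≤ (∑ k, x k) / n := by
    rw [le_div_iff₀ hn']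
    calc a * n = ∑ _k : Fin n, a := by simp [mul_comm]
      _ ≤ _ := sum_le_sum fun i _ => ha i
  have h2 : (∑ k, x k) / n ≤ b := by
    rw [div_le_iff₀ hn']
    calc (∑ k, x k) ≤ ∑ _k : Fin n, b := sum_le_sum fun i _ => hb i
      _ = b * n := by simp [mul_comm]
  calc sqDev x ≤ ∑ _i : Fin n, (b - a) ^ 2 := by
        refine sum_le_sum fun i _ => ?_
        rw [sq_le_sq, abs_of_nonneg (by linarith [ha i] : 0 ≤ b - a)]
        exact abs_le.2 ⟨by linarith [ha i], by linarith [hb i]⟩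
    _ = n * (b - a) ^ 2 := by simp

/-- The variance of `x` under the weights `c`, as a double sum. -/
lemma weighted_variance_eq {c x : Fin n → ℝ} (hc : ∑ i, c i = 1) :
    ∑ i, c i * x i ^ 2 - (∑ i, c i * x i) ^ 2 =
      (∑ i, ∑ j, c i * c j * (x i - x j) ^ 2) / 2 := by
  have h1 : ∀ i j, c i * c j * (x i - x j) ^ 2 =
      (c i * x i ^ 2) * c j - 2 * ((c i * x i) * (c j * x j)) + c i * (c j * x j ^ 2) :=
    fun i j => by ring
  simp_rw [h1, sum_add_distrib, sum_sub_distrib, ← mul_sum, ← sum_mul, hc]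
  ring

lemma weighted_variance_nonneg {c x : Fin n → ℝ} (h0 : ∀ i, 0 ≤ c i) (hc : ∑ i, c i = 1) :
    0 ≤ ∑ i, c i * x i ^ 2 - (∑ i, c i * x i) ^ 2 := by
  rw [weighted_variance_eq hc]
  have : 0 ≤ ∑ i, ∑ j, c i * c j * (x i - x j) ^ 2 :=
    sum_nonneg fun i _ => sum_nonneg fun j _ =>
      mul_nonneg (mul_nonneg (h0 i) (h0 j)) (sq_nonneg _)
  linarith

lemma Separated.le_weighted_variance {S : Finset (Fin n)} {a b : ℝ} {c x : Fin n → ℝ}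
    (hS : Separated S a b x) (hab : b ≤ a) (h0 : ∀ i, 0 ≤ c i) (hc : ∑ i, c i = 1) :
    (∑ i ∈ S, c i) * (∑ i ∈ Sᶜ, c i) * (a - b) ^ 2 ≤
      ∑ i, c i * x i ^ 2 - (∑ i, c i * x i) ^ 2 := by
  rw [weighted_variance_eq hc]
  have hnn : ∀ i j, 0 ≤ c i * c j * (x i - x j) ^ 2 := fun i j =>
    mul_nonneg (mul_nonneg (h0 i) (h0 j)) (sq_nonneg _)
  have hcross : ∀ i ∈ S, ∀ j ∈ Sᶜ, c i * c j * (a - b) ^ 2 ≤ c i * c j * (x i - x j) ^ 2 := by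
    intro i hi j hj
    refine mul_le_mul_of_nonneg_left ?_ (mul_nonneg (h0 i) (h0 j))
    have h1 := hS.1 i hi
    have h2 := hS.2 j (by simpa using hj)
    exact pow_le_pow_left₀ (by linarith) (by linarith) 2
  have e1 : (∑ i ∈ S, c i) * (∑ i ∈ Sᶜ, c i) * (a - b) ^ 2 =
      ∑ i ∈ S, ∑ j ∈ Sᶜ, c i * c j * (a - b) ^ 2 := by
    rw [sum_mul_sum, sum_mul]
    exact sum_congr rfl fun i _ => sum_mul _ _ _
  have e2 : ∑ i ∈ S, ∑ j ∈ Sᶜ, c i * c j * (a - b) ^ 2 ≤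
      ∑ i ∈ S, ∑ j, c i * c j * (x i - x j) ^ 2 := by
    refine sum_le_sum fun i hi => ?_
    rw [← sum_add_sum_compl S]
    have : 0 ≤ ∑ j ∈ S, c i * c j * (x i - x j) ^ 2 := sum_nonneg fun j _ => hnn i j
    linarith [sum_le_sum fun j hj => hcross i hi j hj]
  have e3 : ∑ i ∈ S, ∑ j ∈ Sᶜ, c i * c j * (a - b) ^ 2 ≤
      ∑ i ∈ Sᶜ, ∑ j, c i * c j * (x i - x j) ^ 2 := by
    rw [sum_comm]
    refine sum_le_sum fun j hj => ?_
    rw [← sum_add_sum_compl S]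
    have : 0 ≤ ∑ i ∈ Sᶜ, c j * c i * (x j - x i) ^ 2 := sum_nonneg fun i _ => hnn j i
    have h2 : ∑ i ∈ S, c i * c j * (a - b) ^ 2 ≤ ∑ i ∈ S, c j * c i * (x j - x i) ^ 2 := by
      refine sum_le_sum fun i hi => (hcross i hi j hj).trans_eq (by ring)
    linarith
  rw [e1]
  have e4 := sum_add_sum_compl S fun i => ∑ j, c i * c j * (x i - x j) ^ 2
  linarith

variable {W : Matrix (Fin n) (Fin n) ℝ}

/-- Averaging with a doubly stochastic matrix decreases the squared deviation by the sum of the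
variances of `x` under the rows. -/
lemma sqDev_sub_sqDev_mulVec (hn : 0 < n) (hW : W ∈ doublyStochastic ℝ (Fin n)) (x : Fin n → ℝ) :
    sqDev x - sqDev (W *ᵥ x) =
      ∑ k, (∑ i, W k i * x i ^ 2 - (∑ i, W k i * x i) ^ 2) := by
  obtain ⟨-, -, hcol⟩ := mem_doublyStochastic_iff_sum.1 hW
  have hsum : ∑ k, (W *ᵥ x) k = ∑ i, x i := by
    simp only [mulVec, dotProduct]
    rw [sum_comm]
    simp_rw [← sum_mul, hcol, one_mul]
  have hsq : ∑ k, ∑ i, W k i * x i ^ 2 = ∑ i, x i ^ 2 := by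
    rw [sum_comm]
    simp_rw [← sum_mul, hcol, one_mul]
  rw [sqDev_eq hn, sqDev_eq hn, hsum, sum_sub_distrib, hsq]
  simp only [mulVec, dotProduct]
  ring

lemma sqDev_mulVec_le (hn : 0 < n) (hW : W ∈ doublyStochastic ℝ (Fin n)) (x : Fin n → ℝ) :
    sqDev (W *ᵥ x) ≤ sqDev x := by
  obtain ⟨h0, hrow, -⟩ := mem_doublyStochastic_iff_sum.1 hW
  have := sqDev_sub_sqDev_mulVec hn hW x
  have h2 : 0 ≤ ∑ k, (∑ i, W k i * x i ^ 2 - (∑ i, W k i * x i) ^ 2) :=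
    sum_nonneg fun k _ => weighted_variance_nonneg (h0 k) (hrow k)
  linarith

/-- If some row puts weight at least `w` on both sides of a cut that separates the values of `x`
by a gap, then averaging decreases the squared deviation. -/
lemma Separated.sqDev_mulVec_le (hn : 0 < n) (hW : W ∈ doublyStochastic ℝ (Fin n))
    {S : Finset (Fin n)} {a b w : ℝ} {x : Fin n → ℝ} (hS : Separated S a b x) (hab : b ≤ a)
    (hw : 0 < w) {d : Fin n} (h1 : w ≤ ∑ i ∈ S, W d i) (h2 : w ≤ ∑ i ∈ Sᶜ, W d i) :
    sqDev (W *ᵥ x) ≤ sqDev x - w / 2 * (a - b) ^ 2 := by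
  obtain ⟨h0, hrow, -⟩ := mem_doublyStochastic_iff_sum.1 hW
  have heq := sqDev_sub_sqDev_mulVec hn hW x
  have hd := hS.le_weighted_variance hab (h0 d) (hrow d)
  have hsingle := single_le_sum (f := fun k => ∑ i, W k i * x i ^ 2 - (∑ i, W k i * x i) ^ 2)
    (fun k _ => weighted_variance_nonneg (h0 k) (hrow k)) (mem_univ d)
  have hsplit := sum_add_sum_compl S (W d)
  rw [hrow d] at hsplit
  have hprod : w / 2 ≤ (∑ i ∈ S, W d i) * (∑ i ∈ Sᶜ, W d i) := by
    set C := ∑ i ∈ S, W d i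
    set C' := ∑ i ∈ Sᶜ, W d i
    rcases le_total (1 / 2) C with h | h
    · nlinarith
    · nlinarith
  have := mul_le_mul_of_nonneg_right hprod (sq_nonneg (a - b))
  linarith

variable {G : Digraph (Fin n)}

/-- Without edges across the cut, averaging preserves the separation. -/
lemma Separated.mulVec_of_not_crossing (hW : W ∈ doublyStochastic ℝ (Fin n))
    (hG : IsMixingMatrix G W) {S : Finset (Fin n)} {a b : ℝ} {x : Fin n → ℝ}
    (hS : Separated S a b x) (hcross : ∀ c d, G.Adj c d → (c ∈ S ↔ d ∈ S)) :
    Separated S a b (W *ᵥ x) := by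
  obtain ⟨h0, hrow, -⟩ := mem_doublyStochastic_iff_sum.1 hW
  have hzero : ∀ d i, ¬ (i ∈ S ↔ d ∈ S) → W d i = 0 := by
    intro d i h
    refine (hG d i).2 ?_
    rintro (h' | rfl)
    · exact h (hcross i d h')
    · exact h Iff.rfl
  constructor
  · intro d hd
    calc a = ∑ i, W d i * a := by rw [← sum_mul, hrow, one_mul]
      _ ≤ ∑ i, W d i * x i := by
        refine sum_le_sum fun i _ => ?_
        by_cases hi : i ∈ S
        · exact mul_le_mul_of_nonneg_left (hS.1 i hi) (h0 d i)
        · rw [hzero d i (by tauto), zero_mul, zero_mul]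
  · intro d hd
    calc ∑ i, W d i * x i ≤ ∑ i, W d i * b := by
          refine sum_le_sum fun i _ => ?_
          by_cases hi : i ∈ S
          · rw [hzero d i (by tauto), zero_mul, zero_mul]
          · exact mul_le_mul_of_nonneg_left (hS.2 i hi) (h0 d i)
      _ = b := by rw [← sum_mul, hrow, one_mul]

/-- Some cut separates the values of `x` by at least the `n`-th part of their range. -/
lemma exists_separated {x : Fin n → ℝ} {p q : Fin n} (hpq : x q < x p) (hq : ∀ i, x q ≤ x i) :
    ∃ (S : Finset (Fin n)) (a b : ℝ), Separated S a b x ∧ p ∈ S ∧ q ∉ S ∧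
      a - b = (x p - x q) / n := by
  have hn : 0 < n := p.pos
  have hn' : (0 : ℝ) < n := by positivity
  set ρ := (x p - x q) / n with hρ
  have hρ0 : 0 < ρ := div_pos (by linarith) hn'
  set fl : Fin n → ℕ := fun i => ⌊(x i - x q) / ρ⌋₊ with hfl
  set F : Fin n → Fin n := fun i => if h : fl i < n then ⟨fl i, h⟩ else ⟨0, hn⟩ with hF
  have hflq : fl q = 0 := by simp [hfl]
  have hpval : (x p - x q) / ρ = n := by
    rw [hρ]
    have : x p - x q ≠ 0 := by linarith
    field_simp
  have hflp : fl p = n := by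
    simp only [hfl, hpval, Nat.floor_natCast]
  have hFq : F q = ⟨0, hn⟩ := by simp [hF, hflq]
  have hFp : F p = ⟨0, hn⟩ := by simp [hF, hflp]
  have hninj : ¬ Function.Injective F := by
    intro h
    have := h (hFp.trans hFq.symm)
    rw [this] at hpq
    exact lt_irrefl _ hpq
  have hnsurj : ¬ Function.Surjective F := fun h => hninj (Finite.injective_iff_surjective.2 h)
  obtain ⟨l, hl⟩ : ∃ l, ∀ i, F i ≠ l := by simpa [Function.Surjective] using hnsurj
  have hcase : ∀ i, fl i < l ∨ (l : ℕ) + 1 ≤ fl i := by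
    intro i
    by_contra h
    push Not at h
    have h1 : fl i = l := by omega
    refine hl i ?_
    simp [hF, h1]
  refine ⟨univ.filter fun i => (l : ℕ) + 1 ≤ fl i, x q + (l + 1) * ρ, x q + l * ρ, ⟨?_, ?_⟩,
    ?_, ?_, ?_⟩
  · intro i hi
    have hi' : (l : ℕ) + 1 ≤ fl i := by simpa using hi
    have h1 : ((l : ℕ) + 1 : ℝ) ≤ (x i - x q) / ρ := by
      have := (Nat.le_floor_iff (div_nonneg (sub_nonneg.2 (hq i)) hρ0.le)).1 hi'
      exact_mod_cast this
    rw [le_div_iff₀ hρ0] at h1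
    linarith
  · intro i hi
    have hi' : fl i < l := by
      rcases hcase i with h | h
      · exact h
      · exact absurd (by simpa using h) hi
    have h1 := (Nat.floor_lt (div_nonneg (sub_nonneg.2 (hq i)) hρ0.le)).1 hi'
    rw [div_lt_iff₀ hρ0] at h1
    linarith
  · simp [hflp]
  · simp [hflq]
  · ring

/-- A path that leaves `S` uses an edge that leaves `S`. -/
lemma exists_crossing_of_reflTransGen {r : Fin n → Fin n → Prop} {S : Finset (Fin n)} {i j : Fin n}
    (h : Relation.ReflTransGen r i j) (hi : i ∈ S) (hj : j ∉ S) : ∃ c d, r c d ∧ c ∈ S ∧ d ∉ S := by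
  induction h with
  | refl => exact absurd hi hj
  | @tail b c hb hbc ih =>
    by_cases hbS : b ∈ S
    · exact ⟨b, c, hbc, hbS, hj⟩
    · exact ih hbS

/-- Over a window of `ι` rounds the squared deviation contracts: the cut at the largest gap of the
initial values stays separated until the first round with an edge across it, and that round
decreases the squared deviation by a fixed multiple of the squared gap. -/
lemma GraphAssumption.sqDev_window_le {G : ℕ → Digraph (Fin n)} {W : ℕ → Matrix (Fin n) (Fin n) ℝ}
    {w : ℝ} {ι : ℕ} (hG : GraphAssumption G W w ι) (hn : 0 < n) {s : ℕ} (hs : 1 ≤ s)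
    (x : ℕ → Fin n → ℝ) (hx : ∀ k, x (k + 1) = W (s + k) *ᵥ x k) :
    sqDev (x ι) ≤ (1 - w / (2 * (n : ℝ) ^ 3)) * sqDev (x 0) := by
  have hn' : (0 : ℝ) < n := by positivity
  have hmono : ∀ k l, k ≤ l → sqDev (x l) ≤ sqDev (x k) := by
    intro k l hkl
    induction l, hkl using Nat.le_induction with
    | base => exact le_rfl
    | succ l _ ih => rw [hx]; exact (sqDev_mulVec_le hn (hG.doubly _ (by omega)) _).trans ih
  obtain ⟨p, -, hp⟩ := exists_max_image univ (x 0) ⟨⟨0, hn⟩, mem_univ _⟩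
  obtain ⟨q, -, hq⟩ := exists_min_image univ (x 0) ⟨⟨0, hn⟩, mem_univ _⟩
  have hbound : sqDev (x 0) ≤ n * (x 0 p - x 0 q) ^ 2 :=
    sqDev_le_of_bounds hn (fun i => hq i (mem_univ _)) fun i => hp i (mem_univ _)
  have hw := hG.w_pos
  have hdrop : w / 2 * ((x 0 p - x 0 q) / n) ^ 2 ≥ w / (2 * (n : ℝ) ^ 3) * sqDev (x 0) := by
    calc w / (2 * (n : ℝ) ^ 3) * sqDev (x 0)
        ≤ w / (2 * (n : ℝ) ^ 3) * (n * (x 0 p - x 0 q) ^ 2) := by gcongr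
      _ = _ := by field_simp
  rcases (hq p (mem_univ _)).eq_or_lt with heq | hlt
  · have h0 : sqDev (x 0) ≤ 0 := by
      rw [heq, sub_self] at hbound; simpa using hbound
    have h0' : sqDev (x 0) = 0 := le_antisymm h0 (sum_nonneg fun i _ => sq_nonneg _)
    have := hmono 0 ι (Nat.zero_le _)
    rw [h0'] at this ⊢
    simpa using this
  obtain ⟨S, a, b, hS, hpS, hqS, hab⟩ := exists_separated hlt fun i => hq i (mem_univ _)
  have hab' : b ≤ a := by
    have : 0 < a - b := by rw [hab]; exact div_pos (by linarith) hn'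
    linarith
  have hex : ∃ l, l < ι ∧ ∃ c d, (G (s + l)).Adj c d ∧ ¬ (c ∈ S ↔ d ∈ S) := by
    obtain ⟨c, d, ⟨l, hl, hadj⟩, hc, hd⟩ :=
      exists_crossing_of_reflTransGen (hG.connected s hs p q) hpS hqS
    exact ⟨l, hl, c, d, hadj, by tauto⟩
  classical
  obtain ⟨hl, c, d, hadj, hcd⟩ := Nat.find_spec hex
  set l := Nat.find hex with hldef
  have hmin : ∀ k < l, ∀ c d, (G (s + k)).Adj c d → (c ∈ S ↔ d ∈ S) := by
    intro k hk c d hadj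
    by_contra hcd
    exact Nat.find_min hex hk ⟨hk.trans hl, c, d, hadj, hcd⟩
  have hsep : ∀ k ≤ l, Separated S a b (x k) := by
    intro k
    induction k with
    | zero => exact fun _ => hS
    | succ k ih =>
      intro hk
      rw [hx]
      exact (ih (by omega)).mulVec_of_not_crossing (hG.doubly _ (by omega))
        (hG.mixing _ (by omega)) (hmin k (by omega))
  have hWl := hG.doubly (s + l) (by omega)
  have hmix := hG.mixing (s + l) (by omega)
  have hlow := hG.lower (s + l) (by omega)
  obtain ⟨h0, -, -⟩ := mem_doublyStochastic_iff_sum.1 hWl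
  have hdc : w ≤ W (s + l) d c := hlow d c ((hmix d c).1 (Or.inl hadj))
  have hdd : w ≤ W (s + l) d d := hlow d d ((hmix d d).1 (Or.inr rfl))
  have hrow : ∀ (A : Finset (Fin n)) (i : Fin n), i ∈ A → W (s + l) d i ≤ ∑ i ∈ A, W (s + l) d i :=
    fun A i hi => single_le_sum (f := fun i => W (s + l) d i) (fun i _ => h0 d i) hi
  have hdec : sqDev (x (l + 1)) ≤ sqDev (x l) - w / 2 * (a - b) ^ 2 := by
    rw [hx]
    by_cases hc : c ∈ S
    · have hd : d ∈ Sᶜ := by rw [mem_compl]; tauto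
      exact (hsep l le_rfl).sqDev_mulVec_le hn hWl hab' hw (d := d)
        (hdc.trans (hrow S c hc)) (hdd.trans (hrow Sᶜ d hd))
    · have hd : d ∈ S := by tauto
      exact (hsep l le_rfl).sqDev_mulVec_le hn hWl hab' hw (d := d)
        (hdd.trans (hrow S d hd)) (hdc.trans (hrow Sᶜ c (mem_compl.2 hc)))
  have h1 := hmono (l + 1) ι hl
  have h2 := hmono 0 l (Nat.zero_le _)
  rw [hab] at hdec
  linarith

end Consensus

/-! ### Accumulated disagreement of a perturbed averaging process -/

section Disagreement

open Finset Matrix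

variable {n m : ℕ}

/-- One round of averaging with the mixing matrix `W`. -/
noncomputable def mix (W : Matrix (Fin n) (Fin n) ℝ) (Y : Fin n → Vec m) (i : Fin n) : Vec m :=
  ∑ j, W i j • Y j

/-- The disagreement of the vectors `Y i`: the Euclidean norm of their deviations from the mean. -/
noncomputable def disagreement (Y : Fin n → Vec m) : ℝ :=
  ‖(WithLp.toLp 2 fun i => Y i - (n : ℝ)⁻¹ • ∑ k, Y k : PiLp 2 fun _ : Fin n => Vec m)‖

lemma disagreement_nonneg (Y : Fin n → Vec m) : 0 ≤ disagreement Y := norm_nonneg _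

lemma disagreement_sq (Y : Fin n → Vec m) :
    disagreement Y ^ 2 = ∑ i, ‖Y i - (n : ℝ)⁻¹ • ∑ k, Y k‖ ^ 2 := by
  rw [disagreement, PiLp.norm_sq_eq_of_L2]

lemma disagreement_sq_eq_sum_sqDev (Y : Fin n → Vec m) :
    disagreement Y ^ 2 = ∑ j, sqDev fun i => Y i j := by
  rw [disagreement_sq]
  simp_rw [EuclideanSpace.real_norm_sq_eq]
  rw [sum_comm]
  refine sum_congr rfl fun j _ => sum_congr rfl fun i _ => ?_
  simp [div_eq_inv_mul]

lemma disagreement_add_le (Y Z : Fin n → Vec m) :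
    disagreement (fun i => Y i + Z i) ≤ disagreement Y + disagreement Z := by
  unfold disagreement
  refine le_of_eq_of_le ?_ (norm_add_le _ _)
  rw [← WithLp.toLp_add]
  congr 2
  funext i
  simp only [Pi.add_apply, sum_add_distrib, smul_add]
  abel

lemma disagreement_zero : disagreement (fun _ : Fin n => (0 : Vec m)) = 0 := by
  have := disagreement_sq (fun _ : Fin n => (0 : Vec m))
  simpa using this

lemma disagreement_le_of_norm_le (hn : 0 < n) {Y : Fin n → Vec m} {c : ℝ} (h : ∀ i, ‖Y i‖ ≤ c) :
    disagreement Y ≤ √n * c := by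
  have hc : 0 ≤ c := (norm_nonneg _).trans (h ⟨0, hn⟩)
  refine le_of_sq_le_sq ?_ (by positivity)
  rw [disagreement_sq_eq_sum_sqDev, mul_pow, Real.sq_sqrt n.cast_nonneg]
  calc ∑ j, sqDev (fun i => Y i j) ≤ ∑ j, ∑ i, Y i j ^ 2 :=
        sum_le_sum fun j _ => sqDev_le_sum_sq hn _
    _ = ∑ i, ‖Y i‖ ^ 2 := by
        rw [sum_comm]
        simp_rw [EuclideanSpace.real_norm_sq_eq]
    _ ≤ ∑ _i : Fin n, c ^ 2 := sum_le_sum fun i _ => pow_le_pow_left₀ (norm_nonneg _) (h i) 2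
    _ = n * c ^ 2 := by simp

lemma sum_norm_sub_mean_le (Y : Fin n → Vec m) :
    ∑ i, ‖Y i - (n : ℝ)⁻¹ • ∑ k, Y k‖ ≤ √n * disagreement Y := by
  refine le_of_sq_le_sq ?_ (mul_nonneg (Real.sqrt_nonneg _) (disagreement_nonneg _))
  rw [mul_pow, Real.sq_sqrt n.cast_nonneg, disagreement_sq]
  simpa using sq_sum_le_card_mul_sum_sq (s := univ) (f := fun i => ‖Y i - (n : ℝ)⁻¹ • ∑ k, Y k‖)

lemma mix_apply (W : Matrix (Fin n) (Fin n) ℝ) (Y : Fin n → Vec m) (i : Fin n) (j : Fin m) :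
    mix W Y i j = (W *ᵥ fun k => Y k j) i := by
  simp [mix, mulVec, dotProduct]

lemma mix_sub (W : Matrix (Fin n) (Fin n) ℝ) (Y Z : Fin n → Vec m) (i : Fin n) :
    mix W (fun k => Y k - Z k) i = mix W Y i - mix W Z i := by
  simp [mix, smul_sub]

lemma disagreement_mix_le {W : Matrix (Fin n) (Fin n) ℝ} (hn : 0 < n)
    (hW : W ∈ doublyStochastic ℝ (Fin n)) (Y : Fin n → Vec m) :
    disagreement (mix W Y) ≤ disagreement Y := by
  refine le_of_sq_le_sq ?_ (disagreement_nonneg _)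
  rw [disagreement_sq_eq_sum_sqDev, disagreement_sq_eq_sum_sqDev]
  refine sum_le_sum fun j _ => ?_
  simp_rw [mix_apply]
  exact sqDev_mulVec_le hn hW _

variable {G : ℕ → Digraph (Fin n)} {W : ℕ → Matrix (Fin n) (Fin n) ℝ} {w : ℝ} {ι : ℕ}

lemma GraphAssumption.disagreement_window_le (hG : GraphAssumption G W w ι) (hn : 0 < n) {s : ℕ}
    (hs : 1 ≤ s) (Y : ℕ → Fin n → Vec m) (hY : ∀ k, Y (k + 1) = mix (W (s + k)) (Y k)) :
    disagreement (Y ι) ≤ (1 - w / (4 * (n : ℝ) ^ 3)) * disagreement (Y 0) := by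
  have hn1 : (1 : ℝ) ≤ n := by exact_mod_cast hn
  have hk : w / (4 * (n : ℝ) ^ 3) ≤ 1 := by
    rw [div_le_one (by positivity)]
    have := hG.w_lt_one
    nlinarith [one_le_pow₀ hn1 (n := 3)]
  refine le_of_sq_le_sq ?_ (mul_nonneg (by linarith) (disagreement_nonneg _))
  have h1 : disagreement (Y ι) ^ 2 ≤ (1 - w / (2 * (n : ℝ) ^ 3)) * disagreement (Y 0) ^ 2 := by
    rw [disagreement_sq_eq_sum_sqDev, disagreement_sq_eq_sum_sqDev, mul_sum]
    refine sum_le_sum fun j _ => ?_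
    refine hG.sqDev_window_le hn hs (fun k i => Y k i j) fun k => ?_
    funext i
    rw [hY, mix_apply]
  refine h1.trans ?_
  rw [mul_pow]
  refine mul_le_mul_of_nonneg_right ?_ (sq_nonneg _)
  have : w / (2 * (n : ℝ) ^ 3) = 2 * (w / (4 * (n : ℝ) ^ 3)) := by ring
  rw [this]
  nlinarith [sq_nonneg (w / (4 * (n : ℝ) ^ 3))]

/-- Summation of a sequence that contracts over windows of length `ι` up to perturbations `E`. -/
lemma sum_le_of_window_contraction {κ : ℝ} (hκ : κ ≤ 1) {d E : ℕ → ℝ}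
    (hd : ∀ t, 0 ≤ d t) (hE : ∀ t, 0 ≤ E t)
    (h1 : ∀ t, d t ≤ ∑ r ∈ Ioc 0 t, E r)
    (h2 : ∀ t, d (t + ι) ≤ (1 - κ) * d t + ∑ r ∈ Ioc t (t + ι), E r) (T : ℕ) :
    κ * ∑ t ∈ range T, d t ≤ ι * ∑ r ∈ Ico 1 T, E r := by
  have hpt : ∀ t, d t ≤ (1 - κ) * (if ι ≤ t then d (t - ι) else 0) + ∑ r ∈ Ioc (t - ι) t, E r := by
    intro t
    split_ifs with h
    · have := h2 (t - ι)
      rwa [Nat.sub_add_cancel h] at this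
    · have := h1 t
      rwa [mul_zero, zero_add, Nat.sub_eq_zero_of_le (by omega)]
  have hshift : ∑ t ∈ range T, (if ι ≤ t then d (t - ι) else 0) = ∑ t ∈ range (T - ι), d t := by
    induction T with
    | zero => simp
    | succ T ih =>
      rw [sum_range_succ, ih]
      split_ifs with h
      · rw [Nat.succ_sub h, sum_range_succ]
      · rw [Nat.sub_eq_zero_of_le (by omega), Nat.sub_eq_zero_of_le (by omega)]; simp
  have hwin : ∑ t ∈ range T, ∑ r ∈ Ioc (t - ι) t, E r ≤ ι * ∑ r ∈ Ico 1 T, E r := by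
    rw [sum_comm' (t' := Ico 1 T) (s' := fun r => (range T).filter fun t => t - ι < r ∧ r ≤ t)
      (by intro x y; simp only [mem_range, mem_Ioc, mem_filter, mem_Ico]; omega), mul_sum]
    refine sum_le_sum fun r hr => ?_
    rw [sum_const, nsmul_eq_mul]
    refine mul_le_mul_of_nonneg_right ?_ (hE r)
    have hr1 := (mem_Ico.1 hr).1
    have : ((range T).filter fun t => t - ι < r ∧ r ≤ t) ⊆ Ico r (r + ι) := by
      intro t
      simp only [mem_range, mem_filter, mem_Ico]
      omega
    have := card_le_card this
    rw [Nat.card_Ico, Nat.add_sub_cancel_left] at this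
    exact_mod_cast this
  have hsum := sum_le_sum fun t (_ : t ∈ range T) => hpt t
  rw [sum_add_distrib, ← mul_sum, hshift] at hsum
  have hsub : ∑ t ∈ range (T - ι), d t ≤ ∑ t ∈ range T, d t :=
    sum_le_sum_of_subset_of_nonneg (range_mono (Nat.sub_le _ _)) fun t _ _ => hd t
  have := mul_le_mul_of_nonneg_left hsub (sub_nonneg.2 hκ)
  linarith

/-- The total disagreement of a perturbed averaging process started at consensus. -/
lemma GraphAssumption.sum_disagreement_le (hG : GraphAssumption G W w ι) (hn : 0 < n)
    {Y e : ℕ → Fin n → Vec m} (h1 : Y 1 = fun _ => 0)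
    (hY : ∀ t, 1 ≤ t → Y (t + 1) = fun i => mix (W t) (Y t) i + e (t + 1) i) (T : ℕ) :
    w / (4 * (n : ℝ) ^ 3) * ∑ t ∈ Icc 1 T, disagreement (Y t) ≤
      ι * ∑ t ∈ Icc 2 T, disagreement (e t) := by
  have hn1 : (1 : ℝ) ≤ n := by exact_mod_cast hn
  have hk : w / (4 * (n : ℝ) ^ 3) ≤ 1 := by
    rw [div_le_one (by positivity)]
    have := hG.w_lt_one
    nlinarith [one_le_pow₀ hn1 (n := 3)]
  have hstep : ∀ t, 1 ≤ t → disagreement (Y (t + 1)) ≤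
      disagreement (Y t) + disagreement (e (t + 1)) := by
    intro t ht
    rw [hY t ht]
    refine (disagreement_add_le _ _).trans ?_
    gcongr
    exact disagreement_mix_le hn (hG.doubly t ht) _
  have hsum1 : ∀ t, disagreement (Y (t + 1)) ≤ ∑ r ∈ Ioc 0 t, disagreement (e (r + 1)) := by
    intro t
    induction t with
    | zero => simp [h1, disagreement_zero]
    | succ t ih =>
      rw [← insert_Ioc_right_eq_Ioc_add_one (Nat.zero_le t), sum_insert (by simp)]
      have := hstep (t + 1) (by omega)
      linarith
  have hsum2 : ∀ t, disagreement (Y (t + ι + 1)) ≤ (1 - w / (4 * (n : ℝ) ^ 3)) *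
      disagreement (Y (t + 1)) + ∑ r ∈ Ioc t (t + ι), disagreement (e (r + 1)) := by
    intro t
    -- the unperturbed averaging process over the window
    let y : ℕ → Fin n → Vec m := fun k => Nat.rec (Y (t + 1)) (fun k y => mix (W (t + 1 + k)) y) k
    have hwin : disagreement (y ι) ≤ _ :=
      hG.disagreement_window_le hn (s := t + 1) (by omega) y fun k => rfl
    have hdiff : ∀ k, disagreement (fun i => Y (t + k + 1) i - y k i) ≤
        ∑ r ∈ Ioc t (t + k), disagreement (e (r + 1)) := by
      intro k
      induction k with
      | zero => simp [y, disagreement_zero]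
      | succ k ih =>
        have he : (fun i => Y (t + (k + 1) + 1) i - y (k + 1) i) = fun i =>
            mix (W (t + 1 + k)) (fun i => Y (t + k + 1) i - y k i) i + e (t + k + 2) i := by
          funext i
          have h3 : y (k + 1) i = mix (W (t + 1 + k)) (y k) i := rfl
          have h4 := congrFun (hY (t + k + 1) (by omega)) i
          rw [mix_sub, h3, show t + (k + 1) + 1 = t + k + 1 + 1 by ring, h4,
            show t + 1 + k = t + k + 1 by ring]
          abel
        rw [he, ← add_assoc, ← insert_Ioc_right_eq_Ioc_add_one (by omega), sum_insert (by simp)]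
        have h5 := disagreement_mix_le (m := m) hn (hG.doubly (t + 1 + k) (by omega))
          (fun i => Y (t + k + 1) i - y k i)
        refine (disagreement_add_le _ _).trans ?_
        have h6 : t + k + 1 + 1 = t + k + 2 := rfl
        rw [h6]
        linarith
    have hsplit : Y (t + ι + 1) = fun i => y ι i + (Y (t + ι + 1) i - y ι i) := by
      funext i; abel
    rw [hsplit]
    refine (disagreement_add_le _ _).trans ?_
    exact add_le_add hwin (hdiff ι)
  have := sum_le_of_window_contraction (ι := ι) hk (d := fun t => disagreement (Y (t + 1)))
    (E := fun t => disagreement (e (t + 1))) (fun t => disagreement_nonneg _)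
    (fun t => disagreement_nonneg _) hsum1 hsum2 T
  have e1 : ∑ t ∈ range T, disagreement (Y (t + 1)) = ∑ t ∈ Icc 1 T, disagreement (Y t) := by
    rw [range_eq_Ico, sum_Ico_add' (fun t => disagreement (Y t)) 0 T 1]
    rfl
  have e2 : ∑ t ∈ Ico 1 T, disagreement (e (t + 1)) = ∑ t ∈ Icc 2 T, disagreement (e t) := by
    rw [sum_Ico_add' (fun t => disagreement (e t)) 1 T 1]
    rfl
  rwa [e1, e2] at this

end Disagreement

/-! ### Sums of powers and comparison of constants -/

section Powers

open Finset

lemma mul_rpow_neg_le_rpow_sub {x s : ℝ} (hx : 0 ≤ x) (hs0 : 0 ≤ s) (hs1 : s ≤ 1) :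
    (1 - s) * (x + 1) ^ (-s) ≤ (x + 1) ^ (1 - s) - x ^ (1 - s) := by
  have hx1 : 0 < x + 1 := by linarith
  have hb : (1 + -(1 / (x + 1))) ^ (1 - s) ≤ 1 + (1 - s) * -(1 / (x + 1)) := by
    refine rpow_one_add_le_one_add_mul_self ?_ (by linarith) (by linarith)
    have : 1 / (x + 1) ≤ 1 := (div_le_one hx1).2 (by linarith)
    linarith
  have hx2 : x = (x + 1) * (1 + -(1 / (x + 1))) := by field_simp; ring
  have h3 : x ^ (1 - s) = (x + 1) ^ (1 - s) * (1 + -(1 / (x + 1))) ^ (1 - s) := by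
    conv_lhs => rw [hx2]
    refine Real.mul_rpow hx1.le ?_
    have : 1 / (x + 1) ≤ 1 := (div_le_one hx1).2 (by linarith)
    linarith
  have h4 : (x + 1) ^ (1 - s) = (x + 1) ^ (-s) * (x + 1) := by
    rw [show 1 - s = -s + 1 by ring, Real.rpow_add hx1, Real.rpow_one]
  have h5 := mul_le_mul_of_nonneg_left hb (Real.rpow_nonneg hx1.le (1 - s))
  rw [h3]
  have h6 : (x + 1) ^ (1 - s) * (1 + (1 - s) * -(1 / (x + 1))) =
      (x + 1) ^ (1 - s) - (1 - s) * (x + 1) ^ (-s) := by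
    rw [h4]; field_simp; ring
  linarith

lemma sum_rpow_neg_le' {s : ℝ} (hs0 : 0 ≤ s) (hs1 : s < 1) {T : ℕ} (hT : 1 ≤ T) :
    ∑ t ∈ Icc 1 T, ((t : ℝ) + 1) ^ (-s) ≤ ((T : ℝ) ^ (1 - s) - s) / (1 - s) := by
  have h1s : 0 < 1 - s := by linarith
  induction T, hT using Nat.le_induction with
  | base =>
    simp only [Icc_self, sum_singleton, Nat.cast_one, Real.one_rpow]
    rw [div_self h1s.ne']
    exact Real.rpow_le_one_of_one_le_of_nonpos (by norm_num) (by linarith)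
  | succ T hT ih =>
    rw [sum_Icc_succ_top (by omega)]
    have h1 := mul_rpow_neg_le_rpow_sub (x := (T : ℝ)) T.cast_nonneg hs0 hs1.le
    have h2 : ((T : ℝ) + 1 + 1) ^ (-s) ≤ ((T : ℝ) + 1) ^ (-s) :=
      Real.rpow_le_rpow_of_nonpos (by positivity) (by linarith) (by linarith)
    rw [le_div_iff₀ h1s] at ih ⊢
    push_cast
    nlinarith

lemma sum_rpow_neg_le {s : ℝ} (hs0 : 0 ≤ s) (hs1 : s < 1) {T : ℕ} (hT : 1 ≤ T) :
    ∑ t ∈ Icc 1 T, ((t : ℝ) + 1) ^ (-s) ≤ (T : ℝ) ^ (1 - s) / (1 - s) := by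
  refine (sum_rpow_neg_le' hs0 hs1 hT).trans ?_
  gcongr
  linarith

lemma rpow_one_sub_sub_le {t s : ℝ} (ht : 0 < t) (hs0 : 0 ≤ s) :
    (t + 1) ^ (1 - s) - t ^ (1 - s) ≤ (t + 1) ^ (-s) := by
  have h1 : (t + 1) ^ (1 - s) = (t + 1) ^ (-s) * (t + 1) := by
    rw [show 1 - s = -s + 1 by ring, Real.rpow_add (by linarith), Real.rpow_one]
  have h2 : t ^ (1 - s) = t ^ (-s) * t := by
    rw [show 1 - s = -s + 1 by ring, Real.rpow_add ht, Real.rpow_one]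
  have h3 : (t + 1) ^ (-s) ≤ t ^ (-s) :=
    Real.rpow_le_rpow_of_nonpos ht (by linarith) (by linarith)
  rw [h1, h2]
  nlinarith

lemma succ_rpow_le {T : ℕ} (hT : 1 ≤ T) {θ : ℝ} (h1 : θ ≤ 1) :
    T * ((T : ℝ) + 1) ^ θ ≤ ((T : ℝ) + 1) * (T : ℝ) ^ θ := by
  have hT' : (0 : ℝ) < T := by exact_mod_cast hT
  have e1 : ((T : ℝ) + 1) ^ θ = ((T : ℝ) + 1) * ((T : ℝ) + 1) ^ (θ - 1) := by
    rw [Real.rpow_sub_one (by positivity)]; field_simp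
  have e2 : (T : ℝ) ^ θ = T * (T : ℝ) ^ (θ - 1) := by
    rw [Real.rpow_sub_one (by positivity)]; field_simp
  rw [e1, e2]
  have h3 : ((T : ℝ) + 1) ^ (θ - 1) ≤ (T : ℝ) ^ (θ - 1) :=
    Real.rpow_le_rpow_of_nonpos hT' (by linarith) (by linarith)
  have := mul_le_mul_of_nonneg_left h3 (by positivity : (0 : ℝ) ≤ T * (T + 1))
  linarith

/-- The factor `3 + 2 (ξ₂ - ξ_{T+1})` collects the three contributions of size
`R² / α_{T+1}` to the regret. -/
lemma succ_rpow_mul_le {T : ℕ} (hT : 1 ≤ T) {θ₁ θ₃ : ℝ} (h1 : θ₁ ≤ 1) (h30 : 0 ≤ θ₃)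
    (h3 : θ₃ ≤ 1 / 2) :
    ((T : ℝ) + 1) ^ θ₁ * (3 + 2 * (1 / ((2 : ℝ) + 1) ^ θ₃ - 1 / ((T : ℝ) + 1 + 1) ^ θ₃)) ≤
      6 * (T : ℝ) ^ θ₁ := by
  have hT' : (1 : ℝ) ≤ T := by exact_mod_cast hT
  have key := succ_rpow_le hT h1
  have hpos : 0 < (T : ℝ) ^ θ₁ := Real.rpow_pos_of_pos (by linarith) _
  set X := 1 / ((2 : ℝ) + 1) ^ θ₃ with hX
  set Y := 1 / ((T : ℝ) + 1 + 1) ^ θ₃ with hY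
  have hY0 : 0 < Y := by positivity
  have hX1 : X ≤ 1 := by
    rw [hX, div_le_one (by positivity)]
    exact Real.one_le_rpow (by norm_num) h30
  -- it suffices to bound the factor `3 + 2 (X - Y)` by `6 T / (T + 1)`
  have hfac : (3 + 2 * (X - Y)) * ((T : ℝ) + 1) ≤ 6 * T := by
    have hsq : ∀ c : ℝ, 0 < c → (T : ℝ) + 1 + 1 ≤ c ^ 2 → c⁻¹ ≤ Y := by
      intro c hc h
      rw [hY, inv_eq_one_div]
      refine one_div_le_one_div_of_le (by positivity) ?_
      calc ((T : ℝ) + 1 + 1) ^ θ₃ ≤ ((T : ℝ) + 1 + 1) ^ (1 / 2 : ℝ) :=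
            Real.rpow_le_rpow_of_exponent_le (by linarith) h3
        _ ≤ (c ^ 2) ^ (1 / 2 : ℝ) := Real.rpow_le_rpow (by linarith) h (by norm_num)
        _ = c := by rw [← Real.sqrt_eq_rpow, Real.sqrt_sq hc.le]
    rcases Nat.lt_or_ge T 5 with h5 | h5
    · interval_cases T
      · have hXY : X = Y := by rw [hX, hY]; norm_num
        rw [hXY]; norm_num
      · have := hsq 2 (by norm_num) (by norm_num)
        norm_num at this ⊢
        linarith
      · have := hsq 3 (by norm_num) (by norm_num)
        norm_num at this ⊢
        linarith
      · have := hsq 3 (by norm_num) (by norm_num)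
        norm_num at this ⊢
        linarith
    · have : (5 : ℝ) ≤ T := by exact_mod_cast h5
      nlinarith
  have hfac0 : 0 ≤ 3 + 2 * (X - Y) := by
    have hY1 : Y ≤ 1 := by
      rw [hY, div_le_one (by positivity)]
      exact Real.one_le_rpow (by linarith) h30
    have : 0 < X := by positivity
    linarith
  have h4 := mul_le_mul_of_nonneg_right key hfac0
  have h5 := mul_le_mul_of_nonneg_right hfac hpos.le
  have hTpos : (0 : ℝ) < T := by linarith
  refine le_of_mul_le_mul_left ?_ hTpos
  linarith

/-- Bernoulli's inequality relates the contraction per round to that per window. -/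
lemma div_le_tauConst_div {n : ℕ} (hn : 0 < n) {w : ℝ} (hw : 0 < w) (hw1 : w < 1) {ι : ℕ}
    (hι : 0 < ι) : ι / (w / (2 * (n : ℝ) ^ 2)) ≤ tauConst n w / (1 - lambdaConst n w ι) := by
  have hn1 : (1 : ℝ) ≤ n := by exact_mod_cast hn
  set ρ := w / (2 * (n : ℝ) ^ 2) with hρ
  have hρ0 : 0 < ρ := by positivity
  have hρ1 : ρ < 1 := by
    rw [hρ, div_lt_one (by positivity)]
    nlinarith [one_le_pow₀ hn1 (n := 2)]
  have hι' : (0 : ℝ) < ι := by exact_mod_cast hι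
  set y := lambdaConst n w ι with hy
  have hydef : y = (1 - ρ) ^ (1 / (ι : ℝ)) := rfl
  have hy0 : 0 < y := Real.rpow_pos_of_pos (by linarith) _
  have hy1 : y < 1 := Real.rpow_lt_one (by linarith) (by linarith) (by positivity)
  have hpow : y ^ ι = 1 - ρ := by
    rw [hydef, ← Real.rpow_natCast, ← Real.rpow_mul (by linarith), one_div, inv_mul_cancel₀ hι'.ne',
      Real.rpow_one]
  have hgeom : ρ = (∑ k ∈ range ι, y ^ k) * (1 - y) := by
    have := geom_sum_mul y ι
    rw [hpow] at this
    linarith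
  have hsum : ι * (1 - ρ) ≤ ∑ k ∈ range ι, y ^ k := by
    calc (ι : ℝ) * (1 - ρ) = ∑ _k ∈ range ι, (1 - ρ) := by
          rw [sum_const, card_range, nsmul_eq_mul]
      _ ≤ _ := sum_le_sum fun k hk => by
        rw [← hpow]
        exact pow_le_pow_of_le_one hy0.le hy1.le (mem_range.1 hk).le
  have h1 : ι * (1 - ρ) * (1 - y) ≤ ρ := by
    rw [hgeom]
    exact mul_le_mul_of_nonneg_right (by rwa [← hgeom]) (by linarith)
  have hτ : tauConst n w = ((1 - ρ) ^ 2)⁻¹ := rfl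
  rw [hτ, div_le_div_iff₀ hρ0 (by linarith), inv_mul_eq_div, le_div_iff₀ (by nlinarith)]
  nlinarith [mul_le_mul_of_nonneg_right h1 (by linarith : (0 : ℝ) ≤ 1 - ρ)]

end Powers

/-! ### The dual iterates -/

section Dual

open Finset Matrix

variable {n m : ℕ}

lemma orthantProj_nonneg (v : Vec m) (j : Fin m) : 0 ≤ orthantProj v j := le_max_right _ _

lemma orthantProj_of_nonneg {v : Vec m} (hv : ∀ j, 0 ≤ v j) : orthantProj v = v := by
  ext j
  exact max_eq_left (hv j)

lemma norm_orthantProj_sub_le (v w : Vec m) : ‖orthantProj v - orthantProj w‖ ≤ ‖v - w‖ := by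
  refine le_of_sq_le_sq ?_ (norm_nonneg _)
  rw [EuclideanSpace.real_norm_sq_eq, EuclideanSpace.real_norm_sq_eq]
  refine sum_le_sum fun j _ => ?_
  rw [sq_le_sq]
  exact abs_max_sub_max_le_abs (v j) (w j) 0

lemma norm_orthantProj_le (v : Vec m) : ‖orthantProj v‖ ≤ ‖v‖ := by
  have h0 : orthantProj (0 : Vec m) = 0 := orthantProj_of_nonneg fun j => le_rfl
  simpa [h0] using norm_orthantProj_sub_le v 0

lemma inner_orthantProj_self (v : Vec m) : inner ℝ (orthantProj v) v = ‖orthantProj v‖ ^ 2 := by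
  rw [EuclideanSpace.real_norm_sq_eq, PiLp.inner_apply]
  refine sum_congr rfl fun j _ => ?_
  simp only [orthantProj, RCLike.inner_apply, conj_trivial]
  rcases le_total (v j) 0 with h | h
  · rw [max_eq_right h]; ring
  · rw [max_eq_left h]; ring

lemma norm_le_sqrt_mul {v : Vec m} {F : ℝ} (hF : 0 ≤ F) (h : ∀ j, |v j| ≤ F) :
    ‖v‖ ≤ √m * F := by
  refine le_of_sq_le_sq ?_ (by positivity)
  rw [mul_pow, Real.sq_sqrt m.cast_nonneg, EuclideanSpace.real_norm_sq_eq]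
  calc ∑ j, v j ^ 2 ≤ ∑ _j : Fin m, F ^ 2 := sum_le_sum fun j _ => by
        rw [sq_le_sq, abs_of_nonneg hF]; exact h j
    _ = m * F ^ 2 := by simp

lemma sum_le_sqrt_mul_norm (v : Vec m) : ∑ j, v j ≤ √m * ‖v‖ := by
  refine le_of_sq_le_sq ?_ (by positivity)
  rw [mul_pow, Real.sq_sqrt m.cast_nonneg, EuclideanSpace.real_norm_sq_eq]
  simpa using sq_sum_le_card_mul_sum_sq (s := univ) (f := fun j => v j)

/-- One step of the regularized dual ascent, compared with an arbitrary multiplier `ν ≥ 0`. -/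
lemma dual_step_le {ν qt c : Vec m} {β γ B : ℝ} (hν : ∀ j, 0 ≤ ν j) (hγ : 0 < γ) (hβ : 0 ≤ β)
    (hc : ‖c‖ ≤ B) (hqt : β * ‖qt‖ ≤ B) :
    inner ℝ ν c - inner ℝ qt c ≤
      (‖qt - ν‖ ^ 2 - ‖orthantProj ((1 - β * γ) • qt + γ • c) - ν‖ ^ 2) / (2 * γ)
        - β / 2 * (‖qt‖ ^ 2 + ‖qt - ν‖ ^ 2 - ‖ν‖ ^ 2) + 2 * γ * B ^ 2 := by
  have h1 : ‖orthantProj ((1 - β * γ) • qt + γ • c) - ν‖ ^ 2 ≤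
      ‖(qt - ν) + γ • (c - β • qt)‖ ^ 2 := by
    refine pow_le_pow_left₀ (norm_nonneg _) ?_ 2
    have := norm_orthantProj_sub_le ((1 - β * γ) • qt + γ • c) ν
    rw [orthantProj_of_nonneg hν] at this
    refine this.trans_eq ?_
    congr 1
    module
  have h2 : ‖c - β • qt‖ ≤ 2 * B := by
    refine (norm_sub_le _ _).trans ?_
    rw [norm_smul, Real.norm_of_nonneg hβ]
    linarith
  have h3 : ‖c - β • qt‖ ^ 2 ≤ 4 * B ^ 2 := by
    calc _ ≤ (2 * B) ^ 2 := pow_le_pow_left₀ (norm_nonneg _) h2 2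
      _ = _ := by ring
  rw [norm_add_sq_real, real_inner_smul_right, norm_smul, mul_pow, Real.norm_of_nonneg hγ.le,
    inner_sub_right, real_inner_smul_right, inner_sub_left] at h1
  have h4 : inner ℝ (qt - ν) qt = (‖qt‖ ^ 2 + ‖qt - ν‖ ^ 2 - ‖ν‖ ^ 2) / 2 := by
    rw [norm_sub_sq_real, inner_sub_left, real_inner_self_eq_norm_sq, real_inner_comm]
    ring
  rw [h4] at h1
  have h5 := mul_le_mul_of_nonneg_left h3 (sq_nonneg γ)
  have h6 : inner ℝ ν c - inner ℝ qt c + β / 2 * (‖qt‖ ^ 2 + ‖qt - ν‖ ^ 2 - ‖ν‖ ^ 2)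
      - 2 * γ * B ^ 2 ≤ (‖qt - ν‖ ^ 2 -
        ‖orthantProj ((1 - β * γ) • qt + γ • c) - ν‖ ^ 2) / (2 * γ) := by
    rw [le_div_iff₀ (by positivity)]
    linarith
  linarith

/-- The dual part of a run: `q`, `qt` are the multipliers and their averages, driven by the
observed constraint values `c`, which are bounded by `B`. -/
structure IsDualRun (W : ℕ → Matrix (Fin n) (Fin n) ℝ) (θ₂ B : ℝ)
    (q qt c : Fin n → ℕ → Vec m) : Prop where
  init : ∀ i, q i 1 = 0
  avg : ∀ i t, 1 ≤ t → qt i (t + 1) = ∑ j, W t i j • q j t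
  step : ∀ i t, 1 ≤ t → q i (t + 1) = orthantProj
    ((1 - beta θ₂ i (t + 1) * gamma θ₂ i (t + 1)) • qt i (t + 1) + gamma θ₂ i (t + 1) • c i t)
  bound : ∀ i t, 1 ≤ t → ‖c i t‖ ≤ B

variable {W : ℕ → Matrix (Fin n) (Fin n) ℝ} {θ₂ B : ℝ} {q qt c : Fin n → ℕ → Vec m}

lemma beta_succ (θ₂ : ℝ) (i : Fin n) (t : ℕ) : beta θ₂ i (t + 1) = 2 * ((t : ℝ) + 1) ^ (-θ₂) := by
  rw [beta, Real.rpow_neg (by positivity)]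
  push_cast
  rfl

lemma gamma_succ (θ₂ : ℝ) (i : Fin n) (t : ℕ) :
    gamma θ₂ i (t + 1) = ((t : ℝ) + 1) ^ (-(1 - θ₂)) := by
  rw [gamma, Real.rpow_neg (by positivity), one_div]
  push_cast
  rfl

lemma beta_mul_gamma_succ (θ₂ : ℝ) (i : Fin n) (t : ℕ) :
    beta θ₂ i (t + 1) * gamma θ₂ i (t + 1) = 2 / ((t : ℝ) + 1) := by
  rw [beta_succ, gamma_succ, mul_assoc, ← Real.rpow_add (by positivity)]
  rw [show -θ₂ + -(1 - θ₂) = -1 by ring, Real.rpow_neg_one]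
  rfl

lemma norm_mix_le {W : Matrix (Fin n) (Fin n) ℝ} (hW : W ∈ doublyStochastic ℝ (Fin n))
    {Y : Fin n → Vec m} {b : ℝ} (h : ∀ i, ‖Y i‖ ≤ b) (i : Fin n) : ‖∑ j, W i j • Y j‖ ≤ b := by
  obtain ⟨h0, hrow, -⟩ := mem_doublyStochastic_iff_sum.1 hW
  calc ‖∑ j, W i j • Y j‖ ≤ ∑ j, ‖W i j • Y j‖ := norm_sum_le _ _
    _ ≤ ∑ j, W i j * b := sum_le_sum fun j _ => by
        rw [norm_smul, Real.norm_of_nonneg (h0 i j)]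
        exact mul_le_mul_of_nonneg_left (h j) (h0 i j)
    _ = b := by rw [← sum_mul, hrow, one_mul]

/-- Jensen's inequality for the squared distance, summed over the learners. -/
lemma sum_norm_mix_sub_sq_le {W : Matrix (Fin n) (Fin n) ℝ} (hW : W ∈ doublyStochastic ℝ (Fin n))
    (Y : Fin n → Vec m) (ν : Vec m) :
    ∑ i, ‖∑ j, W i j • Y j - ν‖ ^ 2 ≤ ∑ i, ‖Y i - ν‖ ^ 2 := by
  obtain ⟨h0, hrow, hcol⟩ := mem_doublyStochastic_iff_sum.1 hW
  have hcv : ConvexOn ℝ Set.univ fun v : Vec m => ‖v‖ ^ 2 :=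
    (convexOn_norm convex_univ).pow (fun _ _ => norm_nonneg _) 2
  calc ∑ i, ‖∑ j, W i j • Y j - ν‖ ^ 2 ≤ ∑ i, ∑ j, W i j * ‖Y j - ν‖ ^ 2 := by
        refine sum_le_sum fun i _ => ?_
        have he : ∑ j, W i j • Y j - ν = ∑ j, W i j • (Y j - ν) := by
          simp_rw [smul_sub, sum_sub_distrib, ← sum_smul, hrow, one_smul]
        rw [he]
        simpa using hcv.map_sum_le (t := univ) (w := W i) (p := fun j => Y j - ν)
          (fun j _ => h0 i j) (hrow i) (fun _ _ => Set.mem_univ _)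
    _ = ∑ j, ‖Y j - ν‖ ^ 2 := by
        rw [sum_comm]
        simp_rw [← sum_mul, hcol, one_mul]

lemma IsDualRun.q_nonneg (h : IsDualRun W θ₂ B q qt c) {i : Fin n} {t : ℕ} (ht : 1 ≤ t)
    (j : Fin m) : 0 ≤ q i t j := by
  rcases ht.eq_or_lt with rfl | ht'
  · simp [h.init]
  · obtain ⟨s, rfl⟩ := Nat.exists_eq_add_of_le' ht
    rw [h.step i s (by omega)]
    exact orthantProj_nonneg _ _

lemma IsDualRun.qt_nonneg (h : IsDualRun W θ₂ B q qt c)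
    (hW : ∀ t, 1 ≤ t → W t ∈ doublyStochastic ℝ (Fin n)) {i : Fin n} {t : ℕ} (ht : 1 ≤ t)
    (j : Fin m) : 0 ≤ qt i (t + 1) j := by
  obtain ⟨h0, -, -⟩ := mem_doublyStochastic_iff_sum.1 (hW t ht)
  rw [h.avg i t ht]
  simp only [WithLp.ofLp_sum, Finset.sum_apply, smul_eq_mul, WithLp.ofLp_smul,
    Pi.smul_apply]
  exact sum_nonneg fun k _ => mul_nonneg (h0 i k) (h.q_nonneg ht j)

/-- The regularization keeps the multipliers of size at most `B / β`. -/
lemma IsDualRun.norm_q_le (h : IsDualRun W θ₂ B q qt c) (hθ : 0 ≤ θ₂) (hB : 0 ≤ B)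
    (hW : ∀ t, 1 ≤ t → W t ∈ doublyStochastic ℝ (Fin n)) {t : ℕ} (ht : 1 ≤ t) (i : Fin n) :
    ‖q i t‖ ≤ B * (t : ℝ) ^ θ₂ / 2 := by
  induction t, ht using Nat.le_induction generalizing i with
  | base => rw [h.init, norm_zero]; positivity
  | succ t ht ih =>
    have hqt : ‖qt i (t + 1)‖ ≤ B * (t : ℝ) ^ θ₂ / 2 := by
      rw [h.avg i t ht]; exact norm_mix_le (hW t ht) ih i
    have hmono : B * (t : ℝ) ^ θ₂ / 2 ≤ B * ((t : ℝ) + 1) ^ θ₂ / 2 := by gcongr; linarith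
    have hγ0 : 0 < gamma θ₂ i (t + 1) := by rw [gamma_succ]; positivity
    have hbg1 : beta θ₂ i (t + 1) * gamma θ₂ i (t + 1) ≤ 1 := by
      rw [beta_mul_gamma_succ, div_le_one (by positivity)]
      have : (1 : ℝ) ≤ t := by exact_mod_cast ht
      linarith
    have hb : beta θ₂ i (t + 1) * ((t : ℝ) + 1) ^ θ₂ = 2 := by
      rw [beta_succ, mul_assoc, ← Real.rpow_add (by positivity)]; simp
    rw [h.step i t ht]
    refine (norm_orthantProj_le _).trans ((norm_add_le _ _).trans ?_)
    rw [norm_smul, norm_smul, Real.norm_of_nonneg hγ0.le, Real.norm_of_nonneg (by linarith)]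
    have h1 := mul_le_mul_of_nonneg_left (hqt.trans hmono) (by linarith :
      0 ≤ 1 - beta θ₂ i (t + 1) * gamma θ₂ i (t + 1))
    have h2 := mul_le_mul_of_nonneg_left (h.bound i t ht) hγ0.le
    have h3 : beta θ₂ i (t + 1) * gamma θ₂ i (t + 1) * (B * ((t : ℝ) + 1) ^ θ₂ / 2) =
        gamma θ₂ i (t + 1) * B := by
      calc _ = gamma θ₂ i (t + 1) * B * (beta θ₂ i (t + 1) * ((t : ℝ) + 1) ^ θ₂) / 2 := by ring
        _ = _ := by rw [hb]; ring
    push_cast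
    linarith

lemma IsDualRun.norm_qt_le (h : IsDualRun W θ₂ B q qt c) (hθ : 0 ≤ θ₂) (hB : 0 ≤ B)
    (hW : ∀ t, 1 ≤ t → W t ∈ doublyStochastic ℝ (Fin n)) {t : ℕ} (ht : 1 ≤ t) (i : Fin n) :
    ‖qt i (t + 1)‖ ≤ B * (t : ℝ) ^ θ₂ / 2 := by
  rw [h.avg i t ht]
  exact norm_mix_le (hW t ht) (h.norm_q_le hθ hB hW ht) i

lemma IsDualRun.beta_mul_norm_qt_le (h : IsDualRun W θ₂ B q qt c) (hθ : 0 ≤ θ₂) (hB : 0 ≤ B)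
    (hW : ∀ t, 1 ≤ t → W t ∈ doublyStochastic ℝ (Fin n)) {t : ℕ} (ht : 1 ≤ t) (i : Fin n) :
    beta θ₂ i (t + 1) * ‖qt i (t + 1)‖ ≤ B := by
  have h1 := h.norm_qt_le hθ hB hW ht i
  have h2 : B * (t : ℝ) ^ θ₂ / 2 ≤ B * ((t : ℝ) + 1) ^ θ₂ / 2 := by gcongr; linarith
  have hb : beta θ₂ i (t + 1) * ((t : ℝ) + 1) ^ θ₂ = 2 := by
    rw [beta_succ, mul_assoc, ← Real.rpow_add (by positivity)]; simp
  have hβ0 : 0 ≤ beta θ₂ i (t + 1) := by rw [beta_succ]; positivity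
  calc _ ≤ beta θ₂ i (t + 1) * (B * ((t : ℝ) + 1) ^ θ₂ / 2) :=
        mul_le_mul_of_nonneg_left (h1.trans h2) hβ0
    _ = B * (beta θ₂ i (t + 1) * ((t : ℝ) + 1) ^ θ₂) / 2 := by ring
    _ = B := by rw [hb]; ring

/-- The multipliers move by at most `2 B γ` away from their averages. -/
lemma IsDualRun.norm_q_sub_qt_le (h : IsDualRun W θ₂ B q qt c) (hθ : 0 ≤ θ₂) (hB : 0 ≤ B)
    (hW : ∀ t, 1 ≤ t → W t ∈ doublyStochastic ℝ (Fin n)) {t : ℕ} (ht : 1 ≤ t) (i : Fin n) :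
    ‖q i (t + 1) - qt i (t + 1)‖ ≤ 2 * B * ((t : ℝ) + 1) ^ (-(1 - θ₂)) := by
  have hγ0 : 0 < gamma θ₂ i (t + 1) := by rw [gamma_succ]; positivity
  have hβ0 : 0 ≤ beta θ₂ i (t + 1) := by rw [beta_succ]; positivity
  have h1 := norm_orthantProj_sub_le ((1 - beta θ₂ i (t + 1) * gamma θ₂ i (t + 1)) • qt i (t + 1)
    + gamma θ₂ i (t + 1) • c i t) (qt i (t + 1))
  rw [orthantProj_of_nonneg (fun j => h.qt_nonneg hW ht j), ← h.step i t ht] at h1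
  refine h1.trans ?_
  have he : (1 - beta θ₂ i (t + 1) * gamma θ₂ i (t + 1)) • qt i (t + 1)
    + gamma θ₂ i (t + 1) • c i t - qt i (t + 1) =
      gamma θ₂ i (t + 1) • (c i t - beta θ₂ i (t + 1) • qt i (t + 1)) := by module
  rw [he, norm_smul, Real.norm_of_nonneg hγ0.le, ← gamma_succ θ₂ i t, mul_comm (2 * B)]
  refine mul_le_mul_of_nonneg_left ((norm_sub_le _ _).trans ?_) hγ0.le
  rw [norm_smul, Real.norm_of_nonneg hβ0]
  have := h.bound i t ht
  have := h.beta_mul_norm_qt_le hθ hB hW ht i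
  linarith

/-- The accumulated distance of the averaged multipliers from consensus. -/
lemma IsDualRun.sum_norm_sub_mean_le {G : ℕ → Digraph (Fin n)} {w : ℝ} {ι : ℕ}
    (h : IsDualRun W θ₂ B q qt c) (hn : 0 < n) (hG : GraphAssumption G W w ι) (hθ : 0 < θ₂)
    (hθ' : θ₂ ≤ 1) (hB : 0 ≤ B) {T : ℕ} (hT : 1 ≤ T) :
    ∑ t ∈ Icc 1 T, ∑ i, ‖qt i (t + 1) - (n : ℝ)⁻¹ • ∑ k, qt k (t + 1)‖ ≤
      8 * (n : ℝ) ^ 4 * ι / w * B * ((T : ℝ) ^ θ₂ / θ₂) := by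
  have hW := hG.doubly
  have hw := hG.w_pos
  have hn' : (0 : ℝ) < n := by exact_mod_cast hn
  set D : ℕ → ℝ := fun t => disagreement fun i => q i t with hD
  have h1 : ∀ t ∈ Icc 1 T, ∑ i, ‖qt i (t + 1) - (n : ℝ)⁻¹ • ∑ k, qt k (t + 1)‖ ≤ √n * D t := by
    intro t ht
    have ht1 := (mem_Icc.1 ht).1
    refine (DBCO.sum_norm_sub_mean_le fun i => qt i (t + 1)).trans ?_
    gcongr
    have he : (fun i => qt i (t + 1)) = mix (W t) fun j => q j t := by
      funext i; exact h.avg i t ht1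
    rw [he]
    exact disagreement_mix_le hn (hW t ht1) _
  have h2 := hG.sum_disagreement_le hn (Y := fun t i => q i t) (e := fun t i => q i t - qt i t)
    (by funext i; exact h.init i) (fun t ht => by
      funext i
      have := h.avg i t ht
      simp only [mix]
      rw [← this]; abel) T
  have h3 : ∑ t ∈ Icc 2 T, disagreement (fun i => q i t - qt i t) ≤
      √n * (2 * B) * ((T : ℝ) ^ θ₂ / θ₂) := by
    have hγsum := sum_rpow_neg_le (s := 1 - θ₂) (by linarith) (by linarith) hT
    rw [sub_sub_cancel] at hγsum
    calc ∑ t ∈ Icc 2 T, disagreement (fun i => q i t - qt i t)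
        ≤ ∑ t ∈ Icc 2 (T + 1), disagreement (fun i => q i t - qt i t) :=
          sum_le_sum_of_subset_of_nonneg (Icc_subset_Icc_right (by omega))
            fun _ _ _ => disagreement_nonneg _
      _ = ∑ t ∈ Icc 1 T, disagreement (fun i => q i (t + 1) - qt i (t + 1)) :=
          (sum_Ico_add' (fun t => disagreement (fun i => q i t - qt i t)) 1 (T + 1) 1).symm
      _ ≤ ∑ t ∈ Icc 1 T, √n * (2 * B) * ((t : ℝ) + 1) ^ (-(1 - θ₂)) := by
          refine sum_le_sum fun t ht => ?_
          rw [mul_assoc]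
          exact disagreement_le_of_norm_le hn fun i =>
            h.norm_q_sub_qt_le hθ.le hB hW (mem_Icc.1 ht).1 i
      _ ≤ _ := by
          rw [← mul_sum]
          exact mul_le_mul_of_nonneg_left hγsum (by positivity)
  have h4 : ∑ t ∈ Icc 1 T, D t ≤
      4 * (n : ℝ) ^ 3 * ι / w * (√n * (2 * B) * ((T : ℝ) ^ θ₂ / θ₂)) := by
    have h5 := h2.trans (mul_le_mul_of_nonneg_left h3 (ι.cast_nonneg))
    rw [div_mul_eq_mul_div, div_le_iff₀ (by positivity)] at h5
    rw [div_mul_eq_mul_div, le_div_iff₀ hw]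
    linarith
  calc _ ≤ ∑ t ∈ Icc 1 T, √n * D t := sum_le_sum h1
    _ = √n * ∑ t ∈ Icc 1 T, D t := (mul_sum _ _ _).symm
    _ ≤ √n * (4 * (n : ℝ) ^ 3 * ι / w * (√n * (2 * B) * ((T : ℝ) ^ θ₂ / θ₂))) := by gcongr
    _ = (√n * √n) * (8 * (n : ℝ) ^ 3 * ι / w * B * ((T : ℝ) ^ θ₂ / θ₂)) := by ring
    _ = _ := by rw [Real.mul_self_sqrt hn'.le]; ring

/-- The dual inequality: the multipliers `qt` do nearly as well as any fixed multiplier `ν ≥ 0`.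
Part of the regularization, `¾ (t+1)^{-θ₂} ‖qt‖²`, is kept in reserve. -/
lemma IsDualRun.sum_inner_sub_le (h : IsDualRun W θ₂ B q qt c) (hθ : 0 < θ₂)
    (hθ' : θ₂ ≤ 1) (hB : 0 ≤ B) (hW : ∀ t, 1 ≤ t → W t ∈ doublyStochastic ℝ (Fin n))
    {ν : Vec m} (hν : ∀ j, 0 ≤ ν j) {T : ℕ} (hT : 1 ≤ T) :
    ∑ t ∈ Icc 1 T, ∑ i, (inner ℝ ν (c i t) - inner ℝ (qt i (t + 1)) (c i t)
        + 3 / 4 * ((t : ℝ) + 1) ^ (-θ₂) * ‖qt i (t + 1)‖ ^ 2) ≤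
      n * (1 / 6 + 5 / 6 * ∑ t ∈ Icc 1 T, ((t : ℝ) + 1) ^ (-θ₂)) * ‖ν‖ ^ 2
        + 2 * n * B ^ 2 * ((T : ℝ) ^ θ₂ / θ₂) := by
  have hstep : ∀ t, 1 ≤ t → ∀ i, inner ℝ ν (c i t) - inner ℝ (qt i (t + 1)) (c i t) ≤
      ((t : ℝ) + 1) ^ (1 - θ₂) / 2 * (‖qt i (t + 1) - ν‖ ^ 2 - ‖q i (t + 1) - ν‖ ^ 2)
      - ((t : ℝ) + 1) ^ (-θ₂) * (‖qt i (t + 1)‖ ^ 2 + ‖qt i (t + 1) - ν‖ ^ 2 - ‖ν‖ ^ 2)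
      + 2 * B ^ 2 * ((t : ℝ) + 1) ^ (-(1 - θ₂)) := by
    intro t ht i
    have hγ0 : 0 < gamma θ₂ i (t + 1) := by rw [gamma_succ]; positivity
    have hβ0 : 0 ≤ beta θ₂ i (t + 1) := by rw [beta_succ]; positivity
    have := dual_step_le hν hγ0 hβ0 (h.bound i t ht) (h.beta_mul_norm_qt_le hθ.le hB hW ht i)
    rw [← h.step i t ht] at this
    refine this.trans_eq ?_
    rw [beta_succ, gamma_succ, Real.rpow_neg (by positivity) (1 - θ₂)]
    have : ((t : ℝ) + 1) ^ (1 - θ₂) ≠ 0 := by positivity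
    field_simp
  -- the induction carries along the potential `(1/2γ) ∑ᵢ ‖qᵢ - ν‖²`
  have main : ∑ t ∈ Icc 1 T, ∑ i, (inner ℝ ν (c i t) - inner ℝ (qt i (t + 1)) (c i t)
        + 3 / 4 * ((t : ℝ) + 1) ^ (-θ₂) * ‖qt i (t + 1)‖ ^ 2)
        + ((T : ℝ) + 1) ^ (1 - θ₂) / 2 * ∑ i, ‖q i (T + 1) - ν‖ ^ 2 ≤
      n * (1 / 6 + 5 / 6 * ∑ t ∈ Icc 1 T, ((t : ℝ) + 1) ^ (-θ₂)) * ‖ν‖ ^ 2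
        + 2 * n * B ^ 2 * ∑ t ∈ Icc 1 T, ((t : ℝ) + 1) ^ (-(1 - θ₂)) := by
    induction T, hT using Nat.le_induction with
    | base =>
      simp only [Icc_self, sum_singleton, Nat.cast_one]
      have hqt0 : ∀ i, qt i (1 + 1) = 0 := fun i => by
        rw [h.avg i 1 le_rfl]; simp [h.init]
      have hs := fun i => hstep 1 le_rfl i
      simp only [hqt0, Nat.cast_one, inner_zero_left, norm_zero] at hs
      have hb : (1 + 1 : ℝ) ^ (1 - θ₂) / 2 = (1 + 1) ^ (-θ₂) := by
        rw [show 1 - θ₂ = -θ₂ + 1 by ring, Real.rpow_add (by norm_num), Real.rpow_one]; ring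
      have hb1 : (1 + 1 : ℝ) ^ (-θ₂) ≤ 1 :=
        Real.rpow_le_one_of_one_le_of_nonpos (by norm_num) (by linarith)
      rw [mul_sum, ← sum_add_distrib]
      rw [hb] at hs ⊢
      generalize (1 + 1 : ℝ) ^ (-θ₂) = Y at hs hb1 ⊢
      generalize (1 + 1 : ℝ) ^ (-(1 - θ₂)) = Z at hs ⊢
      calc _ ≤ ∑ _i : Fin n, (Y * ‖ν‖ ^ 2 + 2 * B ^ 2 * Z) := by
            refine sum_le_sum fun i _ => ?_
            have := hs i
            simp only [hqt0, inner_zero_left, norm_zero, zero_sub, norm_neg] at this ⊢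
            linarith
        _ = n * Y * ‖ν‖ ^ 2 + 2 * n * B ^ 2 * Z := by
            rw [sum_const, card_univ, Fintype.card_fin, nsmul_eq_mul]; ring
        _ ≤ _ := by
            gcongr
            linarith
    | succ T hT ih =>
      rw [sum_Icc_succ_top (by omega), sum_Icc_succ_top (by omega), sum_Icc_succ_top (by omega)]
      have hT0 : (0 : ℝ) < (T : ℝ) + 1 := by positivity
      have hdiff := rpow_one_sub_sub_le hT0 hθ.le
      set b := ((T : ℝ) + 1 + 1) ^ (-θ₂) with hb
      have hb0 : 0 < b := by positivity
      have hcast : ((T + 1 : ℕ) : ℝ) = (T : ℝ) + 1 := by push_cast; rfl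
      simp only [hcast]
      have hs := fun i => hstep (T + 1) (by omega) i
      simp only [hcast, ← hb] at hs
      have hJ := sum_norm_mix_sub_sq_le (hW (T + 1) (by omega)) (fun i => q i (T + 1)) ν
      simp_rw [← h.avg _ (T + 1) (by omega)] at hJ
      have hJ' := mul_le_mul_of_nonneg_left hJ
        (by positivity : 0 ≤ ((T : ℝ) + 1) ^ (1 - θ₂) / 2)
      have hpt : ∀ i, inner ℝ ν (c i (T + 1)) - inner ℝ (qt i (T + 1 + 1)) (c i (T + 1))
          + 3 / 4 * b * ‖qt i (T + 1 + 1)‖ ^ 2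
          + ((T : ℝ) + 1 + 1) ^ (1 - θ₂) / 2 * ‖q i (T + 1 + 1) - ν‖ ^ 2 ≤
          ((T : ℝ) + 1) ^ (1 - θ₂) / 2 * ‖qt i (T + 1 + 1) - ν‖ ^ 2 +
          (5 / 6 * b * ‖ν‖ ^ 2 + 2 * B ^ 2 * ((T : ℝ) + 1 + 1) ^ (-(1 - θ₂))) := by
        intro i
        have h1 := hs i
        have h2 := mul_le_mul_of_nonneg_right hdiff (sq_nonneg ‖qt i (T + 1 + 1) - ν‖)
        -- `¼ ‖a‖² + ½ ‖a - ν‖² ≥ (1/6) ‖ν‖²`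
        have h3 : ‖ν‖ ^ 2 ≤ 3 / 2 * ‖qt i (T + 1 + 1)‖ ^ 2 + 3 * ‖qt i (T + 1 + 1) - ν‖ ^ 2 := by
          have h4 : ‖ν‖ ≤ ‖qt i (T + 1 + 1)‖ + ‖qt i (T + 1 + 1) - ν‖ := by
            have := norm_sub_le (qt i (T + 1 + 1)) (qt i (T + 1 + 1) - ν)
            rwa [sub_sub_cancel] at this
          have h5 := pow_le_pow_left₀ (norm_nonneg _) h4 2
          nlinarith [sq_nonneg (‖qt i (T + 1 + 1)‖ - 2 * ‖qt i (T + 1 + 1) - ν‖)]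
        have h4 := mul_le_mul_of_nonneg_left h3 hb0.le
        linarith
      have hsum := sum_le_sum fun i (_ : i ∈ (univ : Finset (Fin n))) => hpt i
      have hR : ∑ i, (((T : ℝ) + 1) ^ (1 - θ₂) / 2 * ‖qt i (T + 1 + 1) - ν‖ ^ 2 +
          (5 / 6 * b * ‖ν‖ ^ 2 + 2 * B ^ 2 * ((T : ℝ) + 1 + 1) ^ (-(1 - θ₂)))) =
          ((T : ℝ) + 1) ^ (1 - θ₂) / 2 * ∑ i, ‖qt i (T + 1 + 1) - ν‖ ^ 2 +
          n * (5 / 6 * b * ‖ν‖ ^ 2 + 2 * B ^ 2 * ((T : ℝ) + 1 + 1) ^ (-(1 - θ₂))) := by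
        rw [sum_add_distrib, ← mul_sum, sum_const, card_univ, Fintype.card_fin, nsmul_eq_mul]
      rw [hR, sum_add_distrib, ← mul_sum] at hsum
      rw [← hb]
      linarith
  have hγsum := sum_rpow_neg_le (s := 1 - θ₂) (by linarith) (by linarith) hT
  rw [sub_sub_cancel] at hγsum
  have h1 := mul_le_mul_of_nonneg_left hγsum (by positivity : 0 ≤ 2 * (n : ℝ) * B ^ 2)
  have h2 : 0 ≤ ((T : ℝ) + 1) ^ (1 - θ₂) / 2 * ∑ i, ‖q i (T + 1) - ν‖ ^ 2 := by positivity
  linarith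

end Dual

/-! ### The primal iterates of one learner -/

section Primal

open Finset

variable {k m : ℕ}

/-- The variational inequality characterizing the projection onto a convex set. -/
lemma IsProjection.inner_le_zero {K : Set (Vec k)} (hK : Convex ℝ K) {x y y' : Vec k}
    (h : IsProjection K x y) (hy' : y' ∈ K) : inner ℝ (x - y) (y' - y) ≤ 0 := by
  have hle : ∀ w ∈ K, ‖x - y‖ ≤ ‖x - w‖ := fun w hw => le_of_sq_le_sq (h.2 w hw) (norm_nonneg _)
  have hinf : ‖x - y‖ = ⨅ w : K, ‖x - w‖ := by
    have : Nonempty K := ⟨⟨y, h.1⟩⟩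
    refine le_antisymm (le_ciInf fun w => hle w w.2) ?_
    exact ciInf_le ⟨0, by rintro _ ⟨w, rfl⟩; exact norm_nonneg _⟩ (⟨y, h.1⟩ : K)
  exact (norm_eq_iInf_iff_real_inner_le_zero hK h.1).1 hinf y' hy'

lemma IsProjection.norm_sub_le {K : Set (Vec k)} (hK : Convex ℝ K) {x y y' : Vec k}
    (h : IsProjection K x y) (hy' : y' ∈ K) : ‖y - y'‖ ^ 2 ≤ ‖x - y'‖ ^ 2 := by
  have hin := h.inner_le_zero hK hy'
  have he : x - y' = (x - y) - (y' - y) := by abel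
  rw [he, norm_sub_sq_real (x - y), norm_sub_rev y y']
  nlinarith [sq_nonneg ‖x - y‖]

/-- Projections onto a convex set are nonexpansive. -/
lemma IsProjection.norm_sub_le_norm_sub {K : Set (Vec k)} (hK : Convex ℝ K) {x y x' y' : Vec k}
    (h : IsProjection K x y) (h' : IsProjection K x' y') : ‖y - y'‖ ≤ ‖x - x'‖ := by
  have h1 := h.inner_le_zero hK h'.1
  have h2 := h'.inner_le_zero hK h.1
  have h3 : inner ℝ (x - x') (y - y') =
      ‖y - y'‖ ^ 2 - inner ℝ (x - y) (y' - y) - inner ℝ (x' - y') (y - y') := by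
    rw [← real_inner_self_eq_norm_sq, show y' - y = -(y - y') by abel, inner_neg_right,
      sub_neg_eq_add, ← inner_add_left, ← inner_sub_left]
    congr 1
    abel
  have h4 := real_inner_le_norm (x - x') (y - y')
  by_contra hlt
  push Not at hlt
  nlinarith [norm_nonneg (x - x'), norm_nonneg (y - y')]

lemma exists_isProjection {K : Set (Vec k)} (hK : Convex ℝ K) (hc : IsClosed K)
    (hne : K.Nonempty) (x : Vec k) : ∃ y, IsProjection K x y := by
  obtain ⟨y, hy, hmin⟩ := exists_norm_eq_iInf_of_complete_convex hne hc.isComplete hK x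
  refine ⟨y, hy, fun y' hy' => pow_le_pow_left₀ (norm_nonneg _) ?_ 2⟩
  rw [hmin]
  exact ciInf_le ⟨0, by rintro _ ⟨w, rfl⟩; exact norm_nonneg _⟩ (⟨y', hy'⟩ : K)

lemma direction_eq (δ : ℝ) (φ : Vec k → ℝ) (ψ : Vec k → Vec m) (z v : Vec k) (qt : Vec m) :
    direction δ φ ψ z v qt =
      ((k : ℝ) / δ * (φ (z + δ • v) + inner ℝ qt (ψ (z + δ • v)))) • v := by
  simp only [direction, onePointGrad, smul_smul, ← sum_smul, ← add_smul, PiLp.inner_apply,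
    RCLike.inner_apply, conj_trivial, mul_add, mul_sum]
  congr 2
  exact sum_congr rfl fun j _ => by ring

lemma norm_direction_le {δ : ℝ} (hδ : 0 < δ) {φ : Vec k → ℝ} {ψ : Vec k → Vec m} {z v : Vec k}
    (qt : Vec m) (hv : ‖v‖ = 1) {F B : ℝ} (hφ : |φ (z + δ • v)| ≤ F) (hψ : ‖ψ (z + δ • v)‖ ≤ B) :
    ‖direction δ φ ψ z v qt‖ ≤ k / δ * (F + B * ‖qt‖) := by
  rw [direction_eq, norm_smul, hv, mul_one, norm_mul, Real.norm_of_nonneg (by positivity)]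
  gcongr
  refine (norm_add_le _ _).trans (add_le_add hφ ?_)
  refine (norm_inner_le_norm _ _).trans ?_
  rw [mul_comm]
  gcongr

/-- The mean of the update direction over a uniformly distributed `v`. -/
noncomputable def meanDirection (δ : ℝ) (φ : Vec k → ℝ) (ψ : Vec k → Vec m) (z : Vec k)
    (qt : Vec m) : Vec k :=
  ∫ v : Metric.sphere (0 : Vec k) 1, direction δ φ ψ z v qt ∂uniformSphere k

variable {K : Set (Vec k)}

lemma FunAssumption.integrable_onePointGrad (hk : 0 < k) {φ : Vec k → ℝ} {F G : ℝ}
    (h : FunAssumption K φ F G) {z : Vec k} {δ : ℝ}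
    (hz : ∀ v ∈ Metric.closedBall (0 : Vec k) 1, z + δ • v ∈ K) :
    Integrable (fun v : Metric.sphere (0 : Vec k) 1 => onePointGrad δ φ z v) (uniformSphere k) := by
  have := isProbabilityMeasure_uniformSphere hk
  have hc : Continuous fun v : Metric.sphere (0 : Vec k) 1 => onePointGrad δ φ z v :=
    (continuous_const.mul (h.continuous_comp_sphere hz)).smul continuous_subtype_val
  exact hc.integrable_of_hasCompactSupport (HasCompactSupport.of_compactSpace _)

lemma meanDirection_eq (hk : 0 < k) {φ : Vec k → ℝ} {ψ : Vec k → Vec m} {Ff Fg Gf Gg : ℝ}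
    (hφ : FunAssumption K φ Ff Gf) (hψ : ∀ j, FunAssumption K (fun y => ψ y j) Fg Gg)
    {z : Vec k} {δ : ℝ} (hz : ∀ v ∈ Metric.closedBall (0 : Vec k) 1, z + δ • v ∈ K) (qt : Vec m) :
    meanDirection δ φ ψ z qt =
      ∫ v : Metric.sphere (0 : Vec k) 1, onePointGrad δ φ z v ∂uniformSphere k +
      ∑ j, qt j • ∫ v : Metric.sphere (0 : Vec k) 1,
        onePointGrad δ (fun y => ψ y j) z v ∂uniformSphere k := by
  have hi : ∀ j, Integrable (fun v : Metric.sphere (0 : Vec k) 1 =>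
      qt j • onePointGrad δ (fun y => ψ y j) z v) (uniformSphere k) :=
    fun j => ((hψ j).integrable_onePointGrad hk hz).smul (qt j)
  unfold meanDirection direction
  rw [integral_add (hφ.integrable_onePointGrad hk hz) (integrable_finsetSum _ fun j _ => hi j),
    integral_finsetSum _ fun j _ => hi j]
  simp_rw [integral_smul]

/-- The first-order bound for one function: the sampled point, the smoothing and the shrinkage of
the comparator cost at most `(2 r + R) ξ` times the Lipschitz constant. -/
lemma FunAssumption.sub_le_inner_add (hk : 0 < k) (hK : Convex ℝ K) (h0 : (0 : Vec k) ∈ K)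
    {φ : Vec k → ℝ} {F G : ℝ} (h : FunAssumption K φ F G) {r R ξ ξ' : ℝ} (hr : 0 < r) (hξ : 0 < ξ)
    (hξ'0 : 0 ≤ ξ') (hξ' : ξ' ≤ ξ) (hξ'1 : ξ' ≤ 1) {z v y : Vec k}
    (hz : ∀ v ∈ Metric.closedBall (0 : Vec k) 1, z + (r * ξ) • v ∈ K) (hv : ‖v‖ ≤ 1) (hy : y ∈ K)
    (hyR : ‖y‖ ≤ R) :
    φ (z + (r * ξ) • v) - φ y ≤ inner ℝ (∫ v : Metric.sphere (0 : Vec k) 1,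
      onePointGrad (r * ξ) φ z v ∂uniformSphere k) (z - (1 - ξ') • y) + G * ((2 * r + R) * ξ) := by
  have hδ : 0 < r * ξ := by positivity
  have hzK : z ∈ K := by simpa using hz 0 (by simp)
  have hG : 0 ≤ G := (norm_nonneg _).trans (h.grad_bounded z hzK)
  have hy' : (1 - ξ') • y ∈ K := hK.smul_mem_of_zero_mem h0 hy ⟨by linarith, by linarith⟩
  have h1 := h.sub_le_inner_integral hk hδ hz hy'
  have h2 := (le_abs_self _).trans (h.abs_sub_le (hz v (by simpa using hv)) hzK)
  have h3 := (le_abs_self _).trans (h.abs_sub_le hy' hy)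
  have h4 : ‖z + (r * ξ) • v - z‖ ≤ r * ξ := by
    rw [add_sub_cancel_left, norm_smul, Real.norm_of_nonneg hδ.le]
    exact mul_le_of_le_one_right hδ.le hv
  have h5 : ‖(1 - ξ') • y - y‖ ≤ R * ξ := by
    have : (1 - ξ') • y - y = (-ξ') • y := by module
    rw [this, norm_smul, norm_neg, Real.norm_of_nonneg hξ'0, mul_comm]
    exact mul_le_mul hyR hξ' hξ'0 ((norm_nonneg _).trans hyR)
  have h6 := mul_le_mul_of_nonneg_left h4 hG
  have h7 := mul_le_mul_of_nonneg_left h5 hG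
  linarith

/-- The primal part of a run for one learner with decision set `K`, directions `u` and averaged
multipliers `qt`; the exploration parameters are `r ξ`. -/
structure IsPrimalRun (K : Set (Vec k)) (r R Ff Fg Gf Gg : ℝ) (α ξ : ℕ → ℝ)
    (f : ℕ → Vec k → ℝ) (g : ℕ → Vec k → Vec m) (u : ℕ → Metric.sphere (0 : Vec k) 1)
    (z x : ℕ → Vec k) (qt : ℕ → Vec m) : Prop where
  k_pos : 0 < k
  r_pos : 0 < r
  convex : Convex ℝ K
  inner_ball : Metric.closedBall 0 r ⊆ K
  outer_ball : K ⊆ Metric.closedBall 0 R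
  loss : ∀ t, 1 ≤ t → FunAssumption K (f t) Ff Gf
  constraint : ∀ t, 1 ≤ t → ∀ j, FunAssumption K (fun y => g t y j) Fg Gg
  α_pos : ∀ t, 1 ≤ t → 0 < α t
  α_anti : ∀ t, 1 ≤ t → α (t + 1) ≤ α t
  ξ_pos : ∀ t, 1 ≤ t → 0 < ξ t
  ξ_le : ∀ t, 1 ≤ t → ξ t ≤ 1
  ξ_anti : ∀ t, 1 ≤ t → ξ (t + 1) ≤ ξ t
  z_init : z 1 ∈ (1 - ξ 1) • K
  x_eq : ∀ t, 1 ≤ t → x t = z t + (r * ξ t) • (u t : Vec k)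
  z_step : ∀ t, 1 ≤ t → IsProjection ((1 - ξ (t + 1)) • K)
    (z t - α (t + 1) • direction (r * ξ t) (f t) (g t) (z t) (u t : Vec k) (qt (t + 1))) (z (t + 1))
  qt_nonneg : ∀ t, 1 ≤ t → ∀ j, 0 ≤ qt (t + 1) j

variable {r R Ff Fg Gf Gg : ℝ} {α ξ : ℕ → ℝ} {f : ℕ → Vec k → ℝ} {g : ℕ → Vec k → Vec m}
  {u : ℕ → Metric.sphere (0 : Vec k) 1} {z x : ℕ → Vec k} {qt : ℕ → Vec m}

lemma add_smul_mem_of_mem_smul (hK : Convex ℝ K) {r ξ : ℝ} (hr : 0 ≤ r)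
    (hball : Metric.closedBall 0 r ⊆ K) (h0 : 0 ≤ ξ) (h1 : ξ ≤ 1) {z v : Vec k}
    (hz : z ∈ (1 - ξ) • K) (hv : v ∈ Metric.closedBall (0 : Vec k) 1) : z + (r * ξ) • v ∈ K := by
  obtain ⟨c, hc, rfl⟩ := Set.mem_smul_set.1 hz
  have hrv : r • v ∈ K := by
    refine hball ?_
    rw [mem_closedBall_zero_iff, norm_smul, Real.norm_of_nonneg hr]
    exact mul_le_of_le_one_right hr (mem_closedBall_zero_iff.1 hv)
  have := hK hc hrv (sub_nonneg.2 h1) h0 (by ring)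
  rwa [smul_smul, mul_comm ξ r] at this

namespace IsPrimalRun

lemma z_mem (h : IsPrimalRun K r R Ff Fg Gf Gg α ξ f g u z x qt) {t : ℕ} (ht : 1 ≤ t) :
    z t ∈ (1 - ξ t) • K := by
  rcases ht.eq_or_lt with rfl | ht'
  · exact h.z_init
  · obtain ⟨s, rfl⟩ := Nat.exists_eq_add_of_le' ht
    exact (h.z_step s (by omega)).1

lemma zero_mem (h : IsPrimalRun K r R Ff Fg Gf Gg α ξ f g u z x qt) : (0 : Vec k) ∈ K :=
  h.inner_ball (by simp [h.r_pos.le])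

lemma add_mem (h : IsPrimalRun K r R Ff Fg Gf Gg α ξ f g u z x qt) {t : ℕ} (ht : 1 ≤ t) :
    ∀ v ∈ Metric.closedBall (0 : Vec k) 1, z t + (r * ξ t) • v ∈ K := fun _ hv =>
  add_smul_mem_of_mem_smul h.convex h.r_pos.le h.inner_ball (h.ξ_pos t ht).le (h.ξ_le t ht)
    (h.z_mem ht) hv

lemma x_mem (h : IsPrimalRun K r R Ff Fg Gf Gg α ξ f g u z x qt) {t : ℕ} (ht : 1 ≤ t) :
    x t ∈ K := by
  rw [h.x_eq t ht]
  exact h.add_mem ht _ (Metric.sphere_subset_closedBall (u t).2)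

lemma norm_z_le (h : IsPrimalRun K r R Ff Fg Gf Gg α ξ f g u z x qt) {t : ℕ} (ht : 1 ≤ t) :
    ‖z t‖ ≤ R := by
  have : z t ∈ K := by simpa using h.add_mem ht 0 (by simp)
  exact mem_closedBall_zero_iff.1 (h.outer_ball this)

lemma R_nonneg (h : IsPrimalRun K r R Ff Fg Gf Gg α ξ f g u z x qt) : 0 ≤ R :=
  (norm_nonneg _).trans (h.norm_z_le le_rfl)

lemma sub_le_inner_meanDirection (h : IsPrimalRun K r R Ff Fg Gf Gg α ξ f g u z x qt) {t : ℕ}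
    (ht : 1 ≤ t) {y : Vec k} (hy : y ∈ K) :
    f t (x t) - f t y + (inner ℝ (qt (t + 1)) (g t (x t)) - inner ℝ (qt (t + 1)) (g t y)) ≤
      inner ℝ (meanDirection (r * ξ t) (f t) (g t) (z t) (qt (t + 1))) (z t - (1 - ξ (t + 1)) • y)
      + (Gf + Gg * (√m * ‖qt (t + 1)‖)) * ((2 * r + R) * ξ t) := by
  have hyR : ‖y‖ ≤ R := mem_closedBall_zero_iff.1 (h.outer_ball hy)
  have hv : ‖(u t : Vec k)‖ ≤ 1 := by rw [norm_eq_of_mem_sphere]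
  have hξ' := h.ξ_pos (t + 1) (by omega)
  have hξ1 := h.ξ_le (t + 1) (by omega)
  have hξ := h.ξ_pos t ht
  have hf := (h.loss t ht).sub_le_inner_add h.k_pos h.convex h.zero_mem h.r_pos hξ
    hξ'.le (h.ξ_anti t ht) hξ1 (h.add_mem ht) hv hy hyR
  have hg := fun j => (h.constraint t ht j).sub_le_inner_add h.k_pos h.convex h.zero_mem h.r_pos hξ
    hξ'.le (h.ξ_anti t ht) hξ1 (h.add_mem ht) hv hy hyR
  rw [← h.x_eq t ht] at hf hg
  rw [meanDirection_eq h.k_pos (h.loss t ht) (h.constraint t ht) (h.add_mem ht), inner_add_left,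
    sum_inner]
  simp_rw [real_inner_smul_left]
  have hsum := sum_le_sum fun j (_ : j ∈ (univ : Finset (Fin m))) =>
    mul_le_mul_of_nonneg_left (hg j) (h.qt_nonneg t ht j)
  simp_rw [mul_add, mul_sub, sum_add_distrib, sum_sub_distrib, ← sum_mul] at hsum
  have hin : ∀ w : Vec m, inner ℝ (qt (t + 1)) w = ∑ j, qt (t + 1) j * w j := fun w => by
    simp [PiLp.inner_apply, mul_comm]
  rw [hin, hin]
  have hR := h.R_nonneg
  have hr := h.r_pos
  rcases Nat.eq_zero_or_pos m with rfl | hm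
  · simp only [univ_eq_empty, sum_empty, zero_mul, sub_zero, add_zero, Nat.cast_zero,
      Real.sqrt_zero, mul_zero] at hsum ⊢
    linarith
  have hGg : 0 ≤ Gg := (norm_nonneg _).trans
    ((h.constraint t ht ⟨0, hm⟩).grad_bounded _ (h.x_mem ht))
  have h1 := mul_le_mul_of_nonneg_right (sum_le_sqrt_mul_norm (qt (t + 1)))
    (by positivity : 0 ≤ Gg * ((2 * r + R) * ξ t))
  linarith

/-- The deviation of the sampled update direction from its mean. -/
noncomputable def noise (r : ℝ) (ξ : ℕ → ℝ) (f : ℕ → Vec k → ℝ) (g : ℕ → Vec k → Vec m)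
    (u : ℕ → Metric.sphere (0 : Vec k) 1) (z : ℕ → Vec k) (qt : ℕ → Vec m) (t : ℕ) : Vec k :=
  direction (r * ξ t) (f t) (g t) (z t) (u t : Vec k) (qt (t + 1)) -
    meanDirection (r * ξ t) (f t) (g t) (z t) (qt (t + 1))

/-- Projected gradient descent on slowly growing sets against the shrunken comparators
`(1 - ξ) y`. -/
lemma sum_inner_direction_le (h : IsPrimalRun K r R Ff Fg Gf Gg α ξ f g u z x qt) {y : Vec k}
    (hy : y ∈ K) {T : ℕ} (hT : 1 ≤ T) (a : ℕ → Vec k)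
    (ha : ∀ t, a t = direction (r * ξ t) (f t) (g t) (z t) (u t : Vec k) (qt (t + 1))) :
    ∑ t ∈ Icc 1 T, (inner ℝ (a t) (z t - (1 - ξ (t + 1)) • y) - α (t + 1) / 2 * ‖a t‖ ^ 2) ≤
      2 * R ^ 2 * (1 + (ξ 2 - ξ (T + 1))) / α (T + 1) := by
  have hyR : ‖y‖ ≤ R := mem_closedBall_zero_iff.1 (h.outer_ball hy)
  have hR := h.R_nonneg
  have hyξ : ∀ t, 1 ≤ t → ‖(1 - ξ t) • y‖ ≤ R := fun t ht => by
    rw [norm_smul, Real.norm_of_nonneg (by linarith [h.ξ_le t ht])]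
    exact (mul_le_of_le_one_left (norm_nonneg _) (by linarith [h.ξ_pos t ht])).trans hyR
  have hdist : ∀ s t, 1 ≤ s → 1 ≤ t → ‖z s - (1 - ξ t) • y‖ ≤ 2 * R := fun s t hs ht => by
    have := norm_sub_le (z s) ((1 - ξ t) • y)
    have := h.norm_z_le hs
    have := hyξ t ht
    linarith
  have hdistsq : ∀ s t, 1 ≤ s → 1 ≤ t → ‖z s - (1 - ξ t) • y‖ ^ 2 ≤ 4 * R ^ 2 := fun s t hs ht => by
    calc _ ≤ (2 * R) ^ 2 := pow_le_pow_left₀ (norm_nonneg _) (hdist s t hs ht) 2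
      _ = _ := by ring
  have hone : ∀ t, 1 ≤ t →
      inner ℝ (a t) (z t - (1 - ξ (t + 1)) • y) - α (t + 1) / 2 * ‖a t‖ ^ 2 ≤
        (‖z t - (1 - ξ (t + 1)) • y‖ ^ 2 - ‖z (t + 1) - (1 - ξ (t + 1)) • y‖ ^ 2)
          / (2 * α (t + 1)) := by
    intro t ht
    have hα := h.α_pos (t + 1) (by omega)
    have hp := (h.z_step t ht).norm_sub_le (h.convex.smul _) (Set.smul_mem_smul_set hy)
    rw [← ha t] at hp
    have he : z t - α (t + 1) • a t - (1 - ξ (t + 1)) • y =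
        (z t - (1 - ξ (t + 1)) • y) - α (t + 1) • a t := by abel
    rw [he, norm_sub_sq_real (z t - (1 - ξ (t + 1)) • y), real_inner_smul_right, norm_smul, mul_pow,
      Real.norm_of_nonneg hα.le, real_inner_comm] at hp
    rw [le_div_iff₀ (by positivity)]
    linarith
  have hshift : ∀ t, 1 ≤ t → ‖z t - (1 - ξ (t + 1)) • y‖ ^ 2 ≤
      ‖z t - (1 - ξ t) • y‖ ^ 2 + 4 * R ^ 2 * (ξ t - ξ (t + 1)) := by
    intro t ht
    have h1 := hdist t (t + 1) ht (by omega)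
    have h2 := hdist t t ht ht
    have h3 : ‖z t - (1 - ξ (t + 1)) • y‖ - ‖z t - (1 - ξ t) • y‖ ≤ R * (ξ t - ξ (t + 1)) := by
      refine (norm_sub_norm_le _ _).trans ?_
      have : z t - (1 - ξ (t + 1)) • y - (z t - (1 - ξ t) • y) = (-(ξ t - ξ (t + 1))) • y := by
        module
      rw [this, norm_smul, norm_neg, Real.norm_of_nonneg (sub_nonneg.2 (h.ξ_anti t ht)), mul_comm]
      exact mul_le_mul_of_nonneg_right hyR (sub_nonneg.2 (h.ξ_anti t ht))
    have h4 : 0 ≤ R * (ξ t - ξ (t + 1)) := mul_nonneg hR (sub_nonneg.2 (h.ξ_anti t ht))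
    have h5 : 0 ≤ ‖z t - (1 - ξ (t + 1)) • y‖ + ‖z t - (1 - ξ t) • y‖ := by positivity
    nlinarith
  have main : ∑ t ∈ Icc 1 T,
      (inner ℝ (a t) (z t - (1 - ξ (t + 1)) • y) - α (t + 1) / 2 * ‖a t‖ ^ 2)
      + ‖z (T + 1) - (1 - ξ (T + 1)) • y‖ ^ 2 / (2 * α (T + 1)) ≤
      2 * R ^ 2 * (1 + (ξ 2 - ξ (T + 1))) / α (T + 1) := by
    induction T, hT using Nat.le_induction with
    | base =>
      rw [Icc_self, sum_singleton]
      have hα := h.α_pos 2 (by omega)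
      have h1 := hone 1 le_rfl
      have h2 := hdistsq 1 2 le_rfl (by omega)
      simp only [Nat.reduceAdd] at h1 ⊢
      rw [sub_self, add_zero, mul_one]
      have h3 : ‖z 1 - (1 - ξ 2) • y‖ ^ 2 / (2 * α 2) ≤ 2 * R ^ 2 / α 2 := by
        rw [div_le_div_iff₀ (by positivity) hα]
        nlinarith
      rw [sub_div] at h1
      linarith
    | succ T hT ih =>
      rw [sum_Icc_succ_top (by omega)]
      have h1 := hone (T + 1) (by omega)
      have h2 := hshift (T + 1) (by omega)
      have h3 := hdistsq (T + 1) (T + 1) (by omega) (by omega)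
      have hα := h.α_pos (T + 1) (by omega)
      have hα' := h.α_pos (T + 1 + 1) (by omega)
      have hanti := h.α_anti (T + 1) (by omega)
      have hξ2 : ξ (T + 1) ≤ ξ 2 := by
        clear ih h1 h2 h3 hα hα' hanti
        induction T, hT using Nat.le_induction with
        | base => exact le_rfl
        | succ T hT ih => exact (h.ξ_anti (T + 1) (by omega)).trans ih
      set D := ‖z (T + 1) - (1 - ξ (T + 1)) • y‖ ^ 2
      set D1 := ‖z (T + 1) - (1 - ξ (T + 1 + 1)) • y‖ ^ 2
      set D2 := ‖z (T + 1 + 1) - (1 - ξ (T + 1 + 1)) • y‖ ^ 2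
      have hinv : (α (T + 1))⁻¹ ≤ (α (T + 1 + 1))⁻¹ := inv_anti₀ hα' hanti
      have e1 : ∀ c a : ℝ, c / (2 * a) = c * a⁻¹ / 2 := fun c a => by
        rw [div_eq_mul_inv, mul_inv]; ring
      rw [e1, div_eq_mul_inv _ (α (T + 1))] at ih
      rw [e1] at h1
      rw [e1, div_eq_mul_inv _ (α (T + 1 + 1))]
      set b := (α (T + 1))⁻¹
      set b' := (α (T + 1 + 1))⁻¹
      have hb : 0 < b := inv_pos.2 hα
      have hb' : 0 < b' := inv_pos.2 hα'
      have h4 := mul_le_mul_of_nonneg_right h2 hb'.le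
      have h5 := mul_nonneg (sub_nonneg.2 hinv) (sub_nonneg.2 h3)
      have h6 := mul_nonneg (mul_nonneg (sub_nonneg.2 hinv) (sq_nonneg R)) (sub_nonneg.2 hξ2)
      linarith
  have : 0 ≤ ‖z (T + 1) - (1 - ξ (T + 1)) • y‖ ^ 2 / (2 * α (T + 1)) := by
    have := h.α_pos (T + 1) (by omega)
    positivity
  linarith

/-- The part of the regret of one learner that is due to sampling. Its mean is nonpositive. -/
noncomputable def noiseTerm (α ξ : ℕ → ℝ) (z a e : ℕ → Vec k) (T : ℕ) : ℝ :=
  α (T + 1) / 4 * ‖∑ t ∈ Icc 1 T, (1 - ξ (t + 1)) • e t‖ ^ 2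
    - ∑ t ∈ Icc 1 T, (inner ℝ (e t) (z t) + α (t + 1) / 4 * ‖a t‖ ^ 2)

/-- The regret of one learner against an arbitrary comparator, which may depend on all the
directions: the comparator enters the noise only through `⟨∑ (1 - ξ) e, y⟩`, which Young's
inequality bounds uniformly in `y`. -/
lemma sum_le (h : IsPrimalRun K r R Ff Fg Gf Gg α ξ f g u z x qt) {y : Vec k}
    (hy : y ∈ K) {T : ℕ} (hT : 1 ≤ T) (a : ℕ → Vec k)
    (ha : ∀ t, a t = direction (r * ξ t) (f t) (g t) (z t) (u t : Vec k) (qt (t + 1))) :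
    ∑ t ∈ Icc 1 T, (f t (x t) - f t y +
        (inner ℝ (qt (t + 1)) (g t (x t)) - inner ℝ (qt (t + 1)) (g t y))) ≤
      noiseTerm α ξ z a (noise r ξ f g u z qt) T
      + ∑ t ∈ Icc 1 T, ((Gf + Gg * (√m * ‖qt (t + 1)‖)) * ((2 * r + R) * ξ t)
          + 3 / 4 * α (t + 1) * ‖a t‖ ^ 2)
      + R ^ 2 * (3 + 2 * (ξ 2 - ξ (T + 1))) / α (T + 1) := by
  have hyR : ‖y‖ ≤ R := mem_closedBall_zero_iff.1 (h.outer_ball hy)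
  have hα := h.α_pos (T + 1) (by omega)
  set e := noise r ξ f g u z qt with he
  set S := ∑ t ∈ Icc 1 T, (1 - ξ (t + 1)) • e t with hS
  have hdesc := h.sum_inner_direction_le hy hT a ha
  have hyoung : inner ℝ S y ≤ R ^ 2 / α (T + 1) + α (T + 1) / 4 * ‖S‖ ^ 2 := by
    have h1 : inner ℝ S y ≤ ‖S‖ * R :=
      (real_inner_le_norm _ _).trans (mul_le_mul_of_nonneg_left hyR (norm_nonneg _))
    refine h1.trans ?_
    rw [div_add' _ _ _ hα.ne', le_div_iff₀ hα]
    nlinarith [sq_nonneg (R - α (T + 1) / 2 * ‖S‖)]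
  have hSy : inner ℝ S y = ∑ t ∈ Icc 1 T, (1 - ξ (t + 1)) * inner ℝ (e t) y := by
    rw [hS, sum_inner]
    simp_rw [real_inner_smul_left]
  have hid : ∀ t, inner ℝ (meanDirection (r * ξ t) (f t) (g t) (z t) (qt (t + 1)))
      (z t - (1 - ξ (t + 1)) • y) =
      (inner ℝ (a t) (z t - (1 - ξ (t + 1)) • y) - α (t + 1) / 2 * ‖a t‖ ^ 2)
      - (inner ℝ (e t) (z t) + α (t + 1) / 4 * ‖a t‖ ^ 2) + (1 - ξ (t + 1)) * inner ℝ (e t) y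
      + 3 / 4 * α (t + 1) * ‖a t‖ ^ 2 := by
    intro t
    have hm : meanDirection (r * ξ t) (f t) (g t) (z t) (qt (t + 1)) = a t - e t := by
      rw [he, noise, ha]; abel
    rw [hm, inner_sub_left, inner_sub_right (e t), real_inner_smul_right]
    ring
  have hpt := sum_le_sum fun t (ht : t ∈ Icc 1 T) =>
    (h.sub_le_inner_meanDirection (mem_Icc.1 ht).1 hy).trans_eq (by rw [hid, add_assoc])
  have hright : ∑ t ∈ Icc 1 T,
      ((inner ℝ (a t) (z t - (1 - ξ (t + 1)) • y) - α (t + 1) / 2 * ‖a t‖ ^ 2)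
      - (inner ℝ (e t) (z t) + α (t + 1) / 4 * ‖a t‖ ^ 2) + (1 - ξ (t + 1)) * inner ℝ (e t) y
      + (3 / 4 * α (t + 1) * ‖a t‖ ^ 2 +
        (Gf + Gg * (√m * ‖qt (t + 1)‖)) * ((2 * r + R) * ξ t))) =
      ∑ t ∈ Icc 1 T, (inner ℝ (a t) (z t - (1 - ξ (t + 1)) • y) - α (t + 1) / 2 * ‖a t‖ ^ 2)
      - ∑ t ∈ Icc 1 T, (inner ℝ (e t) (z t) + α (t + 1) / 4 * ‖a t‖ ^ 2) + inner ℝ S y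
      + ∑ t ∈ Icc 1 T, ((Gf + Gg * (√m * ‖qt (t + 1)‖)) * ((2 * r + R) * ξ t)
        + 3 / 4 * α (t + 1) * ‖a t‖ ^ 2) := by
    rw [hSy, ← sum_sub_distrib, ← sum_add_distrib, ← sum_add_distrib]
    exact sum_congr rfl fun t _ => by ring
  rw [hright] at hpt
  have hsplit : R ^ 2 * (3 + 2 * (ξ 2 - ξ (T + 1))) / α (T + 1) =
      R ^ 2 / α (T + 1) + 2 * R ^ 2 * (1 + (ξ 2 - ξ (T + 1))) / α (T + 1) := by
    rw [← add_div]; ring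
  rw [noiseTerm, ← hS, hsplit]
  linarith

end IsPrimalRun

end Primal

/-! ### The pathwise regret inequality -/

section Pathwise

open Finset

lemma xi_eq {n : ℕ} (θ₃ : ℝ) (i : Fin n) (t : ℕ) : xi θ₃ i t = ((t : ℝ) + 1) ^ (-θ₃) := by
  rw [xi, Real.rpow_neg (by positivity), one_div]

lemma delta_eq {n : ℕ} (r : Fin n → ℝ) (θ₃ : ℝ) (i : Fin n) (t : ℕ) :
    delta r θ₃ i t = r i * xi θ₃ i t := by
  rw [delta, xi, mul_one_div]

lemma alpha_pos {n m : ℕ} (hm : 0 < m) {p : Fin n → ℕ} {r Fg : Fin n → ℝ} {θ₁ : ℝ} {i : Fin n}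
    (hp : 0 < p i) (hr : 0 < r i) (hF : 0 < Fg i) {t : ℕ} (ht : 1 ≤ t) :
    0 < alpha m p r Fg θ₁ i t := by
  have : (0 : ℝ) < t := by exact_mod_cast ht
  have : (0 : ℝ) < p i := by exact_mod_cast hp
  have : (0 : ℝ) < m := by exact_mod_cast hm
  unfold alpha
  positivity

/-- The stepsize absorbs the size of the one-point estimates: up to a term of order `t^{θ₁-1}`,
the second-order term of the descent is paid for by the dual regularization. -/
lemma alpha_mul_norm_sq_le {n m : ℕ} (hm : 0 < m) {p : Fin n → ℕ} {r Fg : Fin n → ℝ}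
    {θ₁ θ₂ θ₃ : ℝ} {i : Fin n} (hp : 0 < p i) (hr : 0 < r i) (hF : 0 < Fg i)
    (h2 : θ₁ - 1 ≤ -θ₂) (h3 : 2 * θ₃ - θ₁ = θ₁ - 1) {t : ℕ} {F A Q : ℝ} (hA0 : 0 ≤ A)
    (hA : A ≤ p i / (r i * xi θ₃ i t) * (F + √m * Fg i * Q)) :
    3 / 4 * alpha m p r Fg θ₁ i (t + 1) * A ^ 2 ≤
      F ^ 2 / (4 * m * Fg i ^ 2) * ((t : ℝ) + 1) ^ (θ₁ - 1)
        + 3 / 4 * ((t : ℝ) + 1) ^ (-θ₂) * Q ^ 2 := by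
  have hp' : (0 : ℝ) < p i := by exact_mod_cast hp
  have hm' : (0 : ℝ) < m := by exact_mod_cast hm
  have hα := alpha_pos hm (θ₁ := θ₁) hp hr hF (t := t + 1) (by omega)
  have ht1 : (1 : ℝ) ≤ (t : ℝ) + 1 := by linarith [t.cast_nonneg (α := ℝ)]
  have ht0 : (0 : ℝ) < (t : ℝ) + 1 := by linarith
  have h4 : A ^ 2 ≤
      (p i / (r i * xi θ₃ i t)) ^ 2 * (4 / 3 * F ^ 2 + 4 * (m * Fg i ^ 2 * Q ^ 2)) := by
    refine (pow_le_pow_left₀ hA0 hA 2).trans ?_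
    rw [mul_pow]
    refine mul_le_mul_of_nonneg_left ?_ (sq_nonneg _)
    have hs : √(m : ℝ) ^ 2 = m := Real.sq_sqrt hm'.le
    have : (m : ℝ) * Fg i ^ 2 * Q ^ 2 = (√m * Fg i * Q) ^ 2 := by
      rw [mul_pow, mul_pow, hs]
    rw [this]
    nlinarith [sq_nonneg (F - 3 * (√m * Fg i * Q))]
  have h5 : alpha m p r Fg θ₁ i (t + 1) * (p i / (r i * xi θ₃ i t)) ^ 2 =
      ((t : ℝ) + 1) ^ (θ₁ - 1) / (4 * m * Fg i ^ 2) := by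
    have e1 : ((t : ℝ) + 1) ^ (θ₁ - 1) = (((t : ℝ) + 1) ^ θ₃) ^ 2 / ((t : ℝ) + 1) ^ θ₁ := by
      rw [← h3, Real.rpow_sub ht0, mul_comm, Real.rpow_mul ht0.le]
      norm_num
    rw [e1, alpha, xi]
    push_cast
    have : 0 < ((t : ℝ) + 1) ^ θ₁ := by positivity
    have : 0 < ((t : ℝ) + 1) ^ θ₃ := by positivity
    field_simp
  have h6 : ((t : ℝ) + 1) ^ (θ₁ - 1) ≤ ((t : ℝ) + 1) ^ (-θ₂) :=
    Real.rpow_le_rpow_of_exponent_le ht1 h2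
  calc 3 / 4 * alpha m p r Fg θ₁ i (t + 1) * A ^ 2
      ≤ 3 / 4 * alpha m p r Fg θ₁ i (t + 1) * ((p i / (r i * xi θ₃ i t)) ^ 2 *
          (4 / 3 * F ^ 2 + 4 * (m * Fg i ^ 2 * Q ^ 2))) :=
        mul_le_mul_of_nonneg_left h4 (by positivity)
    _ = (alpha m p r Fg θ₁ i (t + 1) * (p i / (r i * xi θ₃ i t)) ^ 2) *
          (F ^ 2 + 3 * (m * Fg i ^ 2 * Q ^ 2)) := by ring
    _ = F ^ 2 / (4 * m * Fg i ^ 2) * ((t : ℝ) + 1) ^ (θ₁ - 1)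
        + 3 / 4 * ((t : ℝ) + 1) ^ (θ₁ - 1) * Q ^ 2 := by
        rw [h5]; field_simp
    _ ≤ _ := by gcongr

variable {n m : ℕ} {p : Fin n → ℕ} {r R Ff Fg Gf Gg : Fin n → ℝ} {θ₁ θ₂ θ₃ : ℝ}

/-- The regret bound for one learner with the stepsizes of the algorithm. -/
lemma IsPrimalRun.sum_le_of_stepsizes (hm : 0 < m) (hθ₁ : θ₁ ∈ Set.Ioc (3 / 4 : ℝ) (5 / 6))
    (hθ₂ : θ₂ = 2 * θ₁ - 3 / 2) (hθ₃ : θ₃ = θ₁ - 1 / 2) {i : Fin n}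
    (hFf : 0 < Ff i) (hFg : 0 < Fg i) (hGf : 0 < Gf i) (hGg : 0 < Gg i)
    {K : Set (Vec (p i))} {f : ℕ → Vec (p i) → ℝ} {g : ℕ → Vec (p i) → Vec m}
    {u : ℕ → Metric.sphere (0 : Vec (p i)) 1} {z x : ℕ → Vec (p i)} {qt : ℕ → Vec m} {F : ℝ}
    (hF0 : 0 ≤ F)
    (h : IsPrimalRun K (r i) (R i) (Ff i) (Fg i) (Gf i) (Gg i) (alpha m p r Fg θ₁ i) (xi θ₃ i)
      f g u z x qt)
    (hqt : ∀ t, 1 ≤ t → ‖qt (t + 1)‖ ≤ √m * F * (t : ℝ) ^ θ₂ / 2)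
    {y : Vec (p i)} (hy : y ∈ K) {T : ℕ} (hT : 1 ≤ T) (a : ℕ → Vec (p i))
    (ha : ∀ t, a t = direction (r i * xi θ₃ i t) (f t) (g t) (z t) (u t : Vec (p i)) (qt (t + 1))) :
    ∑ t ∈ Icc 1 T, (f t (x t) - f t y +
        (inner ℝ (qt (t + 1)) (g t (x t)) - inner ℝ (qt (t + 1)) (g t y))) ≤
      noiseTerm (alpha m p r Fg θ₁ i) (xi θ₃ i) z a (noise (r i) (xi θ₃ i) f g u z qt) T
      + (m * F * Gg i * (2 * r i + R i) / (1 - θ₃ + θ₂)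
        + Gf i * (2 * r i + R i) / (1 - θ₃)
        + 8 * m * (p i : ℝ) ^ 2 * Fg i ^ 2 * R i ^ 2 / r i ^ 2
        + Ff i ^ 2 / (4 * m * Fg i ^ 2 * (1 - θ₁ + 2 * θ₃))
        + 16 * m * (p i : ℝ) ^ 2 * Fg i ^ 2 * R i ^ 2 / r i ^ 2) * (T : ℝ) ^ θ₁
      + ∑ t ∈ Icc 1 T, 3 / 4 * ((t : ℝ) + 1) ^ (-θ₂) * ‖qt (t + 1)‖ ^ 2 := by
  obtain ⟨hθa, hθb⟩ := hθ₁
  have hθpos : 0 < θ₁ := by linarith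
  have e1 : 1 - θ₃ + θ₂ = θ₁ := by linarith
  have e2 : 1 - θ₁ + 2 * θ₃ = θ₁ := by linarith
  have hm' : (0 : ℝ) < m := by exact_mod_cast hm
  have hr := h.r_pos
  have hR := h.R_nonneg
  have hp' : (0 : ℝ) < p i := by exact_mod_cast h.k_pos
  have hT' : (1 : ℝ) ≤ T := by exact_mod_cast hT
  have hL : 0 ≤ 2 * r i + R i := by linarith
  rw [e1, e2]
  have hmain := h.sum_le hy hT a ha
  have hsq : √(m : ℝ) * √m = m := Real.mul_self_sqrt hm'.le
  have hpt : ∀ t ∈ Icc 1 T, (Gf i + Gg i * (√m * ‖qt (t + 1)‖)) * ((2 * r i + R i) * xi θ₃ i t)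
      + 3 / 4 * alpha m p r Fg θ₁ i (t + 1) * ‖a t‖ ^ 2 ≤
      Gf i * (2 * r i + R i) * ((t : ℝ) + 1) ^ (-θ₃) +
      (m * F * Gg i * (2 * r i + R i) + Ff i ^ 2 / (4 * m * Fg i ^ 2)) *
        ((t : ℝ) + 1) ^ (-(1 - θ₁)) +
      3 / 4 * ((t : ℝ) + 1) ^ (-θ₂) * ‖qt (t + 1)‖ ^ 2 := by
    intro t ht
    have ht1 := (mem_Icc.1 ht).1
    have ht0 : (0 : ℝ) < (t : ℝ) + 1 := by positivity
    have hx := h.x_mem ht1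
    have hgx : ‖g t (z t + (r i * xi θ₃ i t) • (u t : Vec (p i)))‖ ≤ √m * Fg i := by
      rw [← h.x_eq t ht1]
      exact norm_le_sqrt_mul hFg.le fun j => (h.constraint t ht1 j).bounded _ hx
    have hfx : |f t (z t + (r i * xi θ₃ i t) • (u t : Vec (p i)))| ≤ Ff i := by
      rw [← h.x_eq t ht1]
      exact (h.loss t ht1).bounded _ hx
    have hξ := h.ξ_pos t ht1
    have hA := norm_direction_le (mul_pos hr hξ) (qt (t + 1)) (norm_eq_of_mem_sphere (u t)) hfx hgx
    rw [← ha t] at hA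
    have hα := alpha_mul_norm_sq_le hm (θ₁ := θ₁) (θ₂ := θ₂) (θ₃ := θ₃) h.k_pos hr hFg
      (by linarith) (by linarith) (norm_nonneg _) hA
    have hb : √m * ‖qt (t + 1)‖ * xi θ₃ i t ≤ m * F * ((t : ℝ) + 1) ^ (-(1 - θ₁)) := by
      have h1 : (t : ℝ) ^ θ₂ ≤ ((t : ℝ) + 1) ^ θ₂ :=
        Real.rpow_le_rpow t.cast_nonneg (by linarith) (by linarith)
      have h2 : ((t : ℝ) + 1) ^ (-(1 - θ₁)) = ((t : ℝ) + 1) ^ θ₂ * ((t : ℝ) + 1) ^ (-θ₃) := by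
        rw [← Real.rpow_add ht0]
        congr 1; linarith
      have h3 : ‖qt (t + 1)‖ ≤ √m * F * ((t : ℝ) + 1) ^ θ₂ := by
        refine (hqt t ht1).trans ?_
        have h4 : √m * F * (t : ℝ) ^ θ₂ ≤ √m * F * ((t : ℝ) + 1) ^ θ₂ :=
          mul_le_mul_of_nonneg_left h1 (by positivity)
        have h5 : 0 ≤ √m * F * (t : ℝ) ^ θ₂ := by positivity
        linarith
      rw [h2, xi_eq]
      calc √m * ‖qt (t + 1)‖ * ((t : ℝ) + 1) ^ (-θ₃)
          ≤ √m * (√m * F * ((t : ℝ) + 1) ^ θ₂) * ((t : ℝ) + 1) ^ (-θ₃) := by gcongr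
        _ = (√m * √m) * F * (((t : ℝ) + 1) ^ θ₂ * ((t : ℝ) + 1) ^ (-θ₃)) := by ring
        _ = _ := by rw [hsq]
    have hb' := mul_le_mul_of_nonneg_left hb (mul_nonneg hGg.le hL)
    rw [← xi_eq θ₃ i t]
    rw [show θ₁ - 1 = -(1 - θ₁) by ring] at hα
    linarith
  have hsum := sum_le_sum hpt
  rw [sum_add_distrib (f := fun t : ℕ => Gf i * (2 * r i + R i) * ((t : ℝ) + 1) ^ (-θ₃) +
      (m * F * Gg i * (2 * r i + R i) + Ff i ^ 2 / (4 * m * Fg i ^ 2)) *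
        ((t : ℝ) + 1) ^ (-(1 - θ₁))),
    sum_add_distrib (f := fun t : ℕ => Gf i * (2 * r i + R i) * ((t : ℝ) + 1) ^ (-θ₃)),
    ← mul_sum, ← mul_sum] at hsum
  have hs1 : ∑ t ∈ Icc 1 T, ((t : ℝ) + 1) ^ (-θ₃) ≤ (T : ℝ) ^ θ₁ / (1 - θ₃) := by
    refine (sum_rpow_neg_le (by linarith) (by linarith) hT).trans ?_
    have : (T : ℝ) ^ (1 - θ₃) ≤ (T : ℝ) ^ θ₁ :=
      Real.rpow_le_rpow_of_exponent_le hT' (by linarith)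
    have h13 : 0 < 1 - θ₃ := by linarith
    gcongr
  have hs2 : ∑ t ∈ Icc 1 T, ((t : ℝ) + 1) ^ (-(1 - θ₁)) ≤ (T : ℝ) ^ θ₁ / θ₁ := by
    have := sum_rpow_neg_le (s := 1 - θ₁) (by linarith) (by linarith) hT
    rwa [sub_sub_cancel] at this
  have hs1' := mul_le_mul_of_nonneg_left hs1 (mul_nonneg hGf.le hL)
  have hs2' := mul_le_mul_of_nonneg_left hs2
    (by positivity : 0 ≤ m * F * Gg i * (2 * r i + R i) + Ff i ^ 2 / (4 * m * Fg i ^ 2))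
  have hU : R i ^ 2 * (3 + 2 * (xi θ₃ i 2 - xi θ₃ i (T + 1))) / alpha m p r Fg θ₁ i (T + 1) ≤
      24 * m * (p i : ℝ) ^ 2 * Fg i ^ 2 * R i ^ 2 / r i ^ 2 * (T : ℝ) ^ θ₁ := by
    have hkey := succ_rpow_mul_le hT (θ₁ := θ₁) (θ₃ := θ₃) (by linarith) (by linarith) (by linarith)
    have hx2 : xi θ₃ i 2 = 1 / ((2 : ℝ) + 1) ^ θ₃ := by rw [xi]; norm_num
    have hxT : xi θ₃ i (T + 1) = 1 / ((T : ℝ) + 1 + 1) ^ θ₃ := by rw [xi]; push_cast; rfl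
    rw [hx2, hxT]
    set X := 3 + 2 * (1 / ((2 : ℝ) + 1) ^ θ₃ - 1 / ((T : ℝ) + 1 + 1) ^ θ₃)
    calc R i ^ 2 * X / alpha m p r Fg θ₁ i (T + 1)
        = 4 * m * (p i : ℝ) ^ 2 * Fg i ^ 2 * R i ^ 2 / r i ^ 2 * (((T : ℝ) + 1) ^ θ₁ * X) := by
          rw [alpha]; push_cast; field_simp
      _ ≤ 4 * m * (p i : ℝ) ^ 2 * Fg i ^ 2 * R i ^ 2 / r i ^ 2 * (6 * (T : ℝ) ^ θ₁) := by
          gcongr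
      _ = _ := by ring
  refine hmain.trans ?_
  have hfin : Gf i * (2 * r i + R i) * ((T : ℝ) ^ θ₁ / (1 - θ₃)) +
      (m * F * Gg i * (2 * r i + R i) + Ff i ^ 2 / (4 * m * Fg i ^ 2)) * ((T : ℝ) ^ θ₁ / θ₁) +
      24 * m * (p i : ℝ) ^ 2 * Fg i ^ 2 * R i ^ 2 / r i ^ 2 * (T : ℝ) ^ θ₁ =
      (m * F * Gg i * (2 * r i + R i) / θ₁
        + Gf i * (2 * r i + R i) / (1 - θ₃)
        + 8 * m * (p i : ℝ) ^ 2 * Fg i ^ 2 * R i ^ 2 / r i ^ 2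
        + Ff i ^ 2 / (4 * m * Fg i ^ 2 * θ₁)
        + 16 * m * (p i : ℝ) ^ 2 * Fg i ^ 2 * R i ^ 2 / r i ^ 2) * (T : ℝ) ^ θ₁ := by
    rw [← div_div (Ff i ^ 2) (4 * m * Fg i ^ 2) θ₁]
    ring
  linarith

lemma le_FgMax (Fg : Fin n → ℝ) (i : Fin n) : Fg i ≤ FgMax Fg :=
  le_ciSup (Set.finite_range Fg).bddAbove i

/-- The disagreement of the multipliers and the dual stepsizes cost at most `C₀`. -/
lemma consensus_const_le_C0 (hn : 0 < n) {w : ℝ} (hw : 0 < w) (hw1 : w < 1) {ι : ℕ} (hι : 0 < ι) :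
    8 * (n : ℝ) ^ 4 * ι / w * (m * FgMax Fg ^ 2) + 2 * n * (m * FgMax Fg ^ 2) ≤ C0 m Fg w ι := by
  have hn' : (0 : ℝ) < n := by exact_mod_cast hn
  have h := div_le_tauConst_div hn hw hw1 hι
  set c := tauConst n w / (1 - lambdaConst n w ι) with hc
  have h0 : 0 ≤ c := le_trans (by positivity) h
  have e1 : 8 * (n : ℝ) ^ 4 * ι / w * (m * FgMax Fg ^ 2) =
      4 * m * (n : ℝ) ^ 2 * FgMax Fg ^ 2 * (ι / (w / (2 * (n : ℝ) ^ 2))) := by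
    field_simp; ring
  have e2 : C0 m Fg w ι = 6 * m * (n : ℝ) ^ 2 * FgMax Fg ^ 2 * c + 2 * m * n * FgMax Fg ^ 2 := by
    rw [C0, hc, mul_div_assoc]
  rw [e1, e2]
  have h1 := mul_le_mul_of_nonneg_left h
    (by positivity : 0 ≤ 4 * m * (n : ℝ) ^ 2 * FgMax Fg ^ 2)
  have h2 : 0 ≤ m * (n : ℝ) ^ 2 * FgMax Fg ^ 2 * c := by positivity
  linarith

/-- The regret against any feasible static decision plus a linear functional of the accumulated
constraint values, along every trajectory. -/
lemma pathwise_le (hn : 0 < n) (hm : 0 < m) {G : ℕ → Digraph (Fin n)}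
    {W : ℕ → Matrix (Fin n) (Fin n) ℝ} {w : ℝ} {ι : ℕ} (hG : GraphAssumption G W w ι)
    {X : (i : Fin n) → Set (Vec (p i))} (hθ₁ : θ₁ ∈ Set.Ioc (3 / 4 : ℝ) (5 / 6))
    (hθ₂ : θ₂ = 2 * θ₁ - 3 / 2) (hθ₃ : θ₃ = θ₁ - 1 / 2)
    (hFf : ∀ i, 0 < Ff i) (hFg : ∀ i, 0 < Fg i) (hGf : ∀ i, 0 < Gf i) (hGg : ∀ i, 0 < Gg i)
    {f : (i : Fin n) → ℕ → Vec (p i) → ℝ} {g : (i : Fin n) → ℕ → Vec (p i) → Vec m}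
    {u : (i : Fin n) → ℕ → Metric.sphere (0 : Vec (p i)) 1} {z x : (i : Fin n) → ℕ → Vec (p i)}
    {q qt : Fin n → ℕ → Vec m}
    (hprimal : ∀ i, IsPrimalRun (X i) (r i) (R i) (Ff i) (Fg i) (Gf i) (Gg i)
      (alpha m p r Fg θ₁ i) (xi θ₃ i) (f i) (g i) (u i) (z i) (x i) (qt i))
    (hdual : IsDualRun W θ₂ (√m * FgMax Fg) q qt fun i t => g i t (x i t))
    {T : ℕ} (hT : 1 ≤ T) {y : (i : Fin n) → Vec (p i)} (hy : y ∈ staticFeasible X g T)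
    {ν : Vec m} (hν : ∀ j, 0 ≤ ν j) (a : (i : Fin n) → ℕ → Vec (p i))
    (ha : ∀ i t, a i t = direction (r i * xi θ₃ i t) (f i t) (g i t) (z i t) (u i t : Vec (p i))
      (qt i (t + 1))) :
    regret f T x (fun i _ => y i) + inner ℝ ν (∑ t ∈ Icc 1 T, ∑ i, g i t (x i t)) ≤
      C1 m p r R Ff Fg Gf Gg w ι θ₁ θ₂ θ₃ * (T : ℝ) ^ θ₁
      + ∑ i, IsPrimalRun.noiseTerm (alpha m p r Fg θ₁ i) (xi θ₃ i) (z i) (a i)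
        (IsPrimalRun.noise (r i) (xi θ₃ i) (f i) (g i) (u i) (z i) (qt i)) T
      + n * (1 / 6 + 5 / 6 * ∑ t ∈ Icc 1 T, ((t : ℝ) + 1) ^ (-θ₂)) * ‖ν‖ ^ 2 := by
  have hF0 : 0 < FgMax Fg := (hFg ⟨0, hn⟩).trans_le (le_FgMax Fg _)
  have hB0 : 0 ≤ √m * FgMax Fg := by positivity
  have hθ20 : 0 < θ₂ := by linarith [hθ₁.1]
  have hθ21 : θ₂ ≤ 1 := by linarith [hθ₁.2]
  have hT' : (1 : ℝ) ≤ T := by exact_mod_cast hT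
  have hW := hG.doubly
  have hP := sum_le_sum fun i (_ : i ∈ (univ : Finset (Fin n))) =>
    (hprimal i).sum_le_of_stepsizes hm hθ₁ hθ₂ hθ₃ (hFf i) (hFg i) (hGf i) (hGg i) hF0.le
      (fun t ht => hdual.norm_qt_le hθ20.le hB0 hW ht i) (hy.1 i) hT (a i) (ha i)
  have hD := hdual.sum_inner_sub_le hθ20 hθ21 hB0 hW hν hT
  have hcons := hdual.sum_norm_sub_mean_le hn hG hθ20 hθ21 hB0 hT
  -- the comparator is feasible for the common multiplier; the rest is disagreement
  have hfeas : ∑ t ∈ Icc 1 T, ∑ i, inner ℝ (qt i (t + 1)) (g i t (y i)) ≤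
      √m * FgMax Fg * (8 * (n : ℝ) ^ 4 * ι / w * (√m * FgMax Fg) * ((T : ℝ) ^ θ₂ / θ₂)) := by
    refine le_trans ?_ (mul_le_mul_of_nonneg_left hcons hB0)
    rw [mul_sum]
    refine sum_le_sum fun t ht => ?_
    have ht1 := (mem_Icc.1 ht).1
    set c := (n : ℝ)⁻¹ • ∑ k, qt k (t + 1) with hc
    have hcn : ∀ j, 0 ≤ c j := by
      intro j
      simp only [hc, WithLp.ofLp_smul, WithLp.ofLp_sum, Pi.smul_apply, Finset.sum_apply,
        smul_eq_mul]
      exact mul_nonneg (by positivity) (sum_nonneg fun k _ => hdual.qt_nonneg hW ht1 j)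
    have h1 : inner ℝ c (∑ i, g i t (y i)) ≤ 0 := by
      rw [PiLp.inner_apply]
      refine sum_nonpos fun j _ => ?_
      simp only [RCLike.inner_apply, conj_trivial]
      exact mul_nonpos_of_nonpos_of_nonneg (hy.2 t ht j) (hcn j)
    have h2 : ∑ i, inner ℝ (qt i (t + 1)) (g i t (y i)) =
        ∑ i, inner ℝ (qt i (t + 1) - c) (g i t (y i)) + inner ℝ c (∑ i, g i t (y i)) := by
      rw [inner_sum, ← sum_add_distrib]
      refine sum_congr rfl fun i _ => ?_
      rw [inner_sub_left]; ring
    have h3 : ∑ i, inner ℝ (qt i (t + 1) - c) (g i t (y i)) ≤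
        √m * FgMax Fg * ∑ i, ‖qt i (t + 1) - c‖ := by
      rw [mul_sum]
      refine sum_le_sum fun i _ => (real_inner_le_norm _ _).trans ?_
      rw [mul_comm]
      refine mul_le_mul_of_nonneg_right ?_ (norm_nonneg _)
      refine (norm_le_sqrt_mul (hFg i).le fun j =>
        ((hprimal i).constraint t ht1 j).bounded _ (hy.1 i)).trans ?_
      exact mul_le_mul_of_nonneg_left (le_FgMax Fg i) (Real.sqrt_nonneg _)
    rw [h2]
    linarith
  have hC0 := consensus_const_le_C0 (m := m) (Fg := Fg) hn hG.w_pos hG.w_lt_one hG.ι_pos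
  have hsq : (√m * FgMax Fg) ^ 2 = m * FgMax Fg ^ 2 := by
    rw [mul_pow, Real.sq_sqrt m.cast_nonneg]
  have hw := hG.w_pos
  have hC00 : 0 ≤ C0 m Fg w ι := le_trans (by positivity) hC0
  have hTpow : (T : ℝ) ^ θ₂ ≤ (T : ℝ) ^ θ₁ :=
    Real.rpow_le_rpow_of_exponent_le hT' (by linarith [hθ₁.2])
  have hC0T : √m * FgMax Fg * (8 * (n : ℝ) ^ 4 * ι / w * (√m * FgMax Fg) * ((T : ℝ) ^ θ₂ / θ₂))
      + 2 * n * (√m * FgMax Fg) ^ 2 * ((T : ℝ) ^ θ₂ / θ₂) ≤ C0 m Fg w ι / θ₂ * (T : ℝ) ^ θ₁ := by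
    calc _ = (8 * (n : ℝ) ^ 4 * ι / w * (√m * FgMax Fg) ^ 2 + 2 * n * (√m * FgMax Fg) ^ 2)
          * ((T : ℝ) ^ θ₂ / θ₂) := by ring
      _ ≤ C0 m Fg w ι * ((T : ℝ) ^ θ₁ / θ₂) := by
          rw [hsq]
          refine mul_le_mul hC0 ?_ (by positivity) hC00
          gcongr
      _ = _ := by ring
  simp only [sum_add_distrib, sum_sub_distrib, ← sum_mul] at hP
  simp only [sum_add_distrib, sum_sub_distrib] at hD
  have hcomm : ∀ φ : Fin n → ℕ → ℝ, ∑ i, ∑ t ∈ Icc 1 T, φ i t = ∑ t ∈ Icc 1 T, ∑ i, φ i t :=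
    fun φ => sum_comm
  have hν' : inner ℝ ν (∑ t ∈ Icc 1 T, ∑ i, g i t (x i t)) =
      ∑ t ∈ Icc 1 T, ∑ i, inner ℝ ν (g i t (x i t)) := by
    rw [inner_sum]
    exact sum_congr rfl fun t _ => inner_sum _ _ _
  rw [hcomm fun i t => f i t (x i t), hcomm fun i t => f i t (y i),
    hcomm fun i t => inner ℝ (qt i (t + 1)) (g i t (x i t)),
    hcomm fun i t => inner ℝ (qt i (t + 1)) (g i t (y i)),
    hcomm fun i t => 3 / 4 * ((t : ℝ) + 1) ^ (-θ₂) * ‖qt i (t + 1)‖ ^ 2] at hP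
  rw [hν', regret, C1]
  simp only [sum_add_distrib]
  linarith

end Pathwise

/-! ### Measurability and fresh randomness -/

section Measurability

open Finset

/-- Evaluation of a random function that is continuous on `K` at a random point of `K`. -/
lemma measurable_eval {k : ℕ} {Ω β : Type*} {mΩ : MeasurableSpace Ω} {mβ : MeasurableSpace β}
    {K : Set (Vec k)} {φ : Ω → Vec k → ℝ} (hc : ∀ ω, ContinuousOn (φ ω) K)
    (hm : ∀ x ∈ K, Measurable fun ω => φ ω x) {Z : β → Ω} (hZ : Measurable Z) {Y : β → Vec k}
    (hY : Measurable Y) (hYK : ∀ b, Y b ∈ K) : Measurable fun b => φ (Z b) (Y b) := by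
  have h1 : Measurable (Function.uncurry fun (x : K) (ω : Ω) => φ ω x) :=
    measurable_uncurry_of_continuous_of_measurable (fun ω => (hc ω).domRestrict) fun x => hm x x.2
  exact h1.comp ((hY.subtype_mk (h := hYK)).prodMk hZ)

lemma measurable_of_isProjection {k : ℕ} {Ω : Type*} {mΩ : MeasurableSpace Ω} {K : Set (Vec k)}
    (hK : Convex ℝ K) (hc : IsClosed K) {x y : Ω → Vec k} (hx : Measurable x)
    (h : ∀ ω, IsProjection K (x ω) (y ω)) : Measurable y := by
  rcases isEmpty_or_nonempty Ω with hΩ | ⟨⟨ω₀⟩⟩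
  · exact measurable_of_empty y
  choose P hP using exists_isProjection hK hc ⟨y ω₀, (h ω₀).1⟩
  have hPc : Continuous P := by
    refine (LipschitzWith.of_dist_le_mul (K := 1) fun a b => ?_).continuous
    rw [NNReal.coe_one, one_mul, dist_eq_norm, dist_eq_norm]
    exact (hP a).norm_sub_le_norm_sub hK (hP b)
  have he : y = fun ω => P (x ω) := by
    funext ω
    have := (h ω).norm_sub_le_norm_sub hK (hP (x ω))
    rw [sub_self, norm_zero] at this
    exact sub_eq_zero.1 (norm_le_zero_iff.1 this)
  rw [he]
  exact hPc.measurable.comp hx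

lemma measurable_of_apply {m : ℕ} {Ω : Type*} {mΩ : MeasurableSpace Ω} {b : Ω → Vec m}
    (hb : ∀ j, Measurable fun ω => b ω j) : Measurable b :=
  (WithLp.measurable_toLp 2 (Fin m → ℝ)).comp (measurable_pi_lambda _ hb)

/-- The sampled update direction depends measurably on the data at which it is taken. -/
lemma measurable_direction {k m : ℕ} {Ω β : Type*} {mΩ : MeasurableSpace Ω}
    {mβ : MeasurableSpace β} {K : Set (Vec k)} {φ : Ω → Vec k → ℝ} {ψ : Ω → Vec k → Vec m}
    (hφc : ∀ ω, ContinuousOn (φ ω) K) (hφm : ∀ x ∈ K, Measurable fun ω => φ ω x)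
    (hψc : ∀ ω j, ContinuousOn (fun x => ψ ω x j) K)
    (hψm : ∀ x ∈ K, ∀ j, Measurable fun ω => ψ ω x j) {Z : β → Ω} (hZ : Measurable Z)
    {y v : β → Vec k} (hy : Measurable y) (hv : Measurable v) {Q : β → Vec m} (hQ : Measurable Q)
    {δ : ℝ} (hK : ∀ b, y b + δ • v b ∈ K) :
    Measurable fun b => direction δ (φ (Z b)) (ψ (Z b)) (y b) (v b) (Q b) := by
  have hyv : Measurable fun b => y b + δ • v b := hy.add (hv.const_smul δ)
  have hφ := measurable_eval hφc hφm hZ hyv hK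
  have hψ : Measurable fun b => ψ (Z b) (y b + δ • v b) := measurable_of_apply fun j =>
    measurable_eval (fun ω => hψc ω j) (fun x hx => hψm x hx j) hZ hyv hK
  simp_rw [direction_eq]
  exact ((hφ.add (hQ.inner hψ)).const_mul _).smul hv

/-- Integrating out a variable `U` that is independent of `V`. -/
lemma integral_comp_eq_of_indepFun {Ω A S : Type*} {mΩ : MeasurableSpace Ω} {mA : MeasurableSpace A}
    {mS : MeasurableSpace S} {μ : Measure Ω} [IsProbabilityMeasure μ] {V : Ω → A} {U : Ω → S}
    (hV : Measurable V) (hU : Measurable U) (hind : IndepFun V U μ) {H : A × S → ℝ}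
    (hH : Measurable H) {C : ℝ} (hC : ∀ y, |H y| ≤ C) :
    ∫ ω, H (V ω, U ω) ∂μ = ∫ ω, ∫ v, H (V ω, v) ∂(μ.map U) ∂μ := by
  have hlaw := (indepFun_iff_map_prod_eq_prod_map_map hV.aemeasurable hU.aemeasurable).1 hind
  have := Measure.isProbabilityMeasure_map (μ := μ) hV.aemeasurable
  have := Measure.isProbabilityMeasure_map (μ := μ) hU.aemeasurable
  have hint : Integrable H ((μ.map V).prod (μ.map U)) :=
    Integrable.of_bound hH.aestronglyMeasurable C (ae_of_all _ hC)
  rw [← integral_map (φ := fun ω => (V ω, U ω)) (hV.prodMk hU).aemeasurable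
    hH.aestronglyMeasurable, hlaw, integral_prod H hint,
    integral_map hV.aemeasurable]
  exact (hH.stronglyMeasurable.integral_prod_right').aestronglyMeasurable

variable {Ω : Type*} {mΩ : MeasurableSpace Ω} {μ : Measure Ω} {k : ℕ}

lemma integrable_of_norm_le {E : Type*} [NormedAddCommGroup E] [MeasurableSpace E] [BorelSpace E]
    [SecondCountableTopology E] [IsFiniteMeasure μ] {φ : Ω → E} (h : Measurable φ) {C : ℝ}
    (hC : ∀ ω, ‖φ ω‖ ≤ C) : Integrable φ μ :=
  Integrable.of_bound h.aestronglyMeasurable C (ae_of_all _ hC)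

/-- A bounded function `h` of past and fresh randomness, minus its mean over the fresh randomness,
is orthogonal to everything that depends only on the past `𝓕`. -/
lemma integral_inner_sub_eq_zero {Ω S : Type*} {𝓕 : MeasurableSpace Ω} {mΩ : MeasurableSpace Ω}
    {mS : MeasurableSpace S} {μ : Measure Ω} [IsProbabilityMeasure μ] (h𝓕 : 𝓕 ≤ mΩ) {U : Ω → S}
    (hU : Measurable U) (hind : Indep 𝓕 (mS.comap U) μ) {h : Ω → S → Vec k}
    (hh : Measurable[𝓕.prod mS] fun y : Ω × S => h y.1 y.2) {C : ℝ} (hC : ∀ ω v, ‖h ω v‖ ≤ C)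
    {Z : Ω → Vec k} (hZ : Measurable[𝓕] Z) {D : ℝ} (hD : ∀ ω, ‖Z ω‖ ≤ D) :
    ∫ ω, inner ℝ (h ω (U ω) - ∫ v, h ω v ∂(μ.map U)) (Z ω) ∂μ = 0 := by
  have hprob := Measure.isProbabilityMeasure_map (μ := μ) hU.aemeasurable
  have hindep : @IndepFun Ω Ω S mΩ 𝓕 mS id U μ := by
    refine (IndepFun_iff_Indep (mβ := 𝓕) (mγ := mS) id U μ).2 ?_
    rwa [MeasurableSpace.comap_id]
  have hid : @Measurable Ω Ω mΩ 𝓕 id := measurable_id'' h𝓕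
  have hH : Measurable[𝓕.prod mS] fun y : Ω × S => inner ℝ (h y.1 y.2) (Z y.1) :=
    hh.inner (hZ.comp (@measurable_fst Ω S 𝓕 mS))
  have hCD : ∀ ω v, |inner ℝ (h ω v) (Z ω)| ≤ C * D := fun ω v =>
    (abs_real_inner_le_norm _ _).trans (mul_le_mul (hC ω v) (hD ω) (norm_nonneg _)
      ((norm_nonneg _).trans (hC ω v)))
  have key := @integral_comp_eq_of_indepFun Ω Ω S mΩ 𝓕 mS μ _ id U hid hU hindep
    (fun y => inner ℝ (h y.1 y.2) (Z y.1)) hH (C * D) fun y => hCD y.1 y.2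
  simp only [id] at key
  have hsec : ∀ ω, Measurable (h ω) := fun ω =>
    hh.comp (@measurable_prodMk_left Ω S 𝓕 mS ω)
  have hinner : ∀ ω, ∫ v, inner ℝ (h ω v) (Z ω) ∂(μ.map U) =
      inner ℝ (∫ v, h ω v ∂(μ.map U)) (Z ω) := by
    intro ω
    have hi : Integrable (h ω) (μ.map U) := integrable_of_norm_le (hsec ω) (hC ω)
    rw [real_inner_comm, ← integral_inner hi]
    exact integral_congr_ae (ae_of_all _ fun v => real_inner_comm _ _)
  simp_rw [hinner] at key
  have hM : Measurable[𝓕] fun ω => ∫ v, h ω v ∂(μ.map U) :=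
    (@StronglyMeasurable.integral_prod_right' Ω S _ 𝓕 mS (μ.map U) _ _ _
      (fun y => h y.1 y.2) hh.stronglyMeasurable).measurable
  have hMC : ∀ ω, ‖∫ v, h ω v ∂(μ.map U)‖ ≤ C := fun ω => by
    simpa using norm_integral_le_of_norm_le_const (μ := μ.map U) (ae_of_all _ (hC ω))
  have hZ' := hZ.mono h𝓕 le_rfl
  have hM' := hM.mono h𝓕 le_rfl
  have hhU : Measurable fun ω => h ω (U ω) :=
    hh.comp (hid.prodMk hU)
  simp_rw [inner_sub_left]
  rw [integral_sub, key, sub_self]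
  · exact integrable_of_norm_le (hhU.inner hZ') fun ω => hCD ω (U ω)
  · refine integrable_of_norm_le (hM'.inner hZ') (C := C * D) fun ω => ?_
    exact (abs_real_inner_le_norm _ _).trans (mul_le_mul (hMC ω) (hD ω) (norm_nonneg _)
      ((norm_nonneg _).trans (hMC ω)))

/-- The sampling part of the regret of one learner has nonpositive mean: the noise is a
martingale difference sequence, so the squared norm of its weighted sum is at most the sum of the
second moments of the sampled directions. -/
lemma integral_noiseTerm_nonpos [IsProbabilityMeasure μ] {𝓕 : ℕ → MeasurableSpace Ω}
    (h𝓕 : ∀ t, 𝓕 t ≤ mΩ) (hmono : Monotone 𝓕) {α ξ : ℕ → ℝ} (hα : ∀ t, 1 ≤ t → 0 < α t)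
    (hanti : ∀ t, 1 ≤ t → α (t + 1) ≤ α t) (hξ0 : ∀ t, 1 ≤ t → 0 < ξ t)
    (hξ1 : ∀ t, 1 ≤ t → ξ t ≤ 1) {z a M : ℕ → Ω → Vec k}
    (hz : ∀ t, 1 ≤ t → Measurable[𝓕 t] (z t)) (hM : ∀ t, 1 ≤ t → Measurable[𝓕 t] (M t))
    (ha : ∀ t, 1 ≤ t → Measurable[𝓕 (t + 1)] (a t)) {Cz : ℝ} (hCz : ∀ t, 1 ≤ t → ∀ ω, ‖z t ω‖ ≤ Cz)
    {C : ℕ → ℝ} (hCM : ∀ t, 1 ≤ t → ∀ ω, ‖M t ω‖ ≤ C t) (hCa : ∀ t, 1 ≤ t → ∀ ω, ‖a t ω‖ ≤ C t)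
    (horth : ∀ t, 1 ≤ t → ∀ (Z : Ω → Vec k) (D : ℝ), Measurable[𝓕 t] Z → (∀ ω, ‖Z ω‖ ≤ D) →
      ∫ ω, inner ℝ (a t ω - M t ω) (Z ω) ∂μ = 0) {T : ℕ} (hT : 1 ≤ T) :
    Integrable (fun ω => IsPrimalRun.noiseTerm α ξ (fun t => z t ω) (fun t => a t ω)
      (fun t => a t ω - M t ω) T) μ ∧
    ∫ ω, IsPrimalRun.noiseTerm α ξ (fun t => z t ω) (fun t => a t ω)
      (fun t => a t ω - M t ω) T ∂μ ≤ 0 := by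
  set e : ℕ → Ω → Vec k := fun t ω => a t ω - M t ω with he
  set c : ℕ → ℝ := fun t => 1 - ξ (t + 1) with hc
  have hc0 : ∀ t, 0 ≤ c t := fun t => by
    have := hξ1 (t + 1) (by omega); simp only [hc]; linarith
  have hc1 : ∀ t, c t ≤ 1 := fun t => by
    have := hξ0 (t + 1) (by omega); simp only [hc]; linarith
  have heM : ∀ t, 1 ≤ t → Measurable[𝓕 (t + 1)] (e t) := fun t ht => by
    exact (ha t ht).sub ((hM t ht).mono (hmono (Nat.le_succ t)) le_rfl)
  have heb : ∀ t, 1 ≤ t → ∀ ω, ‖e t ω‖ ≤ 2 * C t := fun t ht ω => by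
    have := norm_sub_le (a t ω) (M t ω)
    have := hCM t ht ω
    have := hCa t ht ω
    linarith
  set S : ℕ → Ω → Vec k := fun T ω => ∑ t ∈ Icc 1 T, c t • e t ω with hS
  have hSm : ∀ T, Measurable[𝓕 (T + 1)] (S T) := by
    intro T
    refine Finset.measurable_sum _ fun t ht => ?_
    have ht' := mem_Icc.1 ht
    have hle : 𝓕 (t + 1) ≤ 𝓕 (T + 1) := hmono (by omega)
    exact ((heM t ht'.1).mono hle le_rfl).const_smul (c t)
  have hSb : ∀ T, ∀ ω, ‖S T ω‖ ≤ ∑ t ∈ Icc 1 T, 2 * C t := by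
    intro T ω
    refine (norm_sum_le _ _).trans (sum_le_sum fun t ht => ?_)
    rw [norm_smul, Real.norm_of_nonneg (hc0 t)]
    exact (mul_le_of_le_one_left (norm_nonneg _) (hc1 t)).trans (heb t (mem_Icc.1 ht).1 ω)
  -- bounded measurable vectors have integrable inner products
  have hint : ∀ (A B : Ω → Vec k) (CA CB : ℝ), Measurable A → Measurable B → (∀ ω, ‖A ω‖ ≤ CA) →
      (∀ ω, ‖B ω‖ ≤ CB) → Integrable (fun ω => inner ℝ (A ω) (B ω)) μ := by
    intro A B CA CB hA hB hCA hCB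
    refine integrable_of_norm_le (hA.inner hB) (C := CA * CB) fun ω => ?_
    exact (abs_real_inner_le_norm _ _).trans (mul_le_mul (hCA ω) (hCB ω) (norm_nonneg _)
      ((norm_nonneg _).trans (hCA ω)))
  have hsq : ∀ (A : Ω → Vec k) (CA : ℝ), Measurable A → (∀ ω, ‖A ω‖ ≤ CA) →
      Integrable (fun ω => ‖A ω‖ ^ 2) μ := by
    intro A CA hA hCA
    have := hint A A CA CA hA hA hCA hCA
    simpa only [real_inner_self_eq_norm_sq] using this
  have ha' : ∀ t, 1 ≤ t → Measurable (a t) := fun t ht => (ha t ht).mono (h𝓕 _) le_rfl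
  have he' : ∀ t, 1 ≤ t → Measurable (e t) := fun t ht => (heM t ht).mono (h𝓕 _) le_rfl
  have hM' : ∀ t, 1 ≤ t → Measurable (M t) := fun t ht => (hM t ht).mono (h𝓕 _) le_rfl
  have hz' : ∀ t, 1 ≤ t → Measurable (z t) := fun t ht => (hz t ht).mono (h𝓕 _) le_rfl
  have hS' : ∀ T, Measurable (S T) := fun T => (hSm T).mono (h𝓕 _) le_rfl
  have hvar : ∀ t, 1 ≤ t → ∫ ω, ‖e t ω‖ ^ 2 ∂μ ≤ ∫ ω, ‖a t ω‖ ^ 2 ∂μ := by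
    intro t ht
    have hpt : ∀ ω, ‖a t ω‖ ^ 2 = ‖e t ω‖ ^ 2 + 2 * inner ℝ (e t ω) (M t ω) + ‖M t ω‖ ^ 2 := by
      intro ω
      have : a t ω = e t ω + M t ω := by simp [he]
      rw [this, norm_add_sq_real]
    simp_rw [hpt]
    have i1 := hsq _ _ (he' t ht) (heb t ht)
    have i2 := (hint _ _ _ _ (he' t ht) (hM' t ht) (heb t ht) (hCM t ht)).const_mul 2
    have i3 := hsq _ _ (hM' t ht) (hCM t ht)
    rw [integral_add (f := fun ω => _ + _) (i1.add i2) i3, integral_add i1 i2, integral_const_mul,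
      horth t ht (M t) (C t) (hM t ht) (hCM t ht)]
    have : 0 ≤ ∫ ω, ‖M t ω‖ ^ 2 ∂μ := integral_nonneg fun ω => sq_nonneg _
    linarith
  have hSsq : ∀ T, ∫ ω, ‖S T ω‖ ^ 2 ∂μ ≤ ∑ t ∈ Icc 1 T, ∫ ω, ‖a t ω‖ ^ 2 ∂μ := by
    intro T
    induction T with
    | zero => simp [hS]
    | succ T ih =>
      have hpt : ∀ ω, ‖S (T + 1) ω‖ ^ 2 = ‖S T ω‖ ^ 2 +
          2 * c (T + 1) * inner ℝ (e (T + 1) ω) (S T ω) + c (T + 1) ^ 2 * ‖e (T + 1) ω‖ ^ 2 := by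
        intro ω
        have : S (T + 1) ω = S T ω + c (T + 1) • e (T + 1) ω := sum_Icc_succ_top (by omega) _
        rw [this, norm_add_sq_real, real_inner_smul_right, norm_smul, mul_pow,
          Real.norm_of_nonneg (hc0 _), real_inner_comm]
        ring
      simp_rw [hpt]
      have i1 := hsq _ _ (hS' T) (hSb T)
      have i2 := (hint _ _ _ _ (he' (T + 1) (by omega)) (hS' T) (heb (T + 1) (by omega))
        (hSb T)).const_mul (2 * c (T + 1))
      have i3 := (hsq _ _ (he' (T + 1) (by omega)) (heb (T + 1) (by omega))).const_mul
        (c (T + 1) ^ 2)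
      rw [integral_add (f := fun ω => _ + _) (i1.add i2) i3, integral_add i1 i2,
        integral_const_mul, integral_const_mul,
        horth (T + 1) (by omega) (S T) _ (hSm T) (hSb T), sum_Icc_succ_top (by omega)]
      have h1 := hvar (T + 1) (by omega)
      have h2 : c (T + 1) ^ 2 ≤ 1 := pow_le_one₀ (hc0 _) (hc1 _)
      have h3 : 0 ≤ ∫ ω, ‖e (T + 1) ω‖ ^ 2 ∂μ := integral_nonneg fun ω => sq_nonneg _
      nlinarith
  have hαT : ∀ t, 1 ≤ t → t ≤ T → α (T + 1) ≤ α (t + 1) := by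
    intro t ht htT
    clear hSsq hvar
    induction T, htT using Nat.le_induction with
    | base => exact le_rfl
    | succ s hs ih => exact (hanti (s + 1) (by omega)).trans (ih (by omega))
  have j1 : Integrable (fun ω => α (T + 1) / 4 * ‖S T ω‖ ^ 2) μ :=
    (hsq _ _ (hS' T) (hSb T)).const_mul _
  have j2 : ∀ t ∈ Icc 1 T, Integrable (fun ω => inner ℝ (e t ω) (z t ω)) μ := fun t ht =>
    have ht1 := (mem_Icc.1 ht).1
    hint _ _ _ _ (he' t ht1) (hz' t ht1) (heb t ht1) (hCz t ht1)
  have j3 : ∀ t ∈ Icc 1 T, Integrable (fun ω => α (t + 1) / 4 * ‖a t ω‖ ^ 2) μ := fun t ht =>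
    have ht1 := (mem_Icc.1 ht).1
    (hsq _ _ (ha' t ht1) (hCa t ht1)).const_mul _
  have j4 : Integrable (fun ω => ∑ t ∈ Icc 1 T, (inner ℝ (e t ω) (z t ω)
      + α (t + 1) / 4 * ‖a t ω‖ ^ 2)) μ :=
    integrable_finsetSum _ fun t ht => (j2 t ht).add (j3 t ht)
  refine ⟨j1.sub j4, ?_⟩
  have hI : ∫ ω, IsPrimalRun.noiseTerm α ξ (fun t => z t ω) (fun t => a t ω)
      (fun t => e t ω) T ∂μ = α (T + 1) / 4 * ∫ ω, ‖S T ω‖ ^ 2 ∂μ -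
        ∑ t ∈ Icc 1 T, α (t + 1) / 4 * ∫ ω, ‖a t ω‖ ^ 2 ∂μ := by
    have : ∀ ω, IsPrimalRun.noiseTerm α ξ (fun t => z t ω) (fun t => a t ω) (fun t => e t ω) T =
        α (T + 1) / 4 * ‖S T ω‖ ^ 2 - ∑ t ∈ Icc 1 T, (inner ℝ (e t ω) (z t ω)
          + α (t + 1) / 4 * ‖a t ω‖ ^ 2) := fun ω => rfl
    simp_rw [this]
    rw [integral_sub j1 j4, integral_const_mul,
      integral_finsetSum (f := fun t ω => _ + _) _ fun t ht => (j2 t ht).add (j3 t ht)]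
    congr 1
    refine sum_congr rfl fun t ht => ?_
    have ht1 := (mem_Icc.1 ht).1
    rw [integral_add (j2 t ht) (j3 t ht), integral_const_mul,
      horth t ht1 (z t) Cz (hz t ht1) (hCz t ht1), zero_add]
  rw [hI]
  have h1 := mul_le_mul_of_nonneg_left (hSsq T)
    (by have := hα (T + 1) (by omega); positivity : 0 ≤ α (T + 1) / 4)
  rw [mul_sum] at h1
  have h2 : ∑ t ∈ Icc 1 T, α (T + 1) / 4 * ∫ ω, ‖a t ω‖ ^ 2 ∂μ ≤
      ∑ t ∈ Icc 1 T, α (t + 1) / 4 * ∫ ω, ‖a t ω‖ ^ 2 ∂μ := by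
    refine sum_le_sum fun t ht => ?_
    have ht' := mem_Icc.1 ht
    refine mul_le_mul_of_nonneg_right ?_ (integral_nonneg fun ω => sq_nonneg _)
    have := hαT t ht'.1 ht'.2
    linarith
  linarith

/-- Solvability over a compact set of finitely many inequalities that are continuous in the unknown
and measurable in the parameter is a measurable event. -/
lemma measurableSet_exists_forall_le {Y κ : Type*} [TopologicalSpace Y] [CompactSpace Y]
    [TopologicalSpace.SeparableSpace Y] [Finite κ] {Φ : κ → Ω → Y → ℝ}
    (hc : ∀ l ω, Continuous (Φ l ω)) (hm : ∀ l y, Measurable fun ω => Φ l ω y) :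
    MeasurableSet {ω | ∃ y, ∀ l, Φ l ω y ≤ 0} := by
  obtain ⟨D, hD, hdense⟩ := TopologicalSpace.exists_countable_dense Y
  have heq : {ω | ∃ y, ∀ l, Φ l ω y ≤ 0} =
      ⋂ N : ℕ, ⋃ y ∈ D, ⋂ l, {ω | Φ l ω y < 1 / ((N : ℝ) + 1)} := by
    ext ω
    simp only [Set.mem_ofPred_eq, Set.mem_iInter, Set.mem_iUnion, exists_prop]
    constructor
    · rintro ⟨y, hy⟩ N
      have hopen : IsOpen {y | ∀ l, Φ l ω y < 1 / ((N : ℝ) + 1)} := by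
        simp only [Set.ofPred_forall]
        exact isOpen_iInter_of_finite fun l => isOpen_lt (hc l ω) continuous_const
      obtain ⟨y', hy', hyD⟩ := hdense.inter_open_nonempty _ hopen
        ⟨y, fun l => (hy l).trans_lt (by positivity)⟩
      exact ⟨y', hyD, hy'⟩
    · intro h
      -- nested nonempty compact sets
      have hne := IsCompact.nonempty_iInter_of_sequence_nonempty_isCompact_isClosed
        (fun N : ℕ => {y | ∀ l, Φ l ω y ≤ 1 / ((N : ℝ) + 1)})
        (fun N y hy l => (hy l).trans (one_div_le_one_div_of_le (by positivity)
          (by push_cast; linarith)))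
        (fun N => by
          obtain ⟨y, -, hy⟩ := h N
          exact ⟨y, fun l => (hy l).le⟩)
        (by
          refine IsClosed.isCompact ?_
          simp only [Set.ofPred_forall]
          exact isClosed_iInter fun l => isClosed_le (hc l ω) continuous_const)
        (fun N => by
          simp only [Set.ofPred_forall]
          exact isClosed_iInter fun l => isClosed_le (hc l ω) continuous_const)
      obtain ⟨y, hy⟩ := hne
      refine ⟨y, fun l => ?_⟩
      refine ge_of_tendsto tendsto_one_div_add_atTop_nhds_zero_nat
        (Filter.Eventually.of_forall fun N => ?_)
      exact (Set.mem_iInter.1 hy N) l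
  rw [heq]
  refine MeasurableSet.iInter fun N => MeasurableSet.biUnion hD fun y _ =>
    MeasurableSet.iInter fun l => measurableSet_lt (hm l y) measurable_const

end Measurability

/-! ### The run of the algorithm as a random process -/

section RandomRun

open Finset

/-- The standing assumptions: the sampling, the graphs, the decision sets, the adversary, the
exponents and the run of the algorithm. -/
structure StandingAssumption {n m : ℕ} {p : Fin n → ℕ} {Ω : Type*} [MeasurableSpace Ω]
    (μ : Measure Ω) (u : (i : Fin n) → ℕ → Ω → Metric.sphere (0 : Vec (p i)) 1)
    (G : ℕ → Digraph (Fin n)) (W : ℕ → Matrix (Fin n) (Fin n) ℝ) (w : ℝ) (ι : ℕ)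
    (X : (i : Fin n) → Set (Vec (p i))) (r R : Fin n → ℝ)
    (f : (i : Fin n) → ℕ → Ω → Vec (p i) → ℝ) (g : (i : Fin n) → ℕ → Ω → Vec (p i) → Vec m)
    (Ff Fg Gf Gg : Fin n → ℝ) (θ₁ θ₂ θ₃ : ℝ) (z x : (i : Fin n) → ℕ → Ω → Vec (p i))
    (q qt : Fin n → ℕ → Ω → Vec m) : Prop where
  n_pos : 0 < n
  m_pos : 0 < m
  p_pos : ∀ i, 0 < p i
  sampling : IsUniformSampling μ u
  graph : GraphAssumption G W w ι
  sets : SetAssumption X r R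
  adversary : AdversaryAssumption X u f g Ff Fg Gf Gg
  θ₁_mem : θ₁ ∈ Set.Ioc (3 / 4 : ℝ) (5 / 6)
  θ₂_eq : θ₂ = 2 * θ₁ - 3 / 2
  θ₃_eq : θ₃ = θ₁ - 1 / 2
  run : IsOnePointRun W X u f g (alpha m p r Fg θ₁) (beta θ₂) (gamma θ₂) (xi θ₃) (delta r θ₃)
    z x q qt

lemma past_mono {n : ℕ} {p : Fin n → ℕ} {Ω : Type*}
    (u : (i : Fin n) → ℕ → Ω → Metric.sphere (0 : Vec (p i)) 1) : Monotone (past u) :=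
  fun _ _ hst => iSup_mono fun _ => iSup_mono fun _ => iSup_mono' fun h =>
    ⟨⟨h.1, h.2.trans_le hst⟩, le_rfl⟩

lemma measurable_past_u {n : ℕ} {p : Fin n → ℕ} {Ω : Type*}
    (u : (i : Fin n) → ℕ → Ω → Metric.sphere (0 : Vec (p i)) 1) (i : Fin n) {t : ℕ} (ht : 1 ≤ t) :
    Measurable[past u (t + 1)] (u i t) :=
  Measurable.of_comap_le (le_iSup_of_le i (le_iSup_of_le t (le_iSup_of_le ⟨ht, Nat.lt_succ_self t⟩
    le_rfl)))

lemma xi_pos {n : ℕ} (θ₃ : ℝ) (i : Fin n) (t : ℕ) : 0 < xi θ₃ i t := by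
  rw [xi_eq]; positivity

lemma xi_le_one {n : ℕ} {θ₃ : ℝ} (h : 0 ≤ θ₃) (i : Fin n) (t : ℕ) : xi θ₃ i t ≤ 1 := by
  rw [xi_eq]
  exact Real.rpow_le_one_of_one_le_of_nonpos (by linarith [t.cast_nonneg (α := ℝ)]) (by linarith)

lemma xi_succ_lt_one {n : ℕ} {θ₃ : ℝ} (h : 0 < θ₃) (i : Fin n) (t : ℕ) :
    xi θ₃ i (t + 1) < 1 := by
  rw [xi_eq]
  refine Real.rpow_lt_one_of_one_lt_of_neg ?_ (by linarith)
  push_cast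
  linarith [t.cast_nonneg (α := ℝ)]

lemma xi_anti {n : ℕ} {θ₃ : ℝ} (h : 0 ≤ θ₃) (i : Fin n) (t : ℕ) : xi θ₃ i (t + 1) ≤ xi θ₃ i t := by
  rw [xi_eq, xi_eq]
  exact Real.rpow_le_rpow_of_nonpos (by positivity) (by push_cast; linarith) (by linarith)

lemma alpha_anti {n m : ℕ} (hm : 0 < m) {p : Fin n → ℕ} {r Fg : Fin n → ℝ} {θ₁ : ℝ} {i : Fin n}
    (hθ : 0 ≤ θ₁) (hp : 0 < p i) (hF : 0 < Fg i) {t : ℕ} (ht : 1 ≤ t) :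
    alpha m p r Fg θ₁ i (t + 1) ≤ alpha m p r Fg θ₁ i t := by
  have : (0 : ℝ) < t := by exact_mod_cast ht
  have : (0 : ℝ) < p i := by exact_mod_cast hp
  have : (0 : ℝ) < m := by exact_mod_cast hm
  unfold alpha
  gcongr
  exact Nat.le_succ t

namespace StandingAssumption

variable {n m : ℕ} {p : Fin n → ℕ} {Ω : Type*} [mΩ : MeasurableSpace Ω] {μ : Measure Ω}
  {u : (i : Fin n) → ℕ → Ω → Metric.sphere (0 : Vec (p i)) 1}
  {G : ℕ → Digraph (Fin n)} {W : ℕ → Matrix (Fin n) (Fin n) ℝ} {w : ℝ} {ι : ℕ}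
  {X : (i : Fin n) → Set (Vec (p i))} {r R : Fin n → ℝ}
  {f : (i : Fin n) → ℕ → Ω → Vec (p i) → ℝ} {g : (i : Fin n) → ℕ → Ω → Vec (p i) → Vec m}
  {Ff Fg Gf Gg : Fin n → ℝ} {θ₁ θ₂ θ₃ : ℝ} {z x : (i : Fin n) → ℕ → Ω → Vec (p i)}
  {q qt : Fin n → ℕ → Ω → Vec m}

section

variable (h : StandingAssumption μ u G W w ι X r R f g Ff Fg Gf Gg θ₁ θ₂ θ₃ z x q qt)

include h

lemma θ₃_pos : 0 < θ₃ := by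
  have := h.θ₁_mem.1; have := h.θ₃_eq; linarith

lemma θ₂_nonneg : 0 ≤ θ₂ := by
  have := h.θ₁_mem.1; have := h.θ₂_eq; linarith

lemma FgMax_pos : 0 < FgMax Fg :=
  (h.adversary.Fg_pos ⟨0, h.n_pos⟩).trans_le (le_FgMax Fg _)

lemma z_mem (i : Fin n) {t : ℕ} (ht : 1 ≤ t) (ω : Ω) : z i t ω ∈ (1 - xi θ₃ i t) • X i := by
  rcases ht.eq_or_lt with rfl | ht'
  · obtain ⟨c, hc, hz⟩ := h.run.z_init i
    rw [hz]
    exact hc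
  · obtain ⟨s, rfl⟩ := Nat.exists_eq_add_of_le' ht
    exact (h.run.z_step i s ω (by omega)).1

lemma add_mem (i : Fin n) {t : ℕ} (ht : 1 ≤ t) (ω : Ω) (v : Metric.sphere (0 : Vec (p i)) 1) :
    z i t ω + (r i * xi θ₃ i t) • (v : Vec (p i)) ∈ X i :=
  add_smul_mem_of_mem_smul (h.sets.convex i) (h.sets.r_pos i).le (h.sets.inner_ball i)
    (xi_pos θ₃ i t).le (xi_le_one h.θ₃_pos.le i t) (h.z_mem i ht ω)
    (Metric.sphere_subset_closedBall v.2)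

lemma x_eq (i : Fin n) {t : ℕ} (ht : 1 ≤ t) (ω : Ω) :
    x i t ω = z i t ω + (r i * xi θ₃ i t) • (u i t ω : Vec (p i)) := by
  rw [h.run.x_eq i t ω ht, delta_eq]

lemma x_mem (i : Fin n) {t : ℕ} (ht : 1 ≤ t) (ω : Ω) : x i t ω ∈ X i := by
  rw [h.x_eq i ht]
  exact h.add_mem i ht ω _

lemma norm_constraint_le (i : Fin n) {t : ℕ} (ht : 1 ≤ t) (ω : Ω) {y : Vec (p i)} (hy : y ∈ X i) :
    ‖g i t ω y‖ ≤ √m * FgMax Fg := by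
  refine (norm_le_sqrt_mul (h.adversary.Fg_pos i).le fun j =>
    (h.adversary.constraint i t ω ht j).bounded _ hy).trans ?_
  gcongr
  exact le_FgMax Fg i

lemma isDualRun (ω : Ω) : IsDualRun W θ₂ (√m * FgMax Fg) (fun i t => q i t ω)
    (fun i t => qt i t ω) fun i t => g i t ω (x i t ω) where
  init i := h.run.q_init i ω
  avg i t ht := h.run.qt_step i t ω ht
  step i t ht := h.run.q_step i t ω ht
  bound i _ ht := h.norm_constraint_le i ht ω (h.x_mem i ht ω)

lemma norm_qt_le (i : Fin n) {t : ℕ} (ht : 1 ≤ t) (ω : Ω) :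
    ‖qt i (t + 1) ω‖ ≤ √m * FgMax Fg * (t : ℝ) ^ θ₂ / 2 :=
  (h.isDualRun ω).norm_qt_le h.θ₂_nonneg (by have := h.FgMax_pos; positivity) h.graph.doubly ht i

lemma isPrimalRun (i : Fin n) (ω : Ω) : IsPrimalRun (X i) (r i) (R i) (Ff i) (Fg i) (Gf i) (Gg i)
    (alpha m p r Fg θ₁ i) (xi θ₃ i) (fun t => f i t ω) (fun t => g i t ω) (fun t => u i t ω)
    (fun t => z i t ω) (fun t => x i t ω) (fun t => qt i t ω) where
  k_pos := h.p_pos i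
  r_pos := h.sets.r_pos i
  convex := h.sets.convex i
  inner_ball := h.sets.inner_ball i
  outer_ball := h.sets.outer_ball i
  loss t ht := h.adversary.loss i t ω ht
  constraint t ht j := h.adversary.constraint i t ω ht j
  α_pos _ ht := alpha_pos h.m_pos (h.p_pos i) (h.sets.r_pos i) (h.adversary.Fg_pos i) ht
  α_anti _ ht := alpha_anti h.m_pos (by linarith [h.θ₁_mem.1]) (h.p_pos i) (h.adversary.Fg_pos i) ht
  ξ_pos t _ := xi_pos θ₃ i t
  ξ_le t _ := xi_le_one h.θ₃_pos.le i t
  ξ_anti t _ := xi_anti h.θ₃_pos.le i t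
  z_init := h.z_mem i le_rfl ω
  x_eq _ ht := h.x_eq i ht ω
  z_step t ht := by
    rw [← delta_eq]
    exact h.run.z_step i t ω ht
  qt_nonneg _ ht j := (h.isDualRun ω).qt_nonneg h.graph.doubly ht j

lemma past_le (t : ℕ) : past u t ≤ mΩ :=
  iSup_le fun j => iSup_le fun s => iSup_le fun hs => (h.sampling.measurable j s hs.1).comap_le

/-- The directions drawn in round `t` are independent of the past. -/
lemma indep_past (i : Fin n) {t : ℕ} (ht : 1 ≤ t) :
    Indep (past u t) (MeasurableSpace.comap (u i t) inferInstance) μ := by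
  have hdisj : Disjoint {k : Fin n × ℕ | k.2 + 1 < t} {(i, t - 1)} := by
    rw [Set.disjoint_singleton_right]
    intro (hlt : t - 1 + 1 < t)
    omega
  have hind := indep_iSup_of_disjoint
    (fun k : Fin n × ℕ => (h.sampling.measurable k.1 (k.2 + 1) (by omega)).comap_le)
    h.sampling.indep.iIndep hdisj
  refine indep_of_indep_of_le_left (indep_of_indep_of_le_right hind ?_) ?_
  · obtain ⟨s, rfl⟩ := Nat.exists_eq_add_of_le' ht
    exact le_iSup₂_of_le (i, s) rfl le_rfl
  · refine iSup_le fun j => iSup_le fun s => iSup_le fun hs => ?_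
    obtain ⟨s', rfl⟩ := Nat.exists_eq_add_of_le' hs.1
    exact le_iSup₂_of_le (f := fun (k : Fin n × ℕ) (_ : k ∈ {k : Fin n × ℕ | k.2 + 1 < t}) =>
      MeasurableSpace.comap (u k.1 (k.2 + 1)) inferInstance) (j, s') hs.2 le_rfl

lemma measurable_past_direction (i : Fin n) {t : ℕ} (ht : 1 ≤ t)
    (hz : Measurable[past u t] (z i t)) (hqt : Measurable[past u t] (qt i (t + 1)))
    {β : Type*} {mβ : MeasurableSpace β} {Z : β → Ω} (hZ : Measurable[mβ, past u t] Z)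
    {v : β → Metric.sphere (0 : Vec (p i)) 1} (hv : Measurable v) :
    Measurable fun b => direction (r i * xi θ₃ i t) (f i t (Z b)) (g i t (Z b)) (z i t (Z b))
      (v b : Vec (p i)) (qt i (t + 1) (Z b)) :=
  measurable_direction (mΩ := past u t) (fun ω => (h.adversary.loss i t ω ht).continuousOn)
    (h.adversary.adapted_f i t ht) (fun ω j => (h.adversary.constraint i t ω ht j).continuousOn)
    (h.adversary.adapted_g i t ht) hZ (hz.comp hZ) (measurable_subtype_coe.comp hv) (hqt.comp hZ)
    fun b => h.add_mem i ht (Z b) (v b)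

/-- The state of the algorithm at the beginning of a round is determined by the past. -/
lemma measurable_past_state {t : ℕ} (ht : 1 ≤ t) :
    ∀ i, Measurable[past u t] (z i t) ∧ Measurable[past u t] (q i t) := by
  induction t, ht using Nat.le_induction with
  | base =>
    intro i
    obtain ⟨c, -, hz⟩ := h.run.z_init i
    rw [show z i 1 = fun _ => c from funext hz,
      show q i 1 = fun _ => 0 from funext (h.run.q_init i)]
    exact ⟨measurable_const, measurable_const⟩
  | succ t ht ih =>
    intro i
    have hle : past u t ≤ past u (t + 1) := past_mono u (Nat.le_succ t)
    have hqt : Measurable[past u t] (qt i (t + 1)) := by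
      rw [show qt i (t + 1) = fun ω => ∑ j, W t i j • q j t ω from
        funext fun ω => h.run.qt_step i t ω ht]
      exact Finset.measurable_sum _ fun j _ => (ih j).2.const_smul (W t i j)
    have hid : Measurable[past u (t + 1), past u t] (id : Ω → Ω) := measurable_id'' hle
    have hu := measurable_past_u u i ht
    have hz' := (ih i).1.mono hle le_rfl
    have ha := h.measurable_past_direction i ht (ih i).1 hqt hid hu
    have hx : Measurable[past u (t + 1)] (x i t) := by
      rw [show x i t = fun ω => z i t ω + (r i * xi θ₃ i t) • (u i t ω : Vec (p i)) from
        funext fun ω => h.x_eq i ht ω]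
      exact hz'.add ((measurable_subtype_coe.comp hu).const_smul (r i * xi θ₃ i t))
    have hg : Measurable[past u (t + 1)] fun ω => g i t ω (x i t ω) :=
      measurable_of_apply fun j => measurable_eval (mΩ := past u t)
        (fun ω => (h.adversary.constraint i t ω ht j).continuousOn)
        (fun y hy => h.adversary.adapted_g i t ht y hy j) hid hx (h.x_mem i ht)
    constructor
    · have hξ : (1 - xi θ₃ i (t + 1)) ≠ 0 := by
        have := xi_succ_lt_one h.θ₃_pos i t
        linarith
      refine measurable_of_isProjection ((h.sets.convex i).smul _)
        ((h.sets.closed i).smul_of_ne_zero hξ) (hz'.sub (ha.const_smul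
        (alpha m p r Fg θ₁ i (t + 1)))) fun ω => ?_
      exact (h.isPrimalRun i ω).z_step t ht
    · rw [show q i (t + 1) = fun ω => _ from funext fun ω => h.run.q_step i t ω ht]
      refine measurable_of_apply fun j => ?_
      have := ((hqt.mono hle le_rfl).const_smul
        (1 - beta θ₂ i (t + 1) * gamma θ₂ i (t + 1))).add (hg.const_smul (gamma θ₂ i (t + 1)))
      exact (((EuclideanSpace.proj (𝕜 := ℝ) j).continuous.measurable.comp this).max
        measurable_const)

lemma measurable_past_qt (i : Fin n) {t : ℕ} (ht : 1 ≤ t) :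
    Measurable[past u t] (qt i (t + 1)) := by
  rw [show qt i (t + 1) = fun ω => ∑ j, W t i j • q j t ω from
    funext fun ω => h.run.qt_step i t ω ht]
  exact Finset.measurable_sum _ fun j _ => (h.measurable_past_state ht j).2.const_smul (W t i j)

lemma measurable_x (i : Fin n) {t : ℕ} (ht : 1 ≤ t) : Measurable (x i t) := by
  rw [show x i t = fun ω => z i t ω + (r i * xi θ₃ i t) • (u i t ω : Vec (p i)) from
    funext fun ω => h.x_eq i ht ω]
  exact ((h.measurable_past_state ht i).1.mono (h.past_le t) le_rfl).add
    ((measurable_subtype_coe.comp (h.sampling.measurable i t ht)).const_smul (r i * xi θ₃ i t))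

lemma measurable_loss (i : Fin n) {t : ℕ} (ht : 1 ≤ t) :
    Measurable fun ω => f i t ω (x i t ω) :=
  measurable_eval (fun ω => (h.adversary.loss i t ω ht).continuousOn)
    (fun y hy => (h.adversary.adapted_f i t ht y hy).mono (h.past_le t) le_rfl) measurable_id
    (h.measurable_x i ht) (h.x_mem i ht)

lemma measurable_constraint (i : Fin n) {t : ℕ} (ht : 1 ≤ t) :
    Measurable fun ω => g i t ω (x i t ω) :=
  measurable_of_apply fun j =>
    measurable_eval (fun ω => (h.adversary.constraint i t ω ht j).continuousOn)
      (fun y hy => (h.adversary.adapted_g i t ht y hy j).mono (h.past_le t) le_rfl) measurable_id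
      (h.measurable_x i ht) (h.x_mem i ht)

lemma norm_direction_le (i : Fin n) {t : ℕ} (ht : 1 ≤ t) (ω : Ω)
    (v : Metric.sphere (0 : Vec (p i)) 1) :
    ‖direction (r i * xi θ₃ i t) (f i t ω) (g i t ω) (z i t ω) (v : Vec (p i)) (qt i (t + 1) ω)‖ ≤
      p i / (r i * xi θ₃ i t) *
        (Ff i + √m * FgMax Fg * (√m * FgMax Fg * (t : ℝ) ^ θ₂ / 2)) := by
  have hr := h.sets.r_pos i
  have hξ := xi_pos θ₃ i t
  have hF := h.FgMax_pos
  refine (DBCO.norm_direction_le (mul_pos hr hξ) _ (norm_eq_of_mem_sphere v)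
    ((h.adversary.loss i t ω ht).bounded _ (h.add_mem i ht ω v))
    (h.norm_constraint_le i ht ω (h.add_mem i ht ω v))).trans ?_
  have := h.norm_qt_le i ht ω
  gcongr

variable [IsProbabilityMeasure μ]

lemma integral_noiseTerm_nonpos (i : Fin n) {T : ℕ} (hT : 1 ≤ T) :
    Integrable (fun ω => IsPrimalRun.noiseTerm (alpha m p r Fg θ₁ i) (xi θ₃ i) (fun t => z i t ω)
      (fun t => direction (r i * xi θ₃ i t) (f i t ω) (g i t ω) (z i t ω) (u i t ω : Vec (p i))
        (qt i (t + 1) ω))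
      (IsPrimalRun.noise (r i) (xi θ₃ i) (fun t => f i t ω) (fun t => g i t ω) (fun t => u i t ω)
        (fun t => z i t ω) fun t => qt i t ω) T) μ ∧
    ∫ ω, IsPrimalRun.noiseTerm (alpha m p r Fg θ₁ i) (xi θ₃ i) (fun t => z i t ω)
      (fun t => direction (r i * xi θ₃ i t) (f i t ω) (g i t ω) (z i t ω) (u i t ω : Vec (p i))
        (qt i (t + 1) ω))
      (IsPrimalRun.noise (r i) (xi θ₃ i) (fun t => f i t ω) (fun t => g i t ω) (fun t => u i t ω)
        (fun t => z i t ω) fun t => qt i t ω) T ∂μ ≤ 0 := by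
  have hprob := isProbabilityMeasure_uniformSphere (h.p_pos i)
  have hzm := fun t (ht : 1 ≤ t) => (h.measurable_past_state ht i).1
  have hqm := fun t (ht : 1 ≤ t) => h.measurable_past_qt i ht
  have hjoint : ∀ t, 1 ≤ t →
      Measurable[(past u t).prod inferInstance] fun y : Ω × Metric.sphere (0 : Vec (p i)) 1 =>
        direction (r i * xi θ₃ i t) (f i t y.1) (g i t y.1) (z i t y.1) (y.2 : Vec (p i))
          (qt i (t + 1) y.1) := fun t ht =>
    h.measurable_past_direction i ht (hzm t ht) (hqm t ht)
      (@measurable_fst Ω _ (past u t) _) (@measurable_snd Ω _ (past u t) _)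
  refine DBCO.integral_noiseTerm_nonpos (𝓕 := past u) h.past_le (past_mono u)
    (z := z i)
    (a := fun t ω => direction (r i * xi θ₃ i t) (f i t ω) (g i t ω) (z i t ω)
      (u i t ω : Vec (p i)) (qt i (t + 1) ω))
    (M := fun t ω => meanDirection (r i * xi θ₃ i t) (f i t ω) (g i t ω) (z i t ω)
      (qt i (t + 1) ω))
    (fun t ht => alpha_pos h.m_pos (h.p_pos i) (h.sets.r_pos i) (h.adversary.Fg_pos i) ht)
    (fun t ht => alpha_anti h.m_pos (by linarith [h.θ₁_mem.1]) (h.p_pos i)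
      (h.adversary.Fg_pos i) ht)
    (fun t _ => xi_pos θ₃ i t) (fun t _ => xi_le_one h.θ₃_pos.le i t) hzm ?_ ?_
    (fun t ht ω => (h.isPrimalRun i ω).norm_z_le ht)
    (C := fun t => p i / (r i * xi θ₃ i t) *
        (Ff i + √m * FgMax Fg * (√m * FgMax Fg * (t : ℝ) ^ θ₂ / 2)))
    ?_ (fun t ht ω => h.norm_direction_le i ht ω _) ?_ hT
  · intro t ht
    exact (@StronglyMeasurable.integral_prod_right' Ω _ _ (past u t) _ (uniformSphere (p i)) _ _ _
      (fun y => direction (r i * xi θ₃ i t) (f i t y.1) (g i t y.1) (z i t y.1) (y.2 : Vec (p i))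
          (qt i (t + 1) y.1)) (hjoint t ht).stronglyMeasurable).measurable
  · intro t ht
    exact h.measurable_past_direction i ht (hzm t ht) (hqm t ht)
      (measurable_id'' (past_mono u (Nat.le_succ t))) (measurable_past_u u i ht)
  · intro t ht ω
    simpa [meanDirection] using norm_integral_le_of_norm_le_const (μ := uniformSphere (p i))
      (ae_of_all _ fun v => h.norm_direction_le i ht ω v)
  · intro t ht Z D hZ hD
    have := integral_inner_sub_eq_zero (h.past_le t) (h.sampling.measurable i t ht)
      (h.indep_past i ht) (hjoint t ht) (fun ω v => h.norm_direction_le i ht ω v) hZ hD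
    rwa [h.sampling.uniform i t ht] at this

/-- The pathwise regret inequality, up to a random variable of nonpositive mean that depends
neither on the comparator nor on the multiplier. -/
lemma exists_noise {T : ℕ} (hT : 1 ≤ T) : ∃ N : Ω → ℝ, Integrable N μ ∧ ∫ ω, N ω ∂μ ≤ 0 ∧
    ∀ ω, ∀ y ∈ staticFeasible X (fun i t => g i t ω) T, ∀ ν : Vec m, (∀ j, 0 ≤ ν j) →
      regret (fun i t => f i t ω) T (fun i t => x i t ω) (fun i _ => y i)
        + inner ℝ ν (∑ t ∈ Icc 1 T, ∑ i, g i t ω (x i t ω)) ≤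
      C1 m p r R Ff Fg Gf Gg w ι θ₁ θ₂ θ₃ * (T : ℝ) ^ θ₁ + N ω
        + n * (1 / 6 + 5 / 6 * ∑ t ∈ Icc 1 T, ((t : ℝ) + 1) ^ (-θ₂)) * ‖ν‖ ^ 2 := by
  refine ⟨_, integrable_finsetSum univ fun i _ => (h.integral_noiseTerm_nonpos i hT).1, ?_, ?_⟩
  · rw [integral_finsetSum _ fun i _ => (h.integral_noiseTerm_nonpos i hT).1]
    exact sum_nonpos fun i _ => (h.integral_noiseTerm_nonpos i hT).2
  · intro ω y hy ν hν
    exact pathwise_le h.n_pos h.m_pos h.graph h.θ₁_mem h.θ₂_eq h.θ₃_eq h.adversary.Ff_pos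
      h.adversary.Fg_pos h.adversary.Gf_pos h.adversary.Gg_pos (fun i => h.isPrimalRun i ω)
      (h.isDualRun ω) hT hy hν
      (fun i t => direction (r i * xi θ₃ i t) (f i t ω) (g i t ω) (z i t ω) (u i t ω : Vec (p i))
        (qt i (t + 1) ω)) fun i t => rfl

end

end StandingAssumption

end RandomRun

/-! ### Expected regret and expected violation -/

section Expectation

open Finset

/-- The factor of `‖ν‖²` in the pathwise inequality is dominated by `C_{2,1} T^{1-θ₂}`. -/
lemma four_mul_le_C21_mul {n : ℕ} {Ff Fg : Fin n → ℝ} {θ₁ θ₂ θ₃ : ℝ}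
    (hθ₁ : θ₁ ∈ Set.Ioc (3 / 4 : ℝ) (5 / 6)) (hθ₂ : θ₂ = 2 * θ₁ - 3 / 2) (hθ₃ : θ₃ = θ₁ - 1 / 2)
    {T : ℕ} (hT : 1 ≤ T) :
    4 * n * (1 / 6 + 5 / 6 * ∑ t ∈ Icc 1 T, ((t : ℝ) + 1) ^ (-θ₂)) ≤
      C21 Ff Fg θ₁ θ₂ θ₃ * (T : ℝ) ^ (1 - θ₂) := by
  obtain ⟨ha, hb⟩ := hθ₁
  have h1 : 0 < 1 - θ₂ := by linarith
  have hT' : (1 : ℝ) ≤ T := by exact_mod_cast hT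
  have hsum := sum_rpow_neg_le' (s := θ₂) (by linarith) (by linarith) hT
  set Y := (T : ℝ) ^ (1 - θ₂) with hY
  have hY1 : 1 ≤ Y := Real.one_le_rpow hT' h1.le
  set s := 1 / (1 - θ₂) with hs
  have hs' : s * (1 - θ₂) = 1 := by rw [hs]; field_simp
  have hs1 : 1 ≤ s := by
    rw [hs, le_div_iff₀ h1]; linarith
  have hs2 : s ≤ 6 / 5 := by
    rw [hs, div_le_iff₀ h1]; linarith
  have hsup : 0 ≤ ⨆ i, Ff i ^ 2 / (Fg i ^ 2 * (1 - θ₁ + 2 * θ₃)) :=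
    Real.iSup_nonneg fun i => div_nonneg (sq_nonneg _) (mul_nonneg (sq_nonneg _) (by linarith))
  have hdiv : (Y - θ₂) / (1 - θ₂) = s * Y - (s - 1) := by
    rw [hs]; field_simp; ring
  rw [hdiv] at hsum
  have hmain : 4 * (1 / 6 + 5 / 6 * ∑ t ∈ Icc 1 T, ((t : ℝ) + 1) ^ (-θ₂)) ≤ 2 * (1 + s) * Y := by
    nlinarith
  have hmono : 2 * (1 + s) * Y ≤
      2 * (1 + (⨆ i, Ff i ^ 2 / (Fg i ^ 2 * (1 - θ₁ + 2 * θ₃))) + s) * Y := by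
    gcongr
    linarith
  rw [C21]
  calc 4 * n * (1 / 6 + 5 / 6 * ∑ t ∈ Icc 1 T, ((t : ℝ) + 1) ^ (-θ₂))
      = n * (4 * (1 / 6 + 5 / 6 * ∑ t ∈ Icc 1 T, ((t : ℝ) + 1) ^ (-θ₂))) := by ring
    _ ≤ n * (2 * (1 + (⨆ i, Ff i ^ 2 / (Fg i ^ 2 * (1 - θ₁ + 2 * θ₃))) + s) * Y) :=
        mul_le_mul_of_nonneg_left (hmain.trans hmono) n.cast_nonneg
    _ = _ := by ring

namespace StandingAssumption

variable {n m : ℕ} {p : Fin n → ℕ} {Ω : Type*} [mΩ : MeasurableSpace Ω] {μ : Measure Ω}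
  {u : (i : Fin n) → ℕ → Ω → Metric.sphere (0 : Vec (p i)) 1}
  {G : ℕ → Digraph (Fin n)} {W : ℕ → Matrix (Fin n) (Fin n) ℝ} {w : ℝ} {ι : ℕ}
  {X : (i : Fin n) → Set (Vec (p i))} {r R : Fin n → ℝ}
  {f : (i : Fin n) → ℕ → Ω → Vec (p i) → ℝ} {g : (i : Fin n) → ℕ → Ω → Vec (p i) → Vec m}
  {Ff Fg Gf Gg : Fin n → ℝ} {θ₁ θ₂ θ₃ : ℝ} {z x : (i : Fin n) → ℕ → Ω → Vec (p i)}
  {q qt : Fin n → ℕ → Ω → Vec m}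
  (h : StandingAssumption μ u G W w ι X r R f g Ff Fg Gf Gg θ₁ θ₂ θ₃ z x q qt)

include h

lemma C1_nonneg : 0 ≤ C1 m p r R Ff Fg Gf Gg w ι θ₁ θ₂ θ₃ := by
  obtain ⟨ha, hb⟩ := h.θ₁_mem
  have h2 := h.θ₂_eq
  have h3 := h.θ₃_eq
  have e1 : 0 ≤ 1 - θ₃ + θ₂ := by linarith
  have e2 : 0 ≤ 1 - θ₃ := by linarith
  have e3 : 0 ≤ 1 - θ₁ + 2 * θ₃ := by linarith
  have hF := h.FgMax_pos
  have hw := h.graph.w_pos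
  have hC0 : 0 ≤ C0 m Fg w ι :=
    le_trans (by positivity) (consensus_const_le_C0 h.n_pos hw h.graph.w_lt_one h.graph.ι_pos)
  refine add_nonneg (sum_nonneg fun i _ => ?_) (div_nonneg hC0 h.θ₂_nonneg)
  have hr := h.sets.r_pos i
  have hR := h.sets.R_pos i
  have hGg := h.adversary.Gg_pos i
  have hGf := h.adversary.Gf_pos i
  positivity

lemma abs_sum_loss_le {T : ℕ} (ω : Ω) {y : (i : Fin n) → ℕ → Vec (p i)}
    (hy : ∀ i t, 1 ≤ t → y i t ∈ X i) :
    |∑ t ∈ Icc 1 T, ∑ i, f i t ω (y i t)| ≤ T * ∑ i, Ff i := by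
  refine (abs_sum_le_sum_abs _ _).trans ?_
  calc ∑ t ∈ Icc 1 T, |∑ i, f i t ω (y i t)| ≤ ∑ _t ∈ Icc 1 T, ∑ i, Ff i := by
        refine sum_le_sum fun t ht => (abs_sum_le_sum_abs _ _).trans (sum_le_sum fun i _ => ?_)
        have ht1 := (mem_Icc.1 ht).1
        exact (h.adversary.loss i t ω ht1).bounded _ (hy i t ht1)
    _ = T * ∑ i, Ff i := by simp

/-- The optimal value in hindsight is a random variable, whether or not the chosen minimizers
depend measurably on the outcome. -/
lemma measurable_optimal_value {T : ℕ} {xstar : Ω → (i : Fin n) → Vec (p i)}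
    (hopt : ∀ ω, IsStaticOptimum X (fun i t => f i t ω) (fun i t => g i t ω) T (xstar ω)) :
    Measurable fun ω => ∑ t ∈ Icc 1 T, ∑ i, f i t ω (xstar ω i) := by
  refine measurable_of_Iic fun c => ?_
  have hcomp : ∀ i, CompactSpace (X i) := fun i => isCompact_iff_compactSpace.1
    ((isCompact_closedBall 0 (R i)).of_isClosed_subset (h.sets.closed i) (h.sets.outer_ball i))
  let Φ : Option ({t // t ∈ Icc 1 T} × Fin m) → Ω → ((i : Fin n) → X i) → ℝ := fun l ω y =>
    l.elim (∑ t ∈ Icc 1 T, ∑ i, f i t ω (y i) - c) fun k => (∑ i, g i k.1 ω (y i)) k.2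
  have hset : (fun ω => ∑ t ∈ Icc 1 T, ∑ i, f i t ω (xstar ω i)) ⁻¹' Set.Iic c =
      {ω | ∃ y, ∀ l, Φ l ω y ≤ 0} := by
    ext ω
    constructor
    · intro (hω : _ ≤ c)
      refine ⟨fun i => ⟨xstar ω i, (hopt ω).1.1 i⟩, fun l => ?_⟩
      cases l with
      | none => exact sub_nonpos.2 hω
      | some k => exact (hopt ω).1.2 k.1 k.1.2 k.2
    · rintro ⟨y, hy⟩
      refine ((hopt ω).2 (fun i => y i) ⟨fun i => (y i).2, fun t ht j => ?_⟩).trans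
        (sub_nonpos.1 (hy none))
      exact hy (some (⟨t, ht⟩, j))
  rw [hset]
  refine measurableSet_exists_forall_le (fun l ω => ?_) fun l y => ?_
  · cases l with
    | none =>
      refine Continuous.sub (continuous_finsetSum _ fun t ht =>
        continuous_finsetSum _ fun i _ => ?_) continuous_const
      exact (h.adversary.loss i t ω (mem_Icc.1 ht).1).continuousOn.comp_continuous
        (continuous_subtype_val.comp (continuous_apply i)) fun y => (y i).2
    | some k =>
      simp only [Φ, Option.elim, WithLp.ofLp_sum, Finset.sum_apply]
      refine continuous_finsetSum _ fun i _ => ?_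
      exact (h.adversary.constraint i k.1 ω (mem_Icc.1 k.1.2).1 k.2).continuousOn.comp_continuous
        (continuous_subtype_val.comp (continuous_apply i)) fun y => (y i).2
  · cases l with
    | none =>
      refine Measurable.sub (Finset.measurable_sum _ fun t ht =>
        Finset.measurable_sum _ fun i _ => ?_) measurable_const
      exact (h.adversary.adapted_f i t (mem_Icc.1 ht).1 _ (y i).2).mono (h.past_le t) le_rfl
    | some k =>
      simp only [Φ, Option.elim, WithLp.ofLp_sum, Finset.sum_apply]
      refine Finset.measurable_sum _ fun i _ => ?_
      exact (h.adversary.adapted_g i k.1 (mem_Icc.1 k.1.2).1 _ (y i).2 k.2).mono (h.past_le _)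
        le_rfl

variable [IsProbabilityMeasure μ]

lemma integral_regret_le {T : ℕ} (hT : 1 ≤ T) {xstar : Ω → (i : Fin n) → Vec (p i)}
    (hopt : ∀ ω, IsStaticOptimum X (fun i t => f i t ω) (fun i t => g i t ω) T (xstar ω)) :
    Integrable (fun ω => regret (fun i t => f i t ω) T (fun i t => x i t ω)
      (fun i _ => xstar ω i)) μ ∧
    ∫ ω, regret (fun i t => f i t ω) T (fun i t => x i t ω) (fun i _ => xstar ω i) ∂μ
      ≤ C1 m p r R Ff Fg Gf Gg w ι θ₁ θ₂ θ₃ * (T : ℝ) ^ θ₁ := by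
  obtain ⟨N, hNi, hN0, hN⟩ := h.exists_noise hT
  have hint : Integrable (fun ω => regret (fun i t => f i t ω) T (fun i t => x i t ω)
      (fun i _ => xstar ω i)) μ := by
    refine Integrable.sub (integrable_of_norm_le (Finset.measurable_sum _ fun t ht =>
      Finset.measurable_sum _ fun i _ => h.measurable_loss i (mem_Icc.1 ht).1) (C := T * ∑ i, Ff i)
      fun ω => ?_) (integrable_of_norm_le (h.measurable_optimal_value hopt) (C := T * ∑ i, Ff i)
      fun ω => ?_)
    · exact h.abs_sum_loss_le ω fun i t ht => h.x_mem i ht ω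
    · exact h.abs_sum_loss_le ω (y := fun i _ => xstar ω i) fun i t ht => (hopt ω).1.1 i
  refine ⟨hint, ?_⟩
  calc ∫ ω, regret (fun i t => f i t ω) T (fun i t => x i t ω) (fun i _ => xstar ω i) ∂μ
      ≤ ∫ ω, (C1 m p r R Ff Fg Gf Gg w ι θ₁ θ₂ θ₃ * (T : ℝ) ^ θ₁ + N ω) ∂μ := by
        refine integral_mono hint ((integrable_const _).add hNi) fun ω => ?_
        simpa using hN ω _ (hopt ω).1 0 fun j => le_rfl
    _ ≤ _ := by
        rw [integral_add (integrable_const _) hNi]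
        simpa using hN0

/-- The violation is recovered from the pathwise inequality by maximizing over the multiplier: the
regret cannot be smaller than `-2 T ∑ F_f`. -/
lemma exists_violation_sq_le {T : ℕ} (hT : 1 ≤ T)
    (hfeas : ∀ ω, (staticFeasible X (fun i t => g i t ω) T).Nonempty) :
    ∃ N : Ω → ℝ, Integrable N μ ∧ ∫ ω, N ω ∂μ ≤ 0 ∧ ∀ ω,
      violation (fun i t => g i t ω) T (fun i t => x i t ω) ^ 2 ≤
        4 * n * (1 / 6 + 5 / 6 * ∑ t ∈ Icc 1 T, ((t : ℝ) + 1) ^ (-θ₂)) *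
          (C1 m p r R Ff Fg Gf Gg w ι θ₁ θ₂ θ₃ * (T : ℝ) ^ θ₁ + 2 * (T * ∑ i, Ff i) + N ω) := by
  obtain ⟨N, hNi, hN0, hN⟩ := h.exists_noise hT
  refine ⟨N, hNi, hN0, fun ω => ?_⟩
  obtain ⟨y, hy⟩ := hfeas ω
  have hn : (0 : ℝ) < n := by exact_mod_cast h.n_pos
  set A := 1 / 6 + 5 / 6 * ∑ t ∈ Icc 1 T, ((t : ℝ) + 1) ^ (-θ₂) with hA
  have hA0 : 0 < A := by positivity
  set V := ∑ t ∈ Icc 1 T, ∑ i, g i t ω (x i t ω) with hV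
  set s := 1 / (2 * n * A) with hs
  have hs0 : 0 < s := by positivity
  have hmain := hN ω y hy (s • orthantProj V) fun j =>
    mul_nonneg hs0.le (orthantProj_nonneg V j)
  rw [real_inner_smul_left, inner_orthantProj_self, norm_smul, Real.norm_of_nonneg hs0.le,
    mul_pow] at hmain
  have hx := (abs_le.1 (h.abs_sum_loss_le (T := T) ω fun i t ht => h.x_mem i ht ω)).1
  have hyb := (abs_le.1 (h.abs_sum_loss_le (T := T) ω (y := fun i _ => y i)
    fun i t _ => hy.1 i)).2
  have hreg : -(2 * (T * ∑ i, Ff i)) ≤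
      regret (fun i t => f i t ω) T (fun i t => x i t ω) (fun i _ => y i) := by
    rw [regret]; linarith
  have e1 : s * ‖orthantProj V‖ ^ 2 - n * A * (s ^ 2 * ‖orthantProj V‖ ^ 2) =
      ‖orthantProj V‖ ^ 2 / (4 * n * A) := by
    rw [hs]; field_simp; ring
  have h2 : ‖orthantProj V‖ ^ 2 / (4 * n * A) ≤ C1 m p r R Ff Fg Gf Gg w ι θ₁ θ₂ θ₃ * (T : ℝ) ^ θ₁
      + 2 * (T * ∑ i, Ff i) + N ω := by
    linarith
  rw [div_le_iff₀ (by positivity)] at h2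
  rw [violation, ← hV]
  linarith

lemma integral_violation_le {T : ℕ} (hT : 1 ≤ T)
    (hfeas : ∀ ω, (staticFeasible X (fun i t => g i t ω) T).Nonempty) :
    Integrable (fun ω => violation (fun i t => g i t ω) T (fun i t => x i t ω)) μ ∧
    ∫ ω, violation (fun i t => g i t ω) T (fun i t => x i t ω) ∂μ
      ≤ √(C2 m p r R Ff Fg Gf Gg w ι θ₁ θ₂ θ₃) * (T : ℝ) ^ (7 / 4 - θ₁) := by
  obtain ⟨N, hNi, hN0, hN⟩ := h.exists_violation_sq_le hT hfeas
  set v : Ω → ℝ := fun ω => violation (fun i t => g i t ω) T (fun i t => x i t ω) with hv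
  set A := 1 / 6 + 5 / 6 * ∑ t ∈ Icc 1 T, ((t : ℝ) + 1) ^ (-θ₂) with hA
  set c := C1 m p r R Ff Fg Gf Gg w ι θ₁ θ₂ θ₃ with hc
  have hc0 : 0 ≤ c := h.C1_nonneg
  have hn : (0 : ℝ) < n := by exact_mod_cast h.n_pos
  have hT' : (1 : ℝ) ≤ T := by exact_mod_cast hT
  have hT0 : (0 : ℝ) < T := by linarith
  have hA0 : 0 < A := by positivity
  have hFf : 0 < ∑ i, Ff i :=
    sum_pos (fun i _ => h.adversary.Ff_pos i) ⟨⟨0, h.n_pos⟩, mem_univ _⟩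
  have hA4 : 4 * n * A ≤ C21 Ff Fg θ₁ θ₂ θ₃ * (T : ℝ) ^ (1 - θ₂) :=
    four_mul_le_C21_mul h.θ₁_mem h.θ₂_eq h.θ₃_eq hT
  have hC21 : 0 < C21 Ff Fg θ₁ θ₂ θ₃ := by
    refine pos_of_mul_pos_left (lt_of_lt_of_le ?_ hA4) (by positivity)
    positivity
  have hC2 : 0 < C2 m p r R Ff Fg Gf Gg w ι θ₁ θ₂ θ₃ := mul_pos hC21 (by positivity)
  have hvm : Measurable v := by
    have : Measurable fun ω => ∑ t ∈ Icc 1 T, ∑ i, g i t ω (x i t ω) :=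
      Finset.measurable_sum _ fun t ht => Finset.measurable_sum _ fun i _ =>
        h.measurable_constraint i (mem_Icc.1 ht).1
    refine Measurable.norm (measurable_of_apply fun j => ?_)
    exact ((EuclideanSpace.proj (𝕜 := ℝ) j).continuous.measurable.comp this).max measurable_const
  have hbound : Integrable (fun ω => 4 * n * A * (c * (T : ℝ) ^ θ₁ + 2 * (T * ∑ i, Ff i) + N ω))
      μ := ((integrable_const _).add hNi).const_mul _
  have hv2 : Integrable (fun ω => v ω ^ 2) μ :=
    hbound.mono' (hvm.pow_const 2).aestronglyMeasurable (ae_of_all _ fun ω => by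
      rw [Real.norm_of_nonneg (sq_nonneg _)]
      exact hN ω)
  set b := √(C2 m p r R Ff Fg Gf Gg w ι θ₁ θ₂ θ₃) * (T : ℝ) ^ (7 / 4 - θ₁) with hb
  have hb0 : 0 < b := by positivity
  have hb2 : b ^ 2 = C21 Ff Fg θ₁ θ₂ θ₃ * (T : ℝ) ^ (1 - θ₂) * ((c + 2 * ∑ i, Ff i) * T) := by
    have e : ((T : ℝ) ^ (7 / 4 - θ₁)) ^ 2 = (T : ℝ) ^ (1 - θ₂) * T := by
      rw [← Real.rpow_natCast, ← Real.rpow_mul hT0.le, ← Real.rpow_add_one hT0.ne']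
      congr 1
      rw [h.θ₂_eq]; push_cast; ring
    rw [hb, mul_pow, Real.sq_sqrt hC2.le, e, C2]
    ring
  have hEv2 : ∫ ω, v ω ^ 2 ∂μ ≤ b ^ 2 := by
    calc ∫ ω, v ω ^ 2 ∂μ
        ≤ ∫ ω, 4 * n * A * (c * (T : ℝ) ^ θ₁ + 2 * (T * ∑ i, Ff i) + N ω) ∂μ :=
          integral_mono hv2 hbound hN
      _ = 4 * n * A * (c * (T : ℝ) ^ θ₁ + 2 * (T * ∑ i, Ff i) + ∫ ω, N ω ∂μ) := by
          rw [integral_const_mul, integral_add (integrable_const _) hNi]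
          simp
      _ ≤ 4 * n * A * ((c + 2 * ∑ i, Ff i) * T) := by
          have hTθ : (T : ℝ) ^ θ₁ ≤ T := by
            simpa using Real.rpow_le_rpow_of_exponent_le hT' (by linarith [h.θ₁_mem.2] : θ₁ ≤ 1)
          have := mul_le_mul_of_nonneg_left hTθ hc0
          refine mul_le_mul_of_nonneg_left ?_ (by positivity)
          linarith
      _ ≤ b ^ 2 := by
          rw [hb2]
          gcongr
  -- `v ≤ (v² + b²) / (2b)` bounds the first moment by the second
  have hle : ∀ ω, v ω ≤ (2 * b)⁻¹ * (v ω ^ 2 + b ^ 2) := fun ω => by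
    rw [inv_mul_eq_div, le_div_iff₀ (by positivity)]
    nlinarith [sq_nonneg (v ω - b)]
  have hvi : Integrable (fun ω => (2 * b)⁻¹ * (v ω ^ 2 + b ^ 2)) μ :=
    (hv2.add (integrable_const _)).const_mul _
  have hvint : Integrable v μ := hvi.mono' hvm.aestronglyMeasurable (ae_of_all _ fun ω => by
    rw [Real.norm_of_nonneg (show 0 ≤ v ω from norm_nonneg _)]
    exact hle ω)
  refine ⟨hvint, (integral_mono hvint hvi hle).trans ?_⟩
  rw [integral_const_mul, integral_add hv2 (integrable_const _), inv_mul_eq_div,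
    div_le_iff₀ (by positivity)]
  simp only [integral_const, probReal_univ, one_smul]
  linarith

end StandingAssumption

end Expectation

end DBCO

theorem corollary1 {n m : ℕ} (hn : 0 < n) (hm : 0 < m) (p : Fin n → ℕ) (hp : ∀ i, 0 < p i)
    {Ω : Type*} [MeasurableSpace Ω] (μ : Measure Ω) [IsProbabilityMeasure μ]
    (u : (i : Fin n) → ℕ → Ω → Metric.sphere (0 : DBCO.Vec (p i)) 1)
    (hu : DBCO.IsUniformSampling μ u)
    (G : ℕ → Digraph (Fin n)) (W : ℕ → Matrix (Fin n) (Fin n) ℝ) (w : ℝ) (ι : ℕ)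
    (hG : DBCO.GraphAssumption G W w ι)
    (X : (i : Fin n) → Set (DBCO.Vec (p i))) (r R : Fin n → ℝ)
    (hX : DBCO.SetAssumption X r R)
    (f : (i : Fin n) → ℕ → Ω → DBCO.Vec (p i) → ℝ)
    (g : (i : Fin n) → ℕ → Ω → DBCO.Vec (p i) → DBCO.Vec m)
    (Ff Fg Gf Gg : Fin n → ℝ)
    (hfg : DBCO.AdversaryAssumption X u f g Ff Fg Gf Gg)
    (hfeas : ∀ ω, ∀ T : ℕ, 1 ≤ T →
      (DBCO.staticFeasible X (fun i t => g i t ω) T).Nonempty)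
    (θ₁ θ₂ θ₃ : ℝ) (hθ₁ : θ₁ ∈ Set.Ioc (3 / 4 : ℝ) (5 / 6))
    (hθ₂ : θ₂ = 2 * θ₁ - 3 / 2) (hθ₃ : θ₃ = θ₁ - 1 / 2)
    (z x : (i : Fin n) → ℕ → Ω → DBCO.Vec (p i)) (q qt : Fin n → ℕ → Ω → DBCO.Vec m)
    (hrun : DBCO.IsOnePointRun W X u f g (DBCO.alpha m p r Fg θ₁) (DBCO.beta θ₂) (DBCO.gamma θ₂)
      (DBCO.xi θ₃) (DBCO.delta r θ₃) z x q qt)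
    (T : ℕ) (hT : 1 ≤ T) :
    (∀ xstar : Ω → (i : Fin n) → DBCO.Vec (p i),
      (∀ ω, DBCO.IsStaticOptimum X (fun i t => f i t ω) (fun i t => g i t ω) T (xstar ω)) →
      Integrable (fun ω => DBCO.regret (fun i t => f i t ω) T (fun i t => x i t ω)
        (fun i _ => xstar ω i)) μ ∧
      ∫ ω, DBCO.regret (fun i t => f i t ω) T (fun i t => x i t ω) (fun i _ => xstar ω i) ∂μ
        ≤ DBCO.C1 m p r R Ff Fg Gf Gg w ι θ₁ θ₂ θ₃ * (T : ℝ) ^ θ₁) ∧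
    Integrable (fun ω => DBCO.violation (fun i t => g i t ω) T (fun i t => x i t ω)) μ ∧
    ∫ ω, DBCO.violation (fun i t => g i t ω) T (fun i t => x i t ω) ∂μ
      ≤ √(DBCO.C2 m p r R Ff Fg Gf Gg w ι θ₁ θ₂ θ₃) * (T : ℝ) ^ (7 / 4 - θ₁) := by
  have h : DBCO.StandingAssumption μ u G W w ι X r R f g Ff Fg Gf Gg θ₁ θ₂ θ₃ z x q qt :=
    ⟨hn, hm, hp, hu, hG, hX, hfg, hθ₁, hθ₂, hθ₃, hrun⟩
  exact ⟨fun xstar hopt => h.integral_regret_le hT hopt,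
    h.integral_violation_le hT fun ω => hfeas ω T hT⟩
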